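/- **Setting.** Let $0<M<N$ be integers. Site $i\in\{1,\dots,N\}$ has parameters $A_i,C_i,\kappa_i\in\mathbb R$, $W_i>0$, $V_i>0$, $T_i\ge 0$ and an initial variance $\Sigma_{i,0}>0$. An observation policy for site $i$ is a measurable function of time $\pi_i(t)\in\{0,1\}$ ($1$ = observed, active; $0$ = passive); the error variance of the site then solves $$\dot\Sigma_i=2A_i\Sigma_i+W_i-\pi_i\frac{C_i^2}{V_i}\Sigma_i^2,\qquad \Sigma_i(0)=\Sigma_{i,0}.$$ The scheduling problem is to minimize the performance $\limsup_{\tau\to\infty}\frac1\tau\int_0^\tau\sum_{i}\big(T_i\Sigma_i(t)+\kappa_i\pi_i(t)\big)dt$ subject to $\sum_i\pi_i(t)=M$ for all $t$. Its relaxation replaces this constraint by $\limsup_{\tau\to\infty}\frac1\tau\int_0^\tau\sum_i\pi_i(t)\,dt=M$; the optimal value of the relaxation is the lower bound on the achievable performance. For $\lambda\in\mathbb R$ put $$\gamma(\lambda)=\min_\pi\Big\{\limsup_{\tau\to\infty}\frac1\tau\int_0^\tau\sum_{i=1}^N\big(T_i\Sigma_i+(\kappa_i+\lambda)\pi_i\big)dt\Big\}-\lambda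 M,\qquad \gamma^i(\lambda)=\min_{\pi_i}\limsup_{\tau\to\infty}\frac1\tau\int_0^\tau\big(T_i\Sigma_i+(\kappa_i+\lambda)\pi_i\big)dt .$$ A relative value function of site $i$ for $\lambda$ is a $C^1$ function $h$ on $[0,\infty)$, bounded below, such that for all $\Sigma\ge0$ (index $i$ dropped) $$\gamma^i(\lambda)=\min\Big\{T\Sigma+(2A\Sigma+W)h'(\Sigma),\ T\Sigma+\kappa+\lambda+\big(2A\Sigma+W-\tfrac{C^2}{V}\Sigma^2\big)h'(\Sigma)\Big\}.$$ The passive action is optimal at $\Sigma$ if the first term attains the minimum; $\mathcal P^i(\lambda)\subseteq[0,\infty)$ is the set of such $\Sigma$. Site $i$ is indexable if $\mathcal P^i(\lambda)$ is nondecreasing in $\lambda$ with $\bigcap_\lambda\mathcal P^i(\lambda)=\emptyset$ and $\bigcup_\lambda\mathcal P^i(\lambda)=[0,\infty)$, and its Whittle index is $\lambda_i(\Sigma)=\inf\{\lambda:\Sigma\in\mathcal P^i(\lambda)\}$. If $C_i\ne0$, let $$x_{1,i}=\frac{A_i-\sqrt{A_i^2+C_i^2W_i/V_i}}{C_i^2/V_i}<0<x_{2,i}=\frac{A_i+\sqrt{A_i^2+C_i^2W_i/V_i}}{C_i^2/V_i},$$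 and let $x_{e,i}=-\frac{W_i}{2A_i}$ if $A_i<0$, $x_{e,i}=+\infty$ and $\lambda_i(x_{e,i})=+\infty$ if $A_i\ge0$. **Theorem.** (a) Every site such that $A_i<0$ whenever $C_i=0$ and $T_i\neq0$ (in particular every detectable site) has, for each $\lambda$, a relative value function, unique up to an additive constant, and is indexable. Its Whittle index is, for $\Sigma\ge0$: if $C_i=0$ or $T_i=0$, $\lambda_i(\Sigma)=-\kappa_i$; if $C_i\ne0$ and $T_i\neq0$, $$\lambda_i(\Sigma)=\begin{cases}-\kappa_i+\dfrac{T_i\Sigma^2}{\Sigma-x_{1,i}}&\text{if }\Sigma\le x_{2,i},\\[2mm]-\kappa_i+\dfrac{C_i^2}{2V_i}\dfrac{T_i\Sigma^3}{A_i\Sigma+W_i}&\text{if }x_{2,i}<\Sigma<x_{e,i},\\[2mm]-\kappa_i+\dfrac{T_iC_i^2\Sigma^2}{2|A_i|V_i}&\text{if }x_{e,i}\le\Sigma.\end{cases}$$ (b) For every site the minimum $\gamma^i(\lambda)$ is attained, and: if $T_i=0$, $\gamma^i(\lambda)=\min\{\lambda+\kappa_i,0\}$; if $T_i\ne0$ and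 $C_i=0$, $\gamma^i(\lambda)=\frac{T_iW_i}{2|A_i|}+\min\{\lambda+\kappa_i,0\}$ when $A_i<0$ and $\gamma^i(\lambda)=+\infty$ when $A_i\ge0$; if $T_i\neq0$ and $C_i\ne0$, $$\gamma^i(\lambda)=\begin{cases}T_ix_{2,i}+\kappa_i+\lambda&\text{if }\lambda\le\lambda_i(x_{2,i}),\\[1mm]T_i\Sigma_i^*(\lambda)+\dfrac{V_i(\kappa_i+\lambda)(2A_i\Sigma_i^*(\lambda)+W_i)}{C_i^2\,\Sigma_i^*(\lambda)^2}&\text{if }\lambda_i(x_{2,i})<\lambda<\lambda_i(x_{e,i}),\\[2mm]T_ix_{e,i}&\text{if }\lambda_i(x_{e,i})\le\lambda,\end{cases}$$ where in the second case $\Sigma_i^*(\lambda)$ is the unique positive root of $$X^3-\frac{2V_i(\lambda+\kappa_i)}{T_iC_i^2}A_iX-\frac{2V_i(\lambda+\kappa_i)}{T_iC_i^2}W_i=0.$$ (c) For every $\lambda$, the minimum $\gamma(\lambda)$ is attained and $\gamma(\lambda)=\sum_{i=1}^N\gamma^i(\lambda)-\lambda M$. The function $\gamma$ is concave (with values in $(-\infty,+\infty]$,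 concave in the sense that $\{(\lambda,r)\in\mathbb R^2:r\le\gamma(\lambda)\}$ is convex), it attains its maximum over $\lambda\in\mathbb R$, and $\max_\lambda\gamma(\lambda)$ is the optimal value of the relaxed problem, which is at most the optimal value of the scheduling problem. -/

import Mathlib

/-- A site with one-dimensional linear dynamics observed by identical sensors: dynamics `A`,
process noise intensity `W` (positive, i.e. `(A, √W)` is controllable), observation gain `C`,
measurement noise intensity `V`, cost rate `kappa` of an observation, weight `T` of the error
variance, and initial error variance `S0`. -/
structure ScalarSite where
  A : ℝ
  W : ℝ
  C : ℝ
  V : ℝ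
  kappa : ℝ
  T : ℝ
  S0 : ℝ
  W_pos : 0 < W
  V_pos : 0 < V
  T_nonneg : 0 ≤ T
  S0_pos : 0 < S0

/-- The long-run average `limsup_{τ → ∞} (1/τ) ∫_0^τ g(t) dt`, with values in `[-∞, +∞]`. -/
noncomputable def longRunAverage (g : ℝ → ℝ) : EReal :=
  Filter.limsup (fun τ : ℝ => (((∫ t in (0 : ℝ)..τ, g t) / τ : ℝ) : EReal)) Filter.atTop

namespace ScalarSite

/-- `a` is an observation policy (a measurable function of time with values in `{0, 1}`, where
`1` means that the site is observed), and `S` is the error variance that it produces: the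
(Carathéodory) solution on `[0, ∞)` of `S' = 2 A S + W - a (C² / V) S²`, `S(0) = S0`. -/
structure IsTrajectory (s : ScalarSite) (a S : ℝ → ℝ) : Prop where
  measurable_policy : Measurable a
  policy_values : ∀ t, a t = 0 ∨ a t = 1
  continuousOn : ContinuousOn S (Set.Ici 0)
  riccati : ∀ t, 0 ≤ t → S t = s.S0 +
    ∫ u in (0 : ℝ)..t, (2 * s.A * S u + s.W - a u * (s.C ^ 2 / s.V) * S u ^ 2)

/-- The costs of all policies for the single-site problem in which an observation is charged the
additional tax `l` per unit of time. -/
def taxedCosts (s : ScalarSite) (l : ℝ) : Set EReal :=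
  {v | ∃ a S : ℝ → ℝ, s.IsTrajectory a S ∧
    v = longRunAverage (fun t => s.T * S t + (s.kappa + l) * a t)}

/-- The optimal average cost `γ^i(l)` of the single-site problem with tax `l`. -/
noncomputable def value (s : ScalarSite) (l : ℝ) : EReal := sInf (s.taxedCosts l)

/-- The term of the passive action (not observing) in the Hamilton-Jacobi-Bellman equation, at
variance `S`, when the derivative of the relative value function is `p`. -/
def passiveTerm (s : ScalarSite) (S p : ℝ) : ℝ :=
  s.T * S + (2 * s.A * S + s.W) * p

/-- The term of the active action (observing) in the Hamilton-Jacobi-Bellman equation. -/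
noncomputable def activeTerm (s : ScalarSite) (l S p : ℝ) : ℝ :=
  s.T * S + s.kappa + l + (2 * s.A * S + s.W - s.C ^ 2 / s.V * S ^ 2) * p

/-- `h` is a relative value function of the single-site problem with tax `l`: a continuously
differentiable solution on `[0, ∞)`, bounded below, of the Hamilton-Jacobi-Bellman equation
`γ(l) = min {T S + (2 A S + W) h'(S), T S + κ + l + (2 A S + W - (C² / V) S²) h'(S)}`,
where `γ(l)` is the optimal average cost. (Boundedness from below is the usual condition at
infinity; for `A ≥ 0` the equation has spurious solutions that tend to `-∞`.) -/
structure IsRelativeValue (s : ScalarSite) (l : ℝ) (h : ℝ → ℝ) : Prop where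
  contDiffOn : ContDiffOn ℝ 1 h (Set.Ici 0)
  bddBelow : BddBelow (h '' Set.Ici 0)
  hjb : ∀ S, 0 ≤ S → s.value l =
    ((min (s.passiveTerm S (derivWithin h (Set.Ici 0) S))
      (s.activeTerm l S (derivWithin h (Set.Ici 0) S)) : ℝ) : EReal)

/-- The set `P(l) ⊆ [0, ∞)` of variances at which the passive action is optimal under tax `l`,
i.e. attains the minimum in the Hamilton-Jacobi-Bellman equation. -/
def passiveSet (s : ScalarSite) (l : ℝ) : Set ℝ :=
  {S | 0 ≤ S ∧ ∃ h, s.IsRelativeValue l h ∧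
    s.passiveTerm S (derivWithin h (Set.Ici 0) S) ≤
      s.activeTerm l S (derivWithin h (Set.Ici 0) S)}

/-- Indexability: `P(l)` increases from `∅` to `[0, ∞)` as `l` increases from `-∞` to `+∞`. -/
def Indexable (s : ScalarSite) : Prop :=
  Monotone s.passiveSet ∧ (⋂ l, s.passiveSet l) = ∅ ∧ (⋃ l, s.passiveSet l) = Set.Ici 0

/-- The Whittle index `inf {l : S ∈ P(l)}`. -/
noncomputable def whittleIndex (s : ScalarSite) (S : ℝ) : ℝ := sInf {l : ℝ | S ∈ s.passiveSet l}

/-- The negative root of `2 A x + W - (C² / V) x² = 0` (for `C ≠ 0`). -/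
noncomputable def x1 (s : ScalarSite) : ℝ :=
  (s.A - Real.sqrt (s.A ^ 2 + s.C ^ 2 * s.W / s.V)) / (s.C ^ 2 / s.V)

/-- The positive root of `2 A x + W - (C² / V) x² = 0` (for `C ≠ 0`). -/
noncomputable def x2 (s : ScalarSite) : ℝ :=
  (s.A + Real.sqrt (s.A ^ 2 + s.C ^ 2 * s.W / s.V)) / (s.C ^ 2 / s.V)

/-- The root of `2 A x + W = 0`; used only for `A < 0`, and read as `+∞` for `A ≥ 0`. -/
noncomputable def xe (s : ScalarSite) : ℝ := -s.W / (2 * s.A)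

/-- The depressed cubic `X³ - (2V(l+κ)/(TC²)) A X - (2V(l+κ)/(TC²)) W`. -/
noncomputable def cubic (s : ScalarSite) (l X : ℝ) : ℝ :=
  X ^ 3 - 2 * s.V * (l + s.kappa) / (s.T * s.C ^ 2) * s.A * X
    - 2 * s.V * (l + s.kappa) / (s.T * s.C ^ 2) * s.W

end ScalarSite

section Scheduling

/-- `a` gives an observation policy for each site, and `S` the corresponding variances. -/
def IsJointTrajectory {N : ℕ} (sites : Fin N → ScalarSite) (a S : Fin N → ℝ → ℝ) : Prop :=
  ∀ i, (sites i).IsTrajectory (a i) (S i)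

/-- The performance of a joint policy, observation costs included. -/
noncomputable def performance {N : ℕ} (sites : Fin N → ScalarSite) (a S : Fin N → ℝ → ℝ) :
    EReal :=
  longRunAverage (fun t => ∑ i, ((sites i).T * S i t + (sites i).kappa * a i t))

/-- The optimal performance of the scheduling problem: exactly `M` of the `N` sites are observed
at each time. -/
noncomputable def optimalPerformance {N : ℕ} (sites : Fin N → ScalarSite) (M : ℕ) : EReal :=
  sInf {v | ∃ a S : Fin N → ℝ → ℝ, IsJointTrajectory sites a S ∧
    (∀ t, 0 ≤ t → ∑ i, a i t = (M : ℝ)) ∧ v = performance sites a S}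

/-- The optimal performance of the relaxed problem, in which `M` sites are observed only on
average. This is the lower bound on the achievable performance. -/
noncomputable def relaxedPerformance {N : ℕ} (sites : Fin N → ScalarSite) (M : ℕ) : EReal :=
  sInf {v | ∃ a S : Fin N → ℝ → ℝ, IsJointTrajectory sites a S ∧
    longRunAverage (fun t => ∑ i, a i t) = ((M : ℝ) : EReal) ∧ v = performance sites a S}

/-- The Lagrangian `L(π, l)` of the relaxed problem. -/
noncomputable def lagrangian {N : ℕ} (sites : Fin N → ScalarSite) (M : ℕ) (l : ℝ)
    (a S : Fin N → ℝ → ℝ) : EReal :=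
  longRunAverage (fun t => ∑ i, ((sites i).T * S i t + ((sites i).kappa + l) * a i t))
    - ((l * M : ℝ) : EReal)

/-- The values of the Lagrangian over all joint policies. -/
def lagrangianValues {N : ℕ} (sites : Fin N → ScalarSite) (M : ℕ) (l : ℝ) : Set EReal :=
  {v | ∃ a S : Fin N → ℝ → ℝ, IsJointTrajectory sites a S ∧ v = lagrangian sites M l a S}

/-- The dual function `γ(l)`, the minimum over all joint policies of the Lagrangian. -/
noncomputable def dualFunction {N : ℕ} (sites : Fin N → ScalarSite) (M : ℕ) (l : ℝ) : EReal :=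
  sInf (lagrangianValues sites M l)

end Scheduling

/-! Write `R = C² / V` and `ν = κ + l`. Dividing the Riccati equation by `S²` frees the action from
the variance: integrating `(1 / S)'` gives `balance`, so over a long time `R ∫ a` equals `∫ (2 A / S
+ W / S²)` up to boundary terms. Holding the variance at `X` therefore needs the fraction of time
`activity X = (2 A X + W) / (R X²)`, and the one-site problem reduces to minimizing the static cost
`T X + ν * activity X` over the `X` with activity in `[0, 1]`, that is from `x2` up to `xe` (or
`∞`). The function `2 A / x + W / x²` need not be convex, but `static_cost_le` still makes a
critical point of `T x + μ (2 A / x + W / x²)` a global minimum, because the excess factors through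
`(x - X)²`. Complementary slackness at the ends of the interval is packaged in `IsOperatingPoint`.
The resulting lower bound holds up to a bounded transient (`operating_bound`), and a policy whose
variance converges to `X` attains it (`exists_trajectory_tendsto`).

For the duality, `IsDual` records the optimal cost of a site and the set of its optimal activities
under each tax. These sets are convex with closed graph, equal `{1}` for very negative taxes and
shrink to `0` for large ones. Hence at some tax they contain activities with sum `M`
(`exists_sum_eq_of_closed_graph`). The corresponding optimal policies are feasible for the relaxed
problem and their performance is the dual value, which gives strong duality. An undetectable site
with `T ≠ 0` makes every cost infinite.

For indexability, put `u = R x² h' - ν`; its sign selects the action. Either branch of the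
Hamilton-Jacobi-Bellman equation reads `drift * u = hjbDefect`, with the drift of the selected
action. For `x > 0` the defect is `R x²` times the gap between the optimal cost and the static cost
at `x`, hence negative at every feasible variance other than the operating point. Below `x2` and
above `xe` the two drifts have the same sign and the defect determines `u`. Between them both
branches may be solvable, but there `u` cannot vanish away from the operating point, so its sign
propagates from an anchor: `x2` on the left, and on the right `xe` or infinity, where boundedness
below enters. This gives uniqueness. Explicit slopes provide a solution in each of the three
regimes, and its passive set is `{x | threshold x ≤ ν}`, so the index is `threshold - κ`. -/

open MeasureTheory Set Filter Topology

/-! ### Riccati trajectories and the information balance -/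

/-- The reciprocal of an absolutely continuous function that is bounded away from zero is
absolutely continuous. -/
theorem AbsolutelyContinuousOnInterval.fun_inv_of_le {F : ℝ → ℝ} {a b m : ℝ} (hm : 0 < m)
    (hF : AbsolutelyContinuousOnInterval F a b) (hFm : ∀ x ∈ uIcc a b, m ≤ F x) :
    AbsolutelyContinuousOnInterval (fun x => (F x)⁻¹) a b := by
  rw [absolutelyContinuousOnInterval_iff] at hF ⊢
  intro ε hε
  obtain ⟨δ, hδ, h⟩ := hF (ε * m ^ 2) (by positivity)
  refine ⟨δ, hδ, fun E hE hlt => ?_⟩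
  have h1 := h E hE hlt
  have key : ∑ i ∈ Finset.range E.1, dist (F (E.2 i).1)⁻¹ (F (E.2 i).2)⁻¹
      ≤ (∑ i ∈ Finset.range E.1, dist (F (E.2 i).1) (F (E.2 i).2)) / m ^ 2 := by
    rw [Finset.sum_div]
    refine Finset.sum_le_sum fun i hi => ?_
    obtain ⟨hx, hy⟩ := hE.1 i hi
    have p := hFm _ hx
    have q := hFm _ hy
    have hp : 0 < F (E.2 i).1 := hm.trans_le p
    have hq : 0 < F (E.2 i).2 := hm.trans_le q
    rw [Real.dist_eq, Real.dist_eq, inv_sub_inv hp.ne' hq.ne', abs_div, abs_sub_comm,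
      abs_of_pos (mul_pos hp hq)]
    refine div_le_div_of_nonneg_left (abs_nonneg _) (by positivity) ?_
    nlinarith
  refine key.trans_lt ?_
  rw [div_lt_iff₀ (by positivity)]
  exact h1

/-- Chain rule for the reciprocal of a positive indefinite integral. -/
theorem integral_div_sq_of_eq_integral {F g : ℝ → ℝ} {c τ : ℝ} (hτ : 0 ≤ τ)
    (hg : IntervalIntegrable g volume 0 τ) (hc : ContinuousOn F (Icc 0 τ))
    (hpos : ∀ t ∈ Icc 0 τ, 0 < F t) (hF : ∀ t ∈ Icc 0 τ, F t = c + ∫ u in (0 : ℝ)..t, g u) :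
    ∫ t in (0 : ℝ)..τ, -g t / F t ^ 2 = (F τ)⁻¹ - (F 0)⁻¹ := by
  -- `F` is an indefinite integral only on `[0, τ]`, while `G` is one everywhere and has derivative
  -- `g` almost everywhere. Since policies are merely measurable, the fundamental theorem is used
  -- for the absolutely continuous function `1 / G`.
  set G : ℝ → ℝ := fun t => c + ∫ u in (0 : ℝ)..t, g u with hG
  have hu : uIcc 0 τ = Icc 0 τ := uIcc_of_le hτ
  obtain ⟨x₀, hx₀, hmin⟩ := isCompact_Icc.exists_isMinOn (nonempty_Icc.2 hτ) hc
  have hGac : AbsolutelyContinuousOnInterval G 0 τ := by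
    have h1 := hg.absolutelyContinuousOnInterval_intervalIntegral (c := 0) (by simp)
    rw [absolutelyContinuousOnInterval_iff] at h1 ⊢
    simpa [hG] using h1
  have hGm : ∀ x ∈ uIcc 0 τ, F x₀ ≤ G x := by
    intro x hx
    rw [hu] at hx
    rw [hG]
    simp only
    rw [← hF x hx]
    exact hmin hx
  have hac := hGac.fun_inv_of_le (hpos x₀ hx₀) hGm
  have h2 := hac.integral_deriv_eq_sub
  have e0 : G 0 = F 0 := (hF 0 ⟨le_rfl, hτ⟩).symm
  have e1 : G τ = F τ := (hF τ ⟨hτ, le_rfl⟩).symm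
  rw [e0, e1] at h2
  rw [← h2]
  refine intervalIntegral.integral_congr_ae ?_
  filter_upwards [hg.ae_hasDerivAt_integral] with x hx hxm
  have hxu : x ∈ uIcc 0 τ := uIoc_subset_uIcc hxm
  have hxi : x ∈ Icc 0 τ := hu ▸ hxu
  have hd : HasDerivAt G (g x) x := (hx hxu 0 (by simp)).const_add c
  have hGx : G x = F x := (hF x hxi).symm
  have hd2 := hd.fun_inv (by rw [hGx]; exact (hpos x hxi).ne')
  rw [hd2.deriv, hGx]

namespace ScalarSite

variable {s : ScalarSite} {a S : ℝ → ℝ}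

theorem gain_nonneg (s : ScalarSite) : 0 ≤ s.C ^ 2 / s.V := div_nonneg (sq_nonneg _) s.V_pos.le

theorem gain_pos (hC : s.C ≠ 0) : 0 < s.C ^ 2 / s.V := div_pos (by positivity) s.V_pos

namespace IsTrajectory

theorem policy_nonneg (h : s.IsTrajectory a S) (t : ℝ) : 0 ≤ a t := by
  rcases h.policy_values t with e | e <;> simp [e]

theorem policy_le_one (h : s.IsTrajectory a S) (t : ℝ) : a t ≤ 1 := by
  rcases h.policy_values t with e | e <;> simp [e]

theorem intervalIntegrable_policy (h : s.IsTrajectory a S) (x y : ℝ) :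
    IntervalIntegrable a volume x y := by
  refine (intervalIntegrable_const (c := (1 : ℝ))).mono_fun
    h.measurable_policy.aestronglyMeasurable (Eventually.of_forall fun t => ?_)
  simpa [abs_of_nonneg (h.policy_nonneg t)] using h.policy_le_one t

theorem continuousOn_uIcc (h : s.IsTrajectory a S) {x y : ℝ} (hx : 0 ≤ x) (hy : 0 ≤ y) :
    ContinuousOn S (uIcc x y) :=
  h.continuousOn.mono fun _ ht => (le_min hx hy).trans ht.1

theorem intervalIntegrable (h : s.IsTrajectory a S) {x y : ℝ} (hx : 0 ≤ x) (hy : 0 ≤ y) :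
    IntervalIntegrable S volume x y :=
  (h.continuousOn_uIcc hx hy).intervalIntegrable

theorem intervalIntegrable_rhs (h : s.IsTrajectory a S) {x y : ℝ} (hx : 0 ≤ x) (hy : 0 ≤ y) :
    IntervalIntegrable (fun u => 2 * s.A * S u + s.W - a u * (s.C ^ 2 / s.V) * S u ^ 2)
      volume x y := by
  refine (((h.intervalIntegrable hx hy).const_mul _).add intervalIntegrable_const).sub ?_
  exact ((h.intervalIntegrable_policy x y).mul_const _).mul_continuousOn
    ((h.continuousOn_uIcc hx hy).pow 2)

theorem initial (h : s.IsTrajectory a S) : S 0 = s.S0 := by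
  simpa using h.riccati 0 le_rfl

theorem sub_eq (h : s.IsTrajectory a S) {x y : ℝ} (hx : 0 ≤ x) (hy : 0 ≤ y) :
    S y - S x = ∫ u in x..y, (2 * s.A * S u + s.W - a u * (s.C ^ 2 / s.V) * S u ^ 2) := by
  rw [h.riccati y hy, h.riccati x hx, ← intervalIntegral.integral_interval_sub_left
    (h.intervalIntegrable_rhs le_rfl hy) (h.intervalIntegrable_rhs le_rfl hx)]
  ring

/-- The error variance stays positive. -/
theorem pos (h : s.IsTrajectory a S) {t : ℝ} (ht : 0 ≤ t) : 0 < S t := by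
  by_contra! hneg
  -- At the first time `x` with `S x ≤ 0`, continuity gives `S x = 0`. Just before `x` the drift is
  -- then close to at least `W > 0` under either action, so `S` could not have come down to `0`.
  set Z : Set ℝ := {u ∈ Icc 0 t | S u ∈ Iic 0} with hZ
  have hZc : IsCompact Z := by
    have : IsClosed Z := (h.continuousOn.mono fun u hu => hu.1 : ContinuousOn S
      (Icc 0 t)).preimage_isClosed_of_isClosed isClosed_Icc isClosed_Iic
    exact isCompact_Icc.of_isClosed_subset this fun u hu => hu.1
  obtain ⟨x, hx, hmin⟩ := hZc.exists_isLeast ⟨t, ⟨ht, le_rfl⟩, hneg⟩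
  have hx0 : 0 < x := by
    rcases hx.1.1.lt_or_eq with h0 | h0
    · exact h0
    · have := hx.2
      rw [← h0, h.initial] at this
      exact absurd this (not_le.2 s.S0_pos)
  have hbefore : ∀ u, 0 ≤ u → u < x → 0 < S u := by
    intro u hu hux
    by_contra! hc
    exact absurd (hmin ⟨⟨hu, hux.le.trans hx.1.2⟩, hc⟩) (not_le.2 hux)
  have hSx : S x ≤ 0 := hx.2
  have hcx : ContinuousWithinAt S (Ici 0) x := h.continuousOn x hx.1.1
  have hlow : Tendsto (fun u => 2 * s.A * S u + s.W - (s.C ^ 2 / s.V) * S u ^ 2) (𝓝[Iio x] x)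
      (𝓝 (2 * s.A * S x + s.W - (s.C ^ 2 / s.V) * S x ^ 2)) := by
    have : Tendsto S (𝓝[Iio x] x) (𝓝 (S x)) := by
      refine hcx.tendsto.mono_left ?_
      rw [nhdsWithin_le_iff]
      exact mem_of_superset (Ioo_mem_nhdsLT hx0) fun u hu => hu.1.le
    exact ((this.const_mul _).add_const _).sub ((this.pow 2).const_mul _)
  have hSx0 : S x = 0 := by
    refine le_antisymm hSx ?_
    have : Tendsto S (𝓝[Iio x] x) (𝓝 (S x)) := by
      refine hcx.tendsto.mono_left ?_
      rw [nhdsWithin_le_iff]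
      exact mem_of_superset (Ioo_mem_nhdsLT hx0) fun u hu => hu.1.le
    refine ge_of_tendsto this ?_
    filter_upwards [Ioo_mem_nhdsLT hx0] with u hu using (hbefore u hu.1.le hu.2).le
  have hev : ∀ᶠ u in 𝓝[Iio x] x,
      0 < 2 * s.A * S u + s.W - (s.C ^ 2 / s.V) * S u ^ 2 := by
    refine hlow.eventually (lt_mem_nhds ?_)
    simp [hSx0, s.W_pos]
  obtain ⟨l, hl, hlsub⟩ := (mem_nhdsLT_iff_exists_Ioo_subset' hx0).1
    (inter_mem hev (Ioo_mem_nhdsLT hx0))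
  obtain ⟨u, hlu, hux⟩ := exists_between (show l < x from hl)
  have hu0 : 0 < u := (hlsub ⟨hlu, hux⟩).2.1
  have h1 := h.sub_eq hu0.le hx.1.1
  have h2 : 0 ≤ ∫ v in u..x, (2 * s.A * S v + s.W - a v * (s.C ^ 2 / s.V) * S v ^ 2) := by
    refine intervalIntegral.integral_nonneg hux.le fun v hv => ?_
    rcases hv.2.lt_or_eq with hvx | hvx
    · have h3 : 0 < 2 * s.A * S v + s.W - (s.C ^ 2 / s.V) * S v ^ 2 :=
        (hlsub ⟨hlu.trans_le hv.1, hvx⟩).1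
      have h4 : a v * ((s.C ^ 2 / s.V) * S v ^ 2) ≤ 1 * ((s.C ^ 2 / s.V) * S v ^ 2) :=
        mul_le_mul_of_nonneg_right (h.policy_le_one v)
          (mul_nonneg s.gain_nonneg (sq_nonneg _))
      linarith
    · rw [hvx, hSx0]
      simp [s.W_pos.le]
  have h3 := hbefore u hu0.le hux
  linarith

theorem continuousOn_inv_terms (h : s.IsTrajectory a S) {x y : ℝ} (hx : 0 ≤ x) (hy : 0 ≤ y) :
    ContinuousOn (fun u => 2 * s.A / S u + s.W / S u ^ 2) (uIcc x y) := by
  have hp : ∀ u ∈ uIcc x y, S u ≠ 0 := fun u hu => (h.pos ((le_min hx hy).trans hu.1)).ne'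
  have hc := h.continuousOn_uIcc hx hy
  exact (continuousOn_const.div hc hp).add
    (continuousOn_const.div (hc.pow 2) fun u hu => pow_ne_zero 2 (hp u hu))

/-- The balance between the information gathered by observations and the information lost. -/
theorem balance (h : s.IsTrajectory a S) {τ : ℝ} (hτ : 0 ≤ τ) :
    s.C ^ 2 / s.V * ∫ t in (0 : ℝ)..τ, a t =
      (∫ t in (0 : ℝ)..τ, (2 * s.A / S t + s.W / S t ^ 2)) + ((S τ)⁻¹ - s.S0⁻¹) := by
  -- The Riccati right-hand side divided by `S²` is `2 A / S + W / S² - a C² / V`, in which the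
  -- action no longer multiplies the variance.
  have h1 := integral_div_sq_of_eq_integral hτ (h.intervalIntegrable_rhs le_rfl hτ)
    (h.continuousOn.mono fun u hu => hu.1) (fun t ht => h.pos ht.1)
    (fun t ht => h.riccati t ht.1)
  rw [← h.initial, ← h1, ← intervalIntegral.integral_const_mul, eq_comm,
    ← eq_sub_iff_add_eq', ← intervalIntegral.integral_sub
      ((h.intervalIntegrable_policy 0 τ).const_mul _)
      (h.continuousOn_inv_terms le_rfl hτ).intervalIntegrable]
  refine intervalIntegral.integral_congr fun t ht => ?_
  have hp : S t ≠ 0 := (h.pos (by rw [uIcc_of_le hτ] at ht; exact ht.1)).ne'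
  field_simp
  ring

theorem integral_policy_nonneg (h : s.IsTrajectory a S) {τ : ℝ} (hτ : 0 ≤ τ) :
    0 ≤ ∫ t in (0 : ℝ)..τ, a t :=
  intervalIntegral.integral_nonneg hτ fun t _ => h.policy_nonneg t

theorem integral_policy_le (h : s.IsTrajectory a S) {τ : ℝ} (hτ : 0 ≤ τ) :
    ∫ t in (0 : ℝ)..τ, a t ≤ τ := by
  have := intervalIntegral.integral_mono_on hτ (h.intervalIntegrable_policy 0 τ)
    (intervalIntegrable_const (c := (1 : ℝ))) fun t _ => h.policy_le_one t
  simpa using this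

end IsTrajectory
end ScalarSite

/-! ### The static problem and the lower bound on the cost -/

/-- The time averages of a convergent function converge to its limit. -/
theorem tendsto_average_of_tendsto {g : ℝ → ℝ} {L : ℝ} (hc : ContinuousOn g (Ici 0))
    (hg : Tendsto g atTop (𝓝 L)) :
    Tendsto (fun τ : ℝ => (∫ t in (0 : ℝ)..τ, g t) / τ) atTop (𝓝 L) := by
  have hint : ∀ {x y : ℝ}, 0 ≤ x → 0 ≤ y → IntervalIntegrable g volume x y := fun hx hy =>
    (hc.mono fun _ ht => (le_min hx hy).trans ht.1).intervalIntegrable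
  rw [Metric.tendsto_atTop]
  intro ε hε
  obtain ⟨t₀, ht₀⟩ := (Metric.tendsto_atTop.1 hg) (ε / 2) (by positivity)
  set b := max t₀ 0 with hb
  have hb0 : 0 ≤ b := le_max_right _ _
  set K := |(∫ t in (0 : ℝ)..b, g t) - L * b| with hK
  refine ⟨max (b + 1) (2 * K / ε + 1), fun τ hτ => ?_⟩
  have h1 : b + 1 ≤ τ := (le_max_left _ _).trans hτ
  have h2 : 2 * K / ε + 1 ≤ τ := (le_max_right _ _).trans hτ
  have hτ0 : 0 < τ := by linarith
  have hsplit := intervalIntegral.integral_add_adjacent_intervals (hint le_rfl hb0)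
    (hint hb0 hτ0.le)
  have htail : ‖∫ t in b..τ, (g t - L)‖ ≤ ε / 2 * |τ - b| := by
    refine intervalIntegral.norm_integral_le_of_norm_le_const fun t ht => ?_
    rw [uIoc_of_le (by linarith)] at ht
    exact (ht₀ t ((le_max_left _ _).trans ht.1.le)).le
  rw [intervalIntegral.integral_sub (hint hb0 hτ0.le) intervalIntegrable_const,
    intervalIntegral.integral_const, smul_eq_mul, abs_of_nonneg (by linarith : 0 ≤ τ - b),
    Real.norm_eq_abs] at htail
  have hKτ : K < ε / 2 * τ := by
    have : 2 * K / ε < τ := by linarith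
    rw [div_lt_iff₀ hε] at this
    linarith
  rw [Real.dist_eq, ← hsplit]
  have e : ((∫ t in (0 : ℝ)..b, g t) + ∫ t in b..τ, g t) / τ - L
      = (((∫ t in (0 : ℝ)..b, g t) - L * b) + ((∫ t in b..τ, g t) - (τ - b) * L)) / τ := by
    field_simp
    ring
  rw [e, abs_div, abs_of_pos hτ0, div_lt_iff₀ hτ0]
  calc _ ≤ K + ε / 2 * (τ - b) := (abs_add_le _ _).trans (add_le_add le_rfl htail)
    _ < ε * τ := by nlinarith

/-- The static cost `T x + μ (2 A / x + W / x²)` is minimal at a point `X` where it is critical. -/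
theorem static_cost_le {A W T X μ x : ℝ} (hX : 0 < X) (hx : 0 < x) (hμ : 0 ≤ μ) (hT : 0 ≤ T)
    (hW : 0 ≤ W) (h : 2 * μ * (A * X + W) = T * X ^ 3) :
    T * X + μ * ((2 * A * X + W) / X ^ 2) ≤ T * x + μ * (2 * A / x + W / x ^ 2) := by
  rw [← sub_nonneg]
  -- Convexity is not available for `A < 0`. Instead the criticality relation turns the excess cost
  -- into a square times a nonnegative factor.
  have e : T * x + μ * (2 * A / x + W / x ^ 2) - (T * X + μ * ((2 * A * X + W) / X ^ 2))
      = (x - X) ^ 2 * (T * X ^ 2 * x + μ * W) / (X ^ 2 * x ^ 2) := by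
    field_simp
    linear_combination (x * X - x ^ 2) * h
  rw [e]
  positivity

namespace ScalarSite

variable {s : ScalarSite} {a S : ℝ → ℝ} {l X : ℝ}

theorem gain_mul_x2_sq (hC : s.C ≠ 0) : s.C ^ 2 / s.V * s.x2 ^ 2 = 2 * s.A * s.x2 + s.W := by
  have hR := gain_pos hC
  have hW := s.W_pos
  have h0 : s.C ^ 2 * s.W / s.V = s.C ^ 2 / s.V * s.W := by ring
  unfold x2
  rw [h0]
  set R := s.C ^ 2 / s.V
  have h1 : 0 ≤ s.A ^ 2 + R * s.W := by positivity
  have h2 := Real.sq_sqrt h1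
  field_simp
  linear_combination h2

theorem abs_A_lt_sqrt (hC : s.C ≠ 0) : |s.A| < √(s.A ^ 2 + s.C ^ 2 * s.W / s.V) := by
  have hR := gain_pos hC
  have hW := s.W_pos
  have h0 : s.C ^ 2 * s.W / s.V = s.C ^ 2 / s.V * s.W := by ring
  rw [h0]
  apply Real.lt_sqrt_of_sq_lt
  rw [sq_abs]
  have := mul_pos hR hW
  linarith

theorem x2_pos (hC : s.C ≠ 0) : 0 < s.x2 := by
  have := abs_A_lt_sqrt hC
  exact div_pos (by linarith [neg_abs_le s.A]) (gain_pos hC)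

theorem x1_neg (hC : s.C ≠ 0) : s.x1 < 0 := by
  have := abs_A_lt_sqrt hC
  exact div_neg_of_neg_of_pos (by linarith [le_abs_self s.A]) (gain_pos hC)

theorem gain_mul_x1_add_x2 (hC : s.C ≠ 0) : s.C ^ 2 / s.V * (s.x1 + s.x2) = 2 * s.A := by
  have hR := (gain_pos hC).ne'
  unfold x1 x2
  rw [← add_div, mul_div_cancel₀ _ hR]
  ring

theorem gain_mul_x1_mul_x2 (hC : s.C ≠ 0) : s.C ^ 2 / s.V * (s.x1 * s.x2) = -s.W := by
  linear_combination s.x2 * gain_mul_x1_add_x2 hC - gain_mul_x2_sq hC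

/-- Factorization of the drift under observation. -/
theorem active_drift_eq (hC : s.C ≠ 0) (x : ℝ) :
    2 * s.A * x + s.W - s.C ^ 2 / s.V * x ^ 2 = s.C ^ 2 / s.V * (x - s.x1) * (s.x2 - x) := by
  linear_combination (-x) * gain_mul_x1_add_x2 hC + gain_mul_x1_mul_x2 hC

theorem two_A_mul_xe (hA : s.A < 0) : 2 * s.A * s.xe = -s.W := by
  unfold xe
  field_simp [hA.ne]

theorem xe_pos (hA : s.A < 0) : 0 < s.xe :=
  div_pos_of_neg_of_neg (by linarith [s.W_pos]) (by linarith)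

theorem passive_drift_eq (hA : s.A < 0) (x : ℝ) :
    2 * s.A * x + s.W = 2 * s.A * (x - s.xe) := by
  linear_combination two_A_mul_xe hA

theorem passive_drift_nonneg_iff (hA : s.A < 0) (x : ℝ) : 0 ≤ 2 * s.A * x + s.W ↔ x ≤ s.xe := by
  rw [passive_drift_eq hA]
  constructor <;> intro h <;> nlinarith

theorem passive_drift_pos_iff (hA : s.A < 0) (x : ℝ) : 0 < 2 * s.A * x + s.W ↔ x < s.xe := by
  rw [passive_drift_eq hA]
  constructor <;> intro h <;> nlinarith

theorem passive_drift_x2_pos (hC : s.C ≠ 0) : 0 < 2 * s.A * s.x2 + s.W := by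
  rw [← gain_mul_x2_sq hC]
  exact mul_pos (gain_pos hC) (pow_pos (x2_pos hC) 2)

theorem x2_lt_xe (hC : s.C ≠ 0) (hA : s.A < 0) : s.x2 < s.xe :=
  (passive_drift_pos_iff hA _).1 (passive_drift_x2_pos hC)

/-- `X` is the stationary variance of an optimal policy under tax `l`: the first-order condition
for minimizing `T X + (κ + l) (2 A X + W) / (R X²)`, `R = C² / V`, subject to the constraint that
the fraction of time `(2 A X + W) / (R X²)` lies in `[0, 1]`. -/
structure IsOperatingPoint (s : ScalarSite) (l X : ℝ) : Prop where
  x2_le : s.x2 ≤ X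
  drift_nonneg : 0 ≤ 2 * s.A * X + s.W
  lower : 0 ≤ (X - s.x2) * (2 * (s.kappa + l) * (s.A * X + s.W) - s.T * (s.C ^ 2 / s.V) * X ^ 3)
  upper : (2 * s.A * X + s.W) *
    (2 * (s.kappa + l) * (s.A * X + s.W) - s.T * (s.C ^ 2 / s.V) * X ^ 3) ≤ 0

/-- The fraction of time that a site has to be observed to keep its variance at `X`. -/
noncomputable def activity (s : ScalarSite) (X : ℝ) : ℝ :=
  (2 * s.A * X + s.W) / (s.C ^ 2 / s.V * X ^ 2)

theorem activity_nonneg (h : 0 ≤ 2 * s.A * X + s.W) : 0 ≤ s.activity X :=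
  div_nonneg h (mul_nonneg s.gain_nonneg (sq_nonneg X))

theorem activity_x2 (hC : s.C ≠ 0) : s.activity s.x2 = 1 := by
  unfold activity
  rw [gain_mul_x2_sq hC, div_self (passive_drift_x2_pos hC).ne']

theorem activity_le_one (hC : s.C ≠ 0) (hX : s.x2 ≤ X) : s.activity X ≤ 1 := by
  have h0 : 0 < X := (x2_pos hC).trans_le hX
  unfold activity
  rw [div_le_one (mul_pos (gain_pos hC) (pow_pos h0 2)), ← sub_nonpos, active_drift_eq hC]
  refine mul_nonpos_of_nonneg_of_nonpos (mul_nonneg s.gain_nonneg ?_) (by linarith)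
  linarith [x1_neg hC]

theorem A_mul_add_W_pos (hX : 0 ≤ 2 * s.A * X + s.W) : 0 < s.A * X + s.W := by
  linarith [s.W_pos]

/-- Here `μ` is a shadow price of information. The static inequality is integrated along the
trajectory, and `balance` trades the information lost for observation time. The boundary term `μ / S
τ` is nonnegative and is dropped, so only the constant `μ / S0` is given away. -/
theorem IsTrajectory.static_bound (h : s.IsTrajectory a S) {μ : ℝ} (hX : 0 < X) (hμ : 0 ≤ μ)
    (hcrit : 2 * μ * (s.A * X + s.W) = s.T * X ^ 3) {τ : ℝ} (hτ : 0 ≤ τ) :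
    (s.T * X + μ * ((2 * s.A * X + s.W) / X ^ 2)) * τ - μ * s.S0⁻¹ ≤
      (∫ t in (0 : ℝ)..τ, s.T * S t) + μ * (s.C ^ 2 / s.V * ∫ t in (0 : ℝ)..τ, a t) := by
  have hi := (h.continuousOn_inv_terms le_rfl hτ).intervalIntegrable (μ := volume)
  have hS := (h.intervalIntegrable le_rfl hτ).const_mul s.T
  have h1 : ∫ _ in (0 : ℝ)..τ, (s.T * X + μ * ((2 * s.A * X + s.W) / X ^ 2)) ≤
      ∫ t in (0 : ℝ)..τ, (s.T * S t + μ * (2 * s.A / S t + s.W / S t ^ 2)) :=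
    intervalIntegral.integral_mono_on hτ intervalIntegrable_const (hS.add (hi.const_mul μ))
      fun t ht => static_cost_le hX (h.pos ht.1) hμ s.T_nonneg s.W_pos.le hcrit
  rw [intervalIntegral.integral_const, intervalIntegral.integral_add hS (hi.const_mul μ),
    intervalIntegral.integral_const_mul μ] at h1
  rw [h.balance hτ]
  have h2 : 0 ≤ μ * (S τ)⁻¹ := mul_nonneg hμ (inv_nonneg.2 (h.pos hτ).le)
  simp only [smul_eq_mul, sub_zero] at h1
  linarith

/-- Every policy costs at least as much as the operating point, up to a bounded transient. -/
theorem IsTrajectory.operating_bound (h : s.IsTrajectory a S) (hC : s.C ≠ 0)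
    (hX : s.IsOperatingPoint l X) : ∃ K, ∀ τ, 0 ≤ τ →
    (s.T * X + (s.kappa + l) * s.activity X) * τ - K ≤
      ∫ t in (0 : ℝ)..τ, (s.T * S t + (s.kappa + l) * a t) := by
  have hX0 : 0 < X := (x2_pos hC).trans_le hX.x2_le
  have hR := gain_pos hC
  have hq := A_mul_add_W_pos hX.drift_nonneg
  have hlow := hX.lower
  have hupp := hX.upper
  set R := s.C ^ 2 / s.V with hRdef
  -- The price under which `X` is critical for the unconstrained static cost. It satisfies `μ R = κ
  -- + l` only if no activity constraint has a multiplier at `X`.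
  set μ := s.T * X ^ 3 / (2 * (s.A * X + s.W)) with hμdef
  have hμ : 0 ≤ μ := div_nonneg (mul_nonneg s.T_nonneg (by positivity)) (by positivity)
  have hcrit : 2 * μ * (s.A * X + s.W) = s.T * X ^ 3 := by
    have := div_mul_cancel₀ (s.T * X ^ 3) (by positivity : 2 * (s.A * X + s.W) ≠ 0)
    rw [← hμdef] at this
    linear_combination this
  refine ⟨μ * s.S0⁻¹, fun τ hτ => ?_⟩
  have h1 := h.static_bound hX0 hμ hcrit hτ
  rw [← hRdef] at h1
  have hf : μ * ((2 * s.A * X + s.W) / X ^ 2) = μ * R * s.activity X := by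
    unfold activity
    rw [← hRdef]
    field_simp
  rw [hf] at h1
  rw [intervalIntegral.integral_add ((h.intervalIntegrable le_rfl hτ).const_mul _)
    ((h.intervalIntegrable_policy 0 τ).const_mul _), intervalIntegral.integral_const_mul (s.kappa + l)]
  set I := ∫ t in (0 : ℝ)..τ, a t with hI
  have hI0 : 0 ≤ I := h.integral_policy_nonneg hτ
  have hI1 : I ≤ τ := h.integral_policy_le hτ
  have hg : 2 * (s.kappa + l) * (s.A * X + s.W) - s.T * R * X ^ 3
      = 2 * (s.A * X + s.W) * (s.kappa + l - μ * R) := by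
    linear_combination R * hcrit
  rw [hg] at hlow hupp
  -- Complementary slackness: a tax below the price forces `X = x2`, whose activity `1` no policy
  -- exceeds; a tax above it forces zero passive drift, hence activity `0`.
  have key : 0 ≤ (s.kappa + l - μ * R) * (I - s.activity X * τ) := by
    rcases lt_trichotomy (s.kappa + l - μ * R) 0 with hn | hn | hn
    · have hXe : X = s.x2 := by
        refine le_antisymm ?_ hX.x2_le
        by_contra! hc
        have : (X - s.x2) * (2 * (s.A * X + s.W) * (s.kappa + l - μ * R)) < 0 :=
          mul_neg_of_pos_of_neg (by linarith) (mul_neg_of_pos_of_neg (by linarith) hn)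
        linarith
      have : s.activity X = 1 := by rw [hXe, activity_x2 hC]
      rw [this]
      exact mul_nonneg_of_nonpos_of_nonpos hn.le (by linarith)
    · rw [hn, zero_mul]
    · have hXe : 2 * s.A * X + s.W = 0 := by
        refine le_antisymm ?_ hX.drift_nonneg
        by_contra! hc
        have : 0 < (2 * s.A * X + s.W) * (2 * (s.A * X + s.W) * (s.kappa + l - μ * R)) := by
          positivity
        linarith
      have : s.activity X = 0 := by rw [activity, hXe, zero_div]
      rw [this]
      simpa using mul_nonneg hn.le hI0
  linarith

/-- A trajectory that converges to `X` has asymptotic activity `s.activity X`. -/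
theorem IsTrajectory.tendsto_average_policy (h : s.IsTrajectory a S) (hC : s.C ≠ 0) (hX : 0 < X)
    (hS : Tendsto S atTop (𝓝 X)) :
    Tendsto (fun τ : ℝ => (∫ t in (0 : ℝ)..τ, a t) / τ) atTop (𝓝 (s.activity X)) := by
  have hR := (gain_pos hC).ne'
  have hc : ContinuousOn (fun u => 2 * s.A / S u + s.W / S u ^ 2) (Ici 0) := by
    have hp : ∀ u ∈ Ici (0 : ℝ), S u ≠ 0 := fun u hu => (h.pos hu).ne'
    exact (continuousOn_const.div h.continuousOn hp).add
      (continuousOn_const.div (h.continuousOn.pow 2) fun u hu => pow_ne_zero 2 (hp u hu))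
  have hl : Tendsto (fun u => 2 * s.A / S u + s.W / S u ^ 2) atTop
      (𝓝 (2 * s.A / X + s.W / X ^ 2)) :=
    (tendsto_const_nhds.div hS hX.ne').add
      (tendsto_const_nhds.div (hS.pow 2) (pow_ne_zero 2 hX.ne'))
  have h1 := tendsto_average_of_tendsto hc hl
  have h2 : Tendsto (fun τ : ℝ => ((S τ)⁻¹ - s.S0⁻¹) / τ) atTop (𝓝 0) :=
    ((hS.inv₀ hX.ne').sub_const _).div_atTop tendsto_id
  have h3 := (h1.add h2).div_const (s.C ^ 2 / s.V)
  have e : (2 * s.A / X + s.W / X ^ 2 + 0) / (s.C ^ 2 / s.V) = s.activity X := by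
    unfold activity
    field_simp
    ring
  rw [e] at h3
  refine h3.congr' ?_
  filter_upwards [eventually_ge_atTop 0] with τ hτ
  rw [← add_div, ← h.balance hτ, mul_div_assoc, mul_div_cancel_left₀ _ hR]

theorem IsTrajectory.tendsto_average_variance (h : s.IsTrajectory a S)
    (hS : Tendsto S atTop (𝓝 X)) :
    Tendsto (fun τ : ℝ => (∫ t in (0 : ℝ)..τ, s.T * S t) / τ) atTop (𝓝 (s.T * X)) :=
  tendsto_average_of_tendsto (h.continuousOn.const_mul _) (hS.const_mul _)

end ScalarSite

/-! ### Explicit flows of the unobserved and the observed variance -/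

namespace ScalarSite

variable {s : ScalarSite} {a S : ℝ → ℝ} {X c : ℝ}

/-- The right-hand side of the Riccati equation at variance `x` under action `u`. -/
noncomputable def drift (s : ScalarSite) (u x : ℝ) : ℝ :=
  2 * s.A * x + s.W - u * (s.C ^ 2 / s.V) * x ^ 2

/-- `S` solves the Riccati equation on `[0, ∞)` in the sense of right derivatives. -/
structure IsRightSolution (s : ScalarSite) (a S : ℝ → ℝ) : Prop where
  continuousOn : ContinuousOn S (Ici 0)
  deriv_right : ∀ t, 0 ≤ t → HasDerivWithinAt S (s.drift (a t) (S t)) (Ioi t) t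

theorem IsRightSolution.isTrajectory (h : s.IsRightSolution a S) (ha : Measurable a)
    (hv : ∀ t, a t = 0 ∨ a t = 1) (h0 : S 0 = s.S0) : s.IsTrajectory a S := by
  refine ⟨ha, hv, h.continuousOn, fun t ht => ?_⟩
  have hai : IntervalIntegrable a volume 0 t := by
    refine (intervalIntegrable_const (c := (1 : ℝ))).mono_fun ha.aestronglyMeasurable
      (Eventually.of_forall fun u => ?_)
    rcases hv u with e | e <;> simp [e]
  have hc : ContinuousOn S (uIcc 0 t) := by
    rw [uIcc_of_le ht]
    exact h.continuousOn.mono fun u hu => hu.1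
  have hint : IntervalIntegrable
      (fun u => 2 * s.A * S u + s.W - a u * (s.C ^ 2 / s.V) * S u ^ 2) volume 0 t :=
    ((hc.intervalIntegrable.const_mul _).add intervalIntegrable_const).sub
      ((hai.mul_const _).mul_continuousOn (hc.pow 2))
  have := intervalIntegral.integral_eq_sub_of_hasDeriv_right_of_le ht
    (h.continuousOn.mono fun u hu => hu.1) (fun x hx => h.deriv_right x hx.1.le) hint
  simp only [drift] at this
  rw [this, h0]
  ring

/-- Solutions can be concatenated. -/
theorem IsRightSolution.concat {b E : ℝ → ℝ} {r : ℝ} (hr : 0 ≤ r) (hE : s.IsRightSolution b E)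
    (h : s.IsRightSolution a S) (hrE : E r = S 0) :
    s.IsRightSolution (fun t => if t < r then b t else a (t - r))
      (fun t => if t < r then E t else S (t - r)) := by
  have hsub : ∀ t, ContinuousWithinAt (fun t => t - r) (Ici r) t := fun t => by fun_prop
  refine ⟨?_, fun t ht => ?_⟩
  · have h1 : ContinuousOn (fun t => if t < r then E t else S (t - r)) (Icc 0 r) := by
      refine (hE.continuousOn.mono fun u hu => hu.1).congr fun u hu => ?_
      rcases hu.2.lt_or_eq with hu2 | hu2
      · simp [hu2]
      · simp [hu2, hrE]
    have h2 : ContinuousOn (fun t => if t < r then E t else S (t - r)) (Ici r) := by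
      have : ContinuousOn (fun t => S (t - r)) (Ici r) :=
        h.continuousOn.comp (by fun_prop) fun u hu => sub_nonneg.2 (mem_Ici.1 hu)
      refine this.congr fun u hu => ?_
      simp [not_lt.2 (show r ≤ u from hu)]
    have := h1.union_of_isClosed h2 isClosed_Icc isClosed_Ici
    rwa [Icc_union_Ici_eq_Ici hr] at this
  · by_cases htr : t < r
    · simp only [htr, if_true]
      refine (hE.deriv_right t ht).congr_of_eventuallyEq ?_ (by simp [htr])
      filter_upwards [mem_nhdsWithin_of_mem_nhds (Iio_mem_nhds htr)] with u hu
      simp [show u < r from hu]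
    · simp only [htr, if_false]
      have hd := h.deriv_right (t - r) (by linarith)
      have h1 : HasDerivWithinAt (fun u => u - r) 1 (Ioi t) t :=
        ((hasDerivAt_id t).sub_const r).hasDerivWithinAt
      have h2 := hd.scomp t h1 (fun u hu => sub_lt_sub_right hu r)
      simp only [one_smul] at h2
      refine h2.congr_of_eventuallyEq ?_ (by simp [htr])
      filter_upwards [self_mem_nhdsWithin] with u hu
      have : ¬ u < r := not_lt.2 ((not_lt.1 htr).trans (le_of_lt hu))
      simp [this]

/-- The integral of `exp (2 A u)` over `[0, t]`. -/
noncomputable def expIntegral (A t : ℝ) : ℝ :=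
  if A = 0 then t else (Real.exp (2 * A * t) - 1) / (2 * A)

theorem two_mul_expIntegral (A t : ℝ) : 2 * A * expIntegral A t = Real.exp (2 * A * t) - 1 := by
  unfold expIntegral
  split_ifs with h
  · simp [h]
  · field_simp

theorem hasDerivAt_expIntegral (A t : ℝ) :
    HasDerivAt (expIntegral A) (Real.exp (2 * A * t)) t := by
  by_cases h : A = 0
  · have : expIntegral A = id := by
      ext u
      simp [expIntegral, h]
    rw [this]
    simpa [h] using hasDerivAt_id t
  · have : expIntegral A = fun u => (Real.exp (2 * A * u) - 1) / (2 * A) := by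
      ext u
      simp [expIntegral, h]
    rw [this]
    have h1 : HasDerivAt (fun u => 2 * A * u) (2 * A) t := by
      simpa using (hasDerivAt_id t).const_mul (2 * A)
    convert! (h1.exp.sub_const 1).div_const (2 * A) using 1
    field_simp

theorem le_expIntegral {A t : ℝ} (hA : 0 ≤ A) : t ≤ expIntegral A t := by
  unfold expIntegral
  split_ifs with h
  · exact le_rfl
  · have hA' : 0 < A := lt_of_le_of_ne hA (Ne.symm h)
    rw [le_div_iff₀ (by positivity)]
    linarith [Real.add_one_le_exp (2 * A * t)]

/-- The flow of the unobserved variance. -/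
noncomputable def passiveFlow (s : ScalarSite) (c t : ℝ) : ℝ :=
  c * Real.exp (2 * s.A * t) + s.W * expIntegral s.A t

theorem passiveFlow_zero (s : ScalarSite) (c : ℝ) : s.passiveFlow c 0 = c := by
  simp [passiveFlow, expIntegral]

theorem drift_passiveFlow (s : ScalarSite) (c t : ℝ) :
    2 * s.A * s.passiveFlow c t + s.W = (2 * s.A * c + s.W) * Real.exp (2 * s.A * t) := by
  unfold passiveFlow
  linear_combination s.W * two_mul_expIntegral s.A t

theorem hasDerivAt_passiveFlow (s : ScalarSite) (c t : ℝ) :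
    HasDerivAt (s.passiveFlow c) (s.drift 0 (s.passiveFlow c t)) t := by
  have h1 : HasDerivAt (fun u => 2 * s.A * u) (2 * s.A) t := by
    simpa using (hasDerivAt_id t).const_mul (2 * s.A)
  have h2 := (h1.exp.const_mul c).add ((hasDerivAt_expIntegral s.A t).const_mul s.W)
  convert! h2 using 1
  unfold drift
  rw [zero_mul, zero_mul, sub_zero, drift_passiveFlow]
  ring

theorem continuous_passiveFlow (s : ScalarSite) (c : ℝ) : Continuous (s.passiveFlow c) :=
  continuous_iff_continuousAt.2 fun t => (s.hasDerivAt_passiveFlow c t).continuousAt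

theorem strictMono_passiveFlow (h : 0 < 2 * s.A * c + s.W) : StrictMono (s.passiveFlow c) := by
  refine strictMono_of_deriv_pos fun t => ?_
  rw [(s.hasDerivAt_passiveFlow c t).deriv]
  unfold drift
  rw [zero_mul, zero_mul, sub_zero, drift_passiveFlow]
  positivity

theorem isRightSolution_passiveFlow (s : ScalarSite) (c : ℝ) :
    s.IsRightSolution (fun _ => 0) (s.passiveFlow c) :=
  ⟨(s.continuous_passiveFlow c).continuousOn,
    fun t _ => (s.hasDerivAt_passiveFlow c t).hasDerivWithinAt⟩

theorem tendsto_passiveFlow (hA : s.A < 0) (c : ℝ) :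
    Tendsto (s.passiveFlow c) atTop (𝓝 s.xe) := by
  have h1 : Tendsto (fun t => Real.exp (2 * s.A * t)) atTop (𝓝 0) :=
    Real.tendsto_exp_atBot.comp (tendsto_id.const_mul_atTop_of_neg (by linarith))
  have h2 : s.passiveFlow c
      = fun t => c * Real.exp (2 * s.A * t) + s.W * ((Real.exp (2 * s.A * t) - 1) / (2 * s.A)) := by
    ext t
    simp [passiveFlow, expIntegral, hA.ne]
  rw [h2]
  have h3 := (h1.const_mul c).add (((h1.sub_const 1).div_const (2 * s.A)).const_mul s.W)
  convert! h3 using 2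
  unfold xe
  ring

/-- For `A < 0` the flow converges to `xe > X`. For `A ≥ 0` it grows at least at rate `W`, so time
`X / W` suffices to pass `X`. The intermediate value theorem does the rest. -/
theorem exists_passiveFlow_eq (hX : 0 < 2 * s.A * X + s.W) (hc : 0 < c) (hcX : c ≤ X) :
    ∃ r, 0 ≤ r ∧ s.passiveFlow c r = X := by
  have : ∃ r, 0 ≤ r ∧ X ≤ s.passiveFlow c r := by
    rcases lt_or_ge s.A 0 with hA | hA
    · have h1 := (tendsto_passiveFlow hA c).eventually
        (lt_mem_nhds ((passive_drift_pos_iff hA X).1 hX))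
      obtain ⟨r, hr, hr0⟩ := (h1.and (eventually_ge_atTop 0)).exists
      exact ⟨r, hr0, hr.le⟩
    · have hX0 : 0 < X := hc.trans_le hcX
      have hW := s.W_pos
      have hr : 0 ≤ X / s.W := by positivity
      refine ⟨X / s.W, hr, ?_⟩
      have h1 := mul_le_mul_of_nonneg_left (le_expIntegral (t := X / s.W) hA) hW.le
      rw [mul_div_cancel₀ _ hW.ne'] at h1
      have : 0 ≤ c * Real.exp (2 * s.A * (X / s.W)) := by positivity
      unfold passiveFlow
      linarith
  obtain ⟨r, hr, hr2⟩ := this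
  have h1 := intermediate_value_Icc hr (s.continuous_passiveFlow c).continuousOn
  obtain ⟨u, hu, hu2⟩ := h1 ⟨by rwa [passiveFlow_zero], hr2⟩
  exact ⟨u, hu.1, hu2⟩

/-- The Möbius coordinate that linearizes the flow of the observed variance. -/
noncomputable def activeCoord (s : ScalarSite) (c t : ℝ) : ℝ :=
  (c - s.x2) / (c - s.x1) * Real.exp (-(s.C ^ 2 / s.V * (s.x2 - s.x1) * t))

/-- The flow of the observed variance. -/
noncomputable def activeFlow (s : ScalarSite) (c t : ℝ) : ℝ :=
  s.x1 + (s.x2 - s.x1) / (1 - s.activeCoord c t)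

theorem activeFlow_zero (hC : s.C ≠ 0) (hc : 0 < c) : s.activeFlow c 0 = c := by
  have h1 := x1_neg hC
  have h2 := x2_pos hC
  have h3 : c - s.x1 ≠ 0 := by linarith
  have h4 : s.x2 - s.x1 ≠ 0 := by linarith
  have : 1 - (c - s.x2) / (c - s.x1) = (s.x2 - s.x1) / (c - s.x1) := by
    field_simp
    ring
  simp only [activeFlow, activeCoord, mul_zero, neg_zero, Real.exp_zero, mul_one, this]
  field_simp
  ring

theorem continuous_activeCoord (s : ScalarSite) (c : ℝ) : Continuous (s.activeCoord c) := by
  unfold activeCoord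
  fun_prop

theorem hasDerivAt_activeFlow (hC : s.C ≠ 0) {t : ℝ} (ht : s.activeCoord c t < 1) :
    HasDerivAt (s.activeFlow c) (s.drift 1 (s.activeFlow c t)) t := by
  have h1 : HasDerivAt (fun u => -(s.C ^ 2 / s.V * (s.x2 - s.x1) * u))
      (-(s.C ^ 2 / s.V * (s.x2 - s.x1))) t := by
    simpa using ((hasDerivAt_id t).const_mul (s.C ^ 2 / s.V * (s.x2 - s.x1))).fun_neg
  have h2 : HasDerivAt (s.activeCoord c)
      (s.activeCoord c t * -(s.C ^ 2 / s.V * (s.x2 - s.x1))) t := by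
    convert! h1.exp.const_mul ((c - s.x2) / (c - s.x1)) using 1
    unfold activeCoord
    ring
  have hne : 1 - s.activeCoord c t ≠ 0 := by linarith
  have h3 := ((h2.const_sub 1).fun_inv hne).const_mul (s.x2 - s.x1) |>.const_add s.x1
  have e : s.activeFlow c
      = fun u => s.x1 + (s.x2 - s.x1) * (1 - s.activeCoord c u)⁻¹ := by
    ext u
    rw [activeFlow, div_eq_mul_inv]
  have e2 : s.drift 1 (s.activeFlow c t)
      = s.C ^ 2 / s.V * (s.activeFlow c t - s.x1) * (s.x2 - s.activeFlow c t) := by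
    rw [← active_drift_eq hC, drift, one_mul]
  rw [e2, e]
  convert! h3 using 1
  field_simp
  ring

/-- The active flow has a pole where the coordinate equals `1`. The coordinate starts below `1`
because `x1 < x2`, and forward in time its modulus does not grow. -/
theorem activeCoord_lt_one (hC : s.C ≠ 0) (hc : 0 < c) {t : ℝ} (ht : 0 ≤ t) :
    s.activeCoord c t < 1 := by
  have h1 := x1_neg hC
  have h2 := x2_pos hC
  have hR := gain_pos hC
  have hq : (c - s.x2) / (c - s.x1) < 1 := by
    rw [div_lt_one (by linarith)]
    linarith
  have he : Real.exp (-(s.C ^ 2 / s.V * (s.x2 - s.x1) * t)) ≤ 1 := by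
    rw [Real.exp_le_one_iff, neg_nonpos]
    exact mul_nonneg (mul_nonneg hR.le (by linarith)) ht
  have he0 := Real.exp_pos (-(s.C ^ 2 / s.V * (s.x2 - s.x1) * t))
  unfold activeCoord
  nlinarith

theorem isRightSolution_activeFlow (hC : s.C ≠ 0) (hc : 0 < c) :
    s.IsRightSolution (fun _ => 1) (s.activeFlow c) :=
  ⟨fun _ ht => (hasDerivAt_activeFlow hC
    (activeCoord_lt_one hC hc ht)).continuousAt.continuousWithinAt,
    fun _ ht => (hasDerivAt_activeFlow hC (activeCoord_lt_one hC hc ht)).hasDerivWithinAt⟩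

theorem tendsto_activeFlow (hC : s.C ≠ 0) (c : ℝ) :
    Tendsto (s.activeFlow c) atTop (𝓝 s.x2) := by
  have hk : 0 < s.C ^ 2 / s.V * (s.x2 - s.x1) :=
    mul_pos (gain_pos hC) (by linarith [x1_neg hC, x2_pos hC])
  have h1 : Tendsto (fun t => Real.exp (-(s.C ^ 2 / s.V * (s.x2 - s.x1) * t))) atTop (𝓝 0) :=
    Real.tendsto_exp_neg_atTop_nhds_zero.comp (tendsto_id.const_mul_atTop hk)
  have h2 : Tendsto (s.activeCoord c) atTop (𝓝 0) := by
    have := h1.const_mul ((c - s.x2) / (c - s.x1))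
    rwa [mul_zero] at this
  have h3 := ((tendsto_const_nhds (x := s.x2 - s.x1)).div (h2.const_sub 1) (by norm_num)).const_add
    s.x1
  convert! h3 using 2
  ring

theorem exists_activeFlow_eq (hC : s.C ≠ 0) (hX : s.x2 < X) (hcX : X ≤ c) :
    ∃ r, 0 ≤ r ∧ s.activeFlow c r = X := by
  have hc : 0 < c := (x2_pos hC).trans (hX.trans_le hcX)
  obtain ⟨r, hr, hr0⟩ := (((tendsto_activeFlow hC c).eventually (gt_mem_nhds hX)).and
    (eventually_ge_atTop 0)).exists
  have h1 := intermediate_value_Icc' hr0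
    ((isRightSolution_activeFlow hC hc).continuousOn.mono fun u hu => hu.1)
  obtain ⟨u, hu, hu2⟩ := h1 ⟨hr.le, by rwa [activeFlow_zero hC hc]⟩
  exact ⟨u, hu.1, hu2⟩

/-- Negative times are admitted as long as the pole is not met, since a chattering cycle follows the
active flow backwards from its endpoint. -/
theorem activeFlow_lt_activeFlow (hC : s.C ≠ 0) (hX : s.x2 < c) {t u : ℝ} (htu : t < u)
    (ht : s.activeCoord c t < 1) : s.activeFlow c u < s.activeFlow c t := by
  have h1 := x1_neg hC
  have h2 := x2_pos hC
  have hk : 0 < s.C ^ 2 / s.V * (s.x2 - s.x1) := mul_pos (gain_pos hC) (by linarith)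
  have hq : 0 < (c - s.x2) / (c - s.x1) := div_pos (by linarith) (by linarith)
  have h3 : s.activeCoord c u < s.activeCoord c t := by
    unfold activeCoord
    gcongr
  unfold activeFlow
  have h4 : (s.x2 - s.x1) / (1 - s.activeCoord c u) < (s.x2 - s.x1) / (1 - s.activeCoord c t) :=
    div_lt_div_of_pos_left (by linarith) (by linarith) (by linarith)
  linarith

/-- Reachability of `X` from any variance. -/
theorem exists_constant_policy_reaching (hC : s.C ≠ 0) (hX : s.x2 < X)
    (hX' : 0 < 2 * s.A * X + s.W) : ∃ b E r, (b = 0 ∨ b = 1) ∧ 0 ≤ r ∧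
      s.IsRightSolution (fun _ => b) E ∧ E 0 = s.S0 ∧ E r = X := by
  rcases le_total s.S0 X with h | h
  · obtain ⟨r, hr, hr2⟩ := exists_passiveFlow_eq hX' s.S0_pos h
    exact ⟨0, _, r, Or.inl rfl, hr, s.isRightSolution_passiveFlow s.S0, s.passiveFlow_zero _, hr2⟩
  · obtain ⟨r, hr, hr2⟩ := exists_activeFlow_eq hC hX h
    exact ⟨1, _, r, Or.inr rfl, hr, isRightSolution_activeFlow hC s.S0_pos,
      activeFlow_zero hC s.S0_pos, hr2⟩

end ScalarSite

/-! ### Chattering policies that steer the variance to a prescribed level -/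

/-- Nodes of a partition of `[0, ∞)` whose mesh tends to `0`. -/
noncomputable def node (ε : ℝ) (n : ℕ) : ℝ := ε * √n

/-- The index of the cell of the partition that contains `t`. -/
noncomputable def nodeIndex (ε t : ℝ) : ℕ := ⌊(t / ε) ^ 2⌋₊

theorem nodeIndex_eq_iff {ε t : ℝ} {n : ℕ} (hε : 0 < ε) (ht : 0 ≤ t) :
    nodeIndex ε t = n ↔ node ε n ≤ t ∧ t < node ε (n + 1) := by
  have hu : 0 ≤ t / ε := by positivity
  unfold nodeIndex node
  rw [Nat.floor_eq_iff (by positivity), mul_comm, mul_comm ε, ← le_div_iff₀ hε, ← div_lt_iff₀ hε,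
    Real.sqrt_le_left hu, Real.lt_sqrt hu]
  simp

theorem node_zero (ε : ℝ) : node ε 0 = 0 := by simp [node]

theorem node_le_node_succ {ε : ℝ} (hε : 0 < ε) (n : ℕ) : node ε n ≤ node ε (n + 1) := by
  unfold node
  gcongr
  simp

theorem node_lt_node_succ {ε : ℝ} (hε : 0 < ε) (n : ℕ) : node ε n < node ε (n + 1) := by
  unfold node
  gcongr
  simp

theorem node_nonneg {ε : ℝ} (hε : 0 < ε) (n : ℕ) : 0 ≤ node ε n := by
  unfold node
  positivity

/-- This uniform bound keeps the backward active flow away from its pole on every cell, the first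
ones included. -/
theorem node_succ_sub_le {ε : ℝ} (hε : 0 < ε) (n : ℕ) : node ε (n + 1) - node ε n ≤ ε := by
  have h : √((n : ℝ) + 1) ≤ √n + 1 := by
    rw [Real.sqrt_le_left (by positivity)]
    nlinarith [Real.sq_sqrt (Nat.cast_nonneg n : (0 : ℝ) ≤ n), Real.sqrt_nonneg (n : ℝ)]
  unfold node
  push_cast
  nlinarith

theorem tendsto_node (ε : ℝ) (hε : 0 < ε) : Tendsto (node ε) atTop atTop :=
  (Real.tendsto_sqrt_atTop.comp tendsto_natCast_atTop_atTop).const_mul_atTop hε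

/-- The squares of the nodes form an arithmetic progression of step `ε²`, so `t` exceeds the last
node by at most `ε² / t`. -/
theorem tendsto_sub_node {ε : ℝ} (hε : 0 < ε) :
    Tendsto (fun t => t - node ε (nodeIndex ε t)) atTop (𝓝 0) := by
  have h1 : Tendsto (fun t : ℝ => ε ^ 2 / t) atTop (𝓝 0) := tendsto_id.const_div_atTop _
  refine tendsto_of_tendsto_of_tendsto_of_le_of_le' tendsto_const_nhds h1 ?_ ?_
  · filter_upwards [eventually_ge_atTop 0] with t ht
    linarith [((nodeIndex_eq_iff hε ht).1 rfl).1]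
  · filter_upwards [eventually_gt_atTop 0] with t ht
    have h2 := ((nodeIndex_eq_iff hε ht.le).1 rfl)
    set n := nodeIndex ε t
    have hn : node ε (n + 1) ^ 2 = node ε n ^ 2 + ε ^ 2 := by
      unfold node
      rw [mul_pow, mul_pow, Real.sq_sqrt (by positivity), Real.sq_sqrt (by positivity)]
      push_cast
      ring
    have h0 := node_nonneg hε n
    rw [le_div_iff₀ ht]
    nlinarith

namespace ScalarSite

variable {s : ScalarSite} {X : ℝ}

/-- Run backwards from `X > x2`, the active flow blows up in finite time. Continuity of the
coordinate at `0` gives a safe backward horizon `ε`, which serves as the scale of the partition. -/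
theorem exists_activeCoord_lt_one (hC : s.C ≠ 0) (hX : s.x2 < X) :
    ∃ ε, 0 < ε ∧ ∀ u, -ε ≤ u → s.activeCoord X u < 1 := by
  have hX0 : 0 < X := (x2_pos hC).trans hX
  have hev := (s.continuous_activeCoord X).continuousAt.eventually
    (gt_mem_nhds (activeCoord_lt_one hC hX0 (le_refl 0)))
  obtain ⟨δ, hδ, h⟩ := Metric.eventually_nhds_iff.1 hev
  refine ⟨δ / 2, by positivity, fun u hu => ?_⟩
  have h1 : s.activeCoord X (-(δ / 2)) < 1 := by
    refine h ?_
    rw [Real.dist_eq, sub_zero, abs_neg, abs_of_pos (by positivity)]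
    linarith
  refine lt_of_le_of_lt ?_ h1
  have hk : 0 < s.C ^ 2 / s.V * (s.x2 - s.x1) :=
    mul_pos (gain_pos hC) (by linarith [x1_neg hC, x2_pos hC])
  have hq : 0 < (X - s.x2) / (X - s.x1) :=
    div_pos (by linarith) (by linarith [x1_neg hC, x2_pos hC])
  unfold activeCoord
  gcongr

/-- On the `n`-th cell the variance first rises from `X` unobserved, and then falls back to `X`
under observation. -/
noncomputable def cycle (s : ScalarSite) (X ε : ℝ) (n : ℕ) (t : ℝ) : ℝ :=
  min (s.passiveFlow X (t - node ε n)) (s.activeFlow X (t - node ε (n + 1)))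

noncomputable def chatter (s : ScalarSite) (X ε t : ℝ) : ℝ := s.cycle X ε (nodeIndex ε t) t

-- The active action is taken exactly where the active flow attains the minimum in `cycle`. Ties
-- count as active: right after a tie the active flow is the smaller one, so the choice agrees with
-- right derivatives.
open Classical in
noncomputable def chatterPolicy (s : ScalarSite) (X ε t : ℝ) : ℝ :=
  if s.activeFlow X (t - node ε (nodeIndex ε t + 1)) ≤ s.passiveFlow X (t - node ε (nodeIndex ε t))
  then 1 else 0

theorem measurable_chatterPolicy (s : ScalarSite) (X ε : ℝ) :
    Measurable (s.chatterPolicy X ε) := by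
  have h1 : Measurable (nodeIndex ε) :=
    Nat.measurable_floor.comp ((measurable_id.div_const ε).pow_const 2)
  have h2 : Measurable fun t => t - node ε (nodeIndex ε t) :=
    measurable_id.sub ((measurable_from_nat (f := node ε)).comp h1)
  have h3 : Measurable fun t => t - node ε (nodeIndex ε t + 1) :=
    measurable_id.sub ((measurable_from_nat (f := fun n => node ε (n + 1))).comp h1)
  have h4 : Measurable (s.activeFlow X) :=
    ((measurable_const.div ((s.continuous_activeCoord X).measurable.const_sub 1))).const_add _
  exact Measurable.ite (measurableSet_le (h4.comp h3)
    ((s.continuous_passiveFlow X).measurable.comp h2)) measurable_const measurable_const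

theorem chatter_of_mem {ε t : ℝ} {n : ℕ} (hε : 0 < ε) (hn : node ε n ≤ t)
    (hn' : t < node ε (n + 1)) : s.chatter X ε t = s.cycle X ε n t := by
  have h0 : nodeIndex ε t = n :=
    (nodeIndex_eq_iff hε ((node_nonneg hε n).trans hn)).2 ⟨hn, hn'⟩
  rw [chatter, h0]

theorem le_activeFlow (hC : s.C ≠ 0) (hX : s.x2 < X) {u : ℝ} (hu : u ≤ 0)
    (h : s.activeCoord X u < 1) : X ≤ s.activeFlow X u := by
  rcases hu.lt_or_eq with h1 | h1
  · simpa [activeFlow_zero hC ((x2_pos hC).trans hX)] using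
      (activeFlow_lt_activeFlow hC hX h1 h).le
  · rw [h1, activeFlow_zero hC ((x2_pos hC).trans hX)]

theorem le_passiveFlow (hX : 0 < 2 * s.A * X + s.W) {u : ℝ} (hu : 0 ≤ u) :
    X ≤ s.passiveFlow X u := by
  simpa [passiveFlow_zero] using (strictMono_passiveFlow hX).monotone hu

theorem cycle_left (hC : s.C ≠ 0) (hX : s.x2 < X) {ε : ℝ} (hε : 0 < ε)
    (hcoord : ∀ u, -ε ≤ u → s.activeCoord X u < 1) (n : ℕ) :
    s.cycle X ε n (node ε n) = X := by
  have h1 := node_succ_sub_le hε n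
  have h2 := node_le_node_succ hε n
  rw [cycle, sub_self, passiveFlow_zero, min_eq_left]
  exact le_activeFlow hC hX (by linarith) (hcoord _ (by linarith))

theorem cycle_right (hC : s.C ≠ 0) (hX : s.x2 < X) (hX' : 0 < 2 * s.A * X + s.W) {ε : ℝ}
    (hε : 0 < ε) (n : ℕ) : s.cycle X ε n (node ε (n + 1)) = X := by
  have h2 := node_le_node_succ hε n
  rw [cycle, sub_self, activeFlow_zero hC ((x2_pos hC).trans hX), min_eq_right]
  exact le_passiveFlow hX' (by linarith)

theorem chatter_node (hC : s.C ≠ 0) (hX : s.x2 < X) {ε : ℝ} (hε : 0 < ε)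
    (hcoord : ∀ u, -ε ≤ u → s.activeCoord X u < 1) (n : ℕ) : s.chatter X ε (node ε n) = X := by
  rw [chatter_of_mem hε le_rfl (node_lt_node_succ hε n), cycle_left hC hX hε hcoord]

/-- Every cycle starts and ends at `X`, so neighbouring cells fit together, and the nodes exhaust
`[0, ∞)`. -/
theorem continuousOn_chatter (hC : s.C ≠ 0) (hX : s.x2 < X) (hX' : 0 < 2 * s.A * X + s.W) {ε : ℝ}
    (hε : 0 < ε) (hcoord : ∀ u, -ε ≤ u → s.activeCoord X u < 1) :
    ContinuousOn (s.chatter X ε) (Ici 0) := by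
  have hcell : ∀ n, ContinuousOn (s.chatter X ε) (Icc (node ε n) (node ε (n + 1))) := by
    intro n
    have hc : ContinuousOn (s.cycle X ε n) (Icc (node ε n) (node ε (n + 1))) := by
      refine ContinuousOn.inf ?_ ?_
      · exact ((s.continuous_passiveFlow X).comp (by fun_prop)).continuousOn
      · intro t ht
        have h1 := node_succ_sub_le hε n
        have h2 := (hasDerivAt_activeFlow hC
          (hcoord (t - node ε (n + 1)) (by linarith [ht.1]))).continuousAt
        exact (ContinuousAt.comp (f := fun t => t - node ε (n + 1)) h2
          (by fun_prop)).continuousWithinAt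
    refine hc.congr fun t ht => ?_
    rcases ht.2.lt_or_eq with h | h
    · exact chatter_of_mem hε ht.1 h
    · rw [h, chatter_node hC hX hε hcoord, cycle_right hC hX hX' hε]
  have hall : ∀ n, ContinuousOn (s.chatter X ε) (Icc 0 (node ε n)) := by
    intro n
    induction n with
    | zero => simp [node_zero]
    | succ n ih =>
      have := ih.union_of_isClosed (hcell n) isClosed_Icc isClosed_Icc
      rwa [Icc_union_Icc_eq_Icc (node_nonneg hε n) (node_le_node_succ hε n)] at this
  intro t ht
  obtain ⟨n, hn⟩ := ((tendsto_node ε hε).eventually (eventually_gt_atTop t)).exists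
  refine (hall n t ⟨ht, hn.le⟩).mono_of_mem_nhdsWithin ?_
  filter_upwards [self_mem_nhdsWithin, mem_nhdsWithin_of_mem_nhds (Iio_mem_nhds hn)] with u hu hu2
  exact ⟨hu, le_of_lt hu2⟩

/-- Within a cell the passive flow rises and the active flow falls. Once the active flow is the
smaller it remains so, hence to the right of each time the minimum follows a single flow. -/
theorem isRightSolution_chatter (hC : s.C ≠ 0) (hX : s.x2 < X) (hX' : 0 < 2 * s.A * X + s.W)
    {ε : ℝ} (hε : 0 < ε) (hcoord : ∀ u, -ε ≤ u → s.activeCoord X u < 1) :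
    s.IsRightSolution (s.chatterPolicy X ε) (s.chatter X ε) := by
  refine ⟨continuousOn_chatter hC hX hX' hε hcoord, fun t ht => ?_⟩
  obtain ⟨h1, h2⟩ := (nodeIndex_eq_iff hε ht).1 rfl
  have hlen := node_succ_sub_le hε (nodeIndex ε t)
  set n := nodeIndex ε t with hn
  have hP : HasDerivAt (fun u => s.passiveFlow X (u - node ε n))
      (s.drift 0 (s.passiveFlow X (t - node ε n))) t := by
    simpa using (s.hasDerivAt_passiveFlow X (t - node ε n)).comp_sub_const t (node ε n)
  have hQ : HasDerivAt (fun u => s.activeFlow X (u - node ε (n + 1)))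
      (s.drift 1 (s.activeFlow X (t - node ε (n + 1)))) t := by
    simpa using (hasDerivAt_activeFlow hC
      (hcoord (t - node ε (n + 1)) (by linarith))).comp_sub_const t (node ε (n + 1))
  have hcell : ∀ᶠ u in 𝓝[>] t, s.chatter X ε u = s.cycle X ε n u := by
    filter_upwards [Ioo_mem_nhdsGT h2] with u hu
    exact chatter_of_mem hε (h1.trans hu.1.le) hu.2
  have hSt : s.chatter X ε t = s.cycle X ε n t := chatter_of_mem hε h1 h2
  have hat : s.chatterPolicy X ε t = if s.activeFlow X (t - node ε (n + 1))
      ≤ s.passiveFlow X (t - node ε n) then 1 else 0 := by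
    simp [chatterPolicy, ← hn]
  by_cases hPQ : s.activeFlow X (t - node ε (n + 1)) ≤ s.passiveFlow X (t - node ε n)
  · have hS : s.chatter X ε t = s.activeFlow X (t - node ε (n + 1)) := by
      rw [hSt, cycle, min_eq_right hPQ]
    rw [hat, if_pos hPQ, hS]
    refine hQ.hasDerivWithinAt.congr_of_eventuallyEq ?_ hS
    filter_upwards [hcell, self_mem_nhdsWithin] with u hu htu
    rw [hu, cycle, min_eq_right]
    have h3 := activeFlow_lt_activeFlow hC hX
      (show t - node ε (n + 1) < u - node ε (n + 1) from sub_lt_sub_right htu _)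
      (hcoord _ (by linarith))
    have h4 := strictMono_passiveFlow hX'
      (show t - node ε n < u - node ε n from sub_lt_sub_right htu _)
    exact (h3.le.trans hPQ).trans h4.le
  · have hPQ' := not_le.1 hPQ
    have hS : s.chatter X ε t = s.passiveFlow X (t - node ε n) := by
      rw [hSt, cycle, min_eq_left hPQ'.le]
    rw [hat, if_neg hPQ, hS]
    refine hP.hasDerivWithinAt.congr_of_eventuallyEq ?_ hS
    have hlt : ∀ᶠ u in 𝓝 t, s.passiveFlow X (u - node ε n) < s.activeFlow X (u - node ε (n + 1)) :=
      hP.continuousAt.eventually_lt hQ.continuousAt hPQ'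
    filter_upwards [hcell, mem_nhdsWithin_of_mem_nhds hlt] with u hu hu2
    rw [hu, cycle, min_eq_left (le_of_lt hu2)]

/-- The variance lies between `X` and the passive flow from `X` run since the last node, and that
duration tends to `0`. -/
theorem tendsto_chatter (hC : s.C ≠ 0) (hX : s.x2 < X) (hX' : 0 < 2 * s.A * X + s.W)
    {ε : ℝ} (hε : 0 < ε) (hcoord : ∀ u, -ε ≤ u → s.activeCoord X u < 1) :
    Tendsto (s.chatter X ε) atTop (𝓝 X) := by
  have h1 : Tendsto (fun t => s.passiveFlow X (t - node ε (nodeIndex ε t))) atTop (𝓝 X) := by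
    have := ((s.continuous_passiveFlow X).tendsto 0).comp (tendsto_sub_node hε)
    rwa [passiveFlow_zero] at this
  refine tendsto_of_tendsto_of_tendsto_of_le_of_le' tendsto_const_nhds h1 ?_ ?_
  · filter_upwards [eventually_ge_atTop 0] with t ht
    obtain ⟨h2, h3⟩ := (nodeIndex_eq_iff hε ht).1 rfl
    have hlen := node_succ_sub_le hε (nodeIndex ε t)
    exact le_min (le_passiveFlow hX' (by linarith))
      (le_activeFlow hC hX (by linarith) (hcoord _ (by linarith)))
  · exact Eventually.of_forall fun t => min_le_left _ _

theorem exists_trajectory_passive (s : ScalarSite) :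
    s.IsTrajectory (fun _ => 0) (s.passiveFlow s.S0) :=
  (s.isRightSolution_passiveFlow s.S0).isTrajectory measurable_const (fun _ => Or.inl rfl)
    (s.passiveFlow_zero _)

/-- Every variance between those of the always active and the always passive policy is the limit
of the variance of some policy. -/
theorem exists_trajectory_tendsto (hC : s.C ≠ 0) (hX : s.x2 ≤ X) (hX' : 0 ≤ 2 * s.A * X + s.W) :
    ∃ a S, s.IsTrajectory a S ∧ Tendsto S atTop (𝓝 X) := by
  rcases hX.lt_or_eq with h1 | h1
  · rcases hX'.lt_or_eq with h2 | h2
    · obtain ⟨ε, hε, hcoord⟩ := exists_activeCoord_lt_one hC h1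
      obtain ⟨b, E, r, hb, hr, hE, hE0, hEr⟩ := exists_constant_policy_reaching hC h1 h2
      have hch := isRightSolution_chatter hC h1 h2 hε hcoord
      have h0 : s.chatter X ε 0 = X := by
        simpa [node_zero] using chatter_node hC h1 hε hcoord 0
      refine ⟨_, _, (hE.concat hr hch (hEr.trans h0.symm)).isTrajectory ?_ ?_ ?_, ?_⟩
      · exact Measurable.ite measurableSet_Iio measurable_const
          ((s.measurable_chatterPolicy X ε).comp (measurable_id.sub_const r))
      · intro t
        simp only [chatterPolicy]
        split_ifs <;> simp [hb]
      · rcases hr.lt_or_eq with h | h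
        · simp [h, hE0]
        · subst h
          simpa [h0] using hEr.symm.trans hE0
      · refine ((tendsto_chatter hC h1 h2 hε hcoord).comp
          (tendsto_atTop_add_const_right _ (-r) tendsto_id)).congr' ?_
        filter_upwards [eventually_ge_atTop r] with t ht
        simp [not_lt.2 ht, sub_eq_add_neg]
    · have hA : s.A < 0 := by
        have := (x2_pos hC).trans_le hX
        by_contra! hA
        have := s.W_pos
        nlinarith
      have hXe : X = s.xe := by
        have h3 := passive_drift_eq hA X
        rw [← h2] at h3
        have : X - s.xe = 0 := by
          rcases mul_eq_zero.1 h3.symm with h | h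
          · linarith
          · exact h
        linarith
      exact ⟨_, _, s.exists_trajectory_passive, hXe ▸ tendsto_passiveFlow hA s.S0⟩
  · refine ⟨_, _, (isRightSolution_activeFlow hC s.S0_pos).isTrajectory measurable_const
      (fun _ => Or.inr rfl) (activeFlow_zero hC s.S0_pos), h1 ▸ tendsto_activeFlow hC s.S0⟩

end ScalarSite

/-! ### Optimal activities of one site as a function of the tax -/

/-- Critical points of the static cost at two different variances belong to different taxes. -/
theorem cubic_ratio_lt {A W X Y : ℝ} (hW : 0 < W) (hX : 0 < X) (hXY : X < Y)
    (hAX : 0 < A * X + W) (hAY : 0 < A * Y + W) :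
    X ^ 3 * (A * Y + W) < Y ^ 3 * (A * X + W) := by
  have hY : 0 < Y := hX.trans hXY
  have h1 : 0 < X * Y * X * (A * Y + W) / Y := by positivity
  have e : Y ^ 3 * (A * X + W) - X ^ 3 * (A * Y + W)
      = (Y - X) * (X * Y * (A * X + W) + X * Y * (A * Y + W) + W * (X - Y) ^ 2 + W * (X * Y)) := by
    ring
  have h2 : 0 < (Y - X) *
      (X * Y * (A * X + W) + X * Y * (A * Y + W) + W * (X - Y) ^ 2 + W * (X * Y)) := by
    have : 0 < Y - X := by linarith
    positivity
  linarith

namespace ScalarSite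

variable {s : ScalarSite} {a S : ℝ → ℝ} {l X Y : ℝ}

/-- Any fraction of time can be realized as the asymptotic activity of a policy. -/
theorem exists_trajectory_average_policy (hC : s.C ≠ 0) {f : ℝ} (h0 : 0 ≤ f) (h1 : f ≤ 1) :
    ∃ a S, s.IsTrajectory a S ∧
      Tendsto (fun τ : ℝ => (∫ t in (0 : ℝ)..τ, a t) / τ) atTop (𝓝 f) := by
  rcases h0.lt_or_eq with hf | hf
  -- A site with the gain scaled by `f` behaves like the averaged dynamics at activity `f`: its `x2`
  -- solves `f R X² = 2 A X + W`, which says `s.activity X = f`.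
  · set s' : ScalarSite := { s with C := s.C * √f } with hs'
    have hC' : s'.C ≠ 0 := mul_ne_zero hC (Real.sqrt_pos.2 hf).ne'
    have hX0 := x2_pos hC'
    have hX := gain_mul_x2_sq hC'
    set X := s'.x2
    have e : (s.C * √f) ^ 2 / s.V = f * (s.C ^ 2 / s.V) := by
      rw [mul_pow, Real.sq_sqrt h0]
      ring
    simp only [hs', e] at hX
    have hR := gain_pos hC
    have hRX : 0 < s.C ^ 2 / s.V * X ^ 2 := by positivity
    have hx2 : s.x2 ≤ X := by
      by_contra! hlt
      have h2 := active_drift_eq hC X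
      have h3 : 0 < s.C ^ 2 / s.V * (X - s.x1) * (s.x2 - X) := by
        have := x1_neg hC
        exact mul_pos (mul_pos hR (by linarith)) (by linarith)
      nlinarith
    have hdr : 0 ≤ 2 * s.A * X + s.W := by
      rw [← hX]
      positivity
    obtain ⟨a, S, h, hS⟩ := exists_trajectory_tendsto hC hx2 hdr
    refine ⟨a, S, h, ?_⟩
    have hf' : s.activity X = f := by
      rw [activity, ← hX, mul_assoc, mul_div_cancel_right₀ _ hRX.ne']
    exact hf' ▸ h.tendsto_average_policy hC hX0 hS
  · refine ⟨_, _, s.exists_trajectory_passive, ?_⟩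
    simp [← hf]

/-- For `C = 0` the action does not enter the Riccati equation, so a policy of the prescribed
activity can be borrowed from a fictitious site with `C = 1`. -/
theorem exists_trajectory_of_unobservable (hC : s.C = 0) {f : ℝ} (h0 : 0 ≤ f) (h1 : f ≤ 1) :
    ∃ a, s.IsTrajectory a (s.passiveFlow s.S0) ∧
      Tendsto (fun τ : ℝ => (∫ t in (0 : ℝ)..τ, a t) / τ) atTop (𝓝 f) := by
  obtain ⟨a, S, h, ha⟩ := exists_trajectory_average_policy (s := { s with C := 1 }) one_ne_zero h0 h1
  refine ⟨a, ⟨h.measurable_policy, h.policy_values, s.exists_trajectory_passive.continuousOn,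
    fun t ht => ?_⟩, ha⟩
  rw [s.exists_trajectory_passive.riccati t ht]
  simp [hC]

/-- The optimal policies of a site with finite optimal cost: `v l` is the optimal cost under tax
`l`, and `D l` is the set of asymptotic activities of optimal policies. -/
structure IsDual (s : ScalarSite) (v : ℝ → ℝ) (D : ℝ → Set ℝ) : Prop where
  lower : ∀ a S, s.IsTrajectory a S → ∀ l, ∃ K, ∀ τ, 0 ≤ τ →
    v l * τ - K ≤ ∫ t in (0 : ℝ)..τ, (s.T * S t + (s.kappa + l) * a t)
  attained : ∀ l, ∀ f ∈ D l, ∃ a S, s.IsTrajectory a S ∧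
    Tendsto (fun τ : ℝ => (∫ t in (0 : ℝ)..τ, a t) / τ) atTop (𝓝 f) ∧
    Tendsto (fun τ : ℝ => (∫ t in (0 : ℝ)..τ, s.T * S t) / τ) atTop (𝓝 (v l - (s.kappa + l) * f))
  nonempty : ∀ l, (D l).Nonempty
  convex : ∀ l, Convex ℝ (D l)
  subset : ∀ l, D l ⊆ Icc 0 1
  closed : ∀ (u w : ℕ → ℝ) (l f : ℝ), Tendsto u atTop (𝓝 l) → Tendsto w atTop (𝓝 f) →
    (∀ n, w n ∈ D (u n)) → f ∈ D l
  eq_one : ∃ L, ∀ l ≤ L, ∀ f ∈ D l, f = 1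
  le_eps : ∀ ε > 0, ∃ L, ∀ l ≥ L, ∀ f ∈ D l, f ≤ ε

/-- The optimal activities of a site whose cost of variance cannot be influenced. -/
def stepActivity (κ l : ℝ) : Set ℝ := {f | f ∈ Icc 0 1 ∧ (κ + l) * f = min (l + κ) 0}

/-- If the variance costs at least `c` on average and `c` is compatible with every activity, what
remains is to minimize the linear function `(κ + l) f` over `[0, 1]`. -/
theorem IsDual.of_step {c : ℝ}
    (hlow : ∀ a S, s.IsTrajectory a S → ∃ K, ∀ τ, 0 ≤ τ →
      c * τ - K ≤ ∫ t in (0 : ℝ)..τ, s.T * S t)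
    (hatt : ∀ f ∈ Icc (0 : ℝ) 1, ∃ a S, s.IsTrajectory a S ∧
      Tendsto (fun τ : ℝ => (∫ t in (0 : ℝ)..τ, a t) / τ) atTop (𝓝 f) ∧
      Tendsto (fun τ : ℝ => (∫ t in (0 : ℝ)..τ, s.T * S t) / τ) atTop (𝓝 c)) :
    s.IsDual (fun l => c + min (l + s.kappa) 0) (stepActivity s.kappa) where
  lower a S h l := by
    obtain ⟨K, hK⟩ := hlow a S h
    refine ⟨K, fun τ hτ => ?_⟩
    rw [intervalIntegral.integral_add ((h.intervalIntegrable le_rfl hτ).const_mul _)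
      ((h.intervalIntegrable_policy 0 τ).const_mul _),
      intervalIntegral.integral_const_mul (s.kappa + l)]
    have h0 := h.integral_policy_nonneg hτ
    have h1 := h.integral_policy_le hτ
    have h2 := hK τ hτ
    have h3 : min (l + s.kappa) 0 * τ ≤ (s.kappa + l) * ∫ t in (0 : ℝ)..τ, a t := by
      rcases le_total (l + s.kappa) 0 with h4 | h4
      · rw [min_eq_left h4]
        nlinarith
      · rw [min_eq_right h4, zero_mul]
        exact mul_nonneg (by linarith) h0
    linarith
  attained l f hf := by
    obtain ⟨a, S, h, h1, h2⟩ := hatt f hf.1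
    refine ⟨a, S, h, h1, ?_⟩
    rwa [hf.2, add_sub_cancel_right]
  nonempty l := by
    rcases le_total (l + s.kappa) 0 with h | h
    · exact ⟨1, by norm_num, by rw [min_eq_left h]; ring⟩
    · exact ⟨0, by norm_num, by rw [min_eq_right h]; ring⟩
  convex l := by
    intro x hx y hy p q hp hq hpq
    refine ⟨convex_Icc 0 1 hx.1 hy.1 hp hq hpq, ?_⟩
    simp only [smul_eq_mul]
    linear_combination p * hx.2 + q * hy.2 + min (l + s.kappa) 0 * hpq
  subset l f hf := hf.1
  closed u w l f hu hw h := by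
    refine ⟨isClosed_Icc.mem_of_tendsto hw (Eventually.of_forall fun n => (h n).1), ?_⟩
    have h1 : Tendsto (fun n => (s.kappa + u n) * w n) atTop (𝓝 ((s.kappa + l) * f)) :=
      (hu.const_add _).mul hw
    have h2 : Tendsto (fun n => min (u n + s.kappa) 0) atTop (𝓝 (min (l + s.kappa) 0)) :=
      (hu.add_const _).min tendsto_const_nhds
    exact tendsto_nhds_unique (h1.congr fun n => (h n).2) h2
  eq_one := by
    refine ⟨-s.kappa - 1, fun l hl f hf => ?_⟩
    have h1 := hf.2
    rw [min_eq_left (by linarith)] at h1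
    have h2 : (s.kappa + l) * (f - 1) = 0 := by linarith
    rcases mul_eq_zero.1 h2 with h | h <;> linarith
  le_eps ε hε := by
    refine ⟨-s.kappa + 1, fun l hl f hf => ?_⟩
    have h1 := hf.2
    rw [min_eq_right (by linarith)] at h1
    rcases mul_eq_zero.1 h1 with h | h <;> linarith

theorem isDual_of_T_eq_zero (hT : s.T = 0) :
    s.IsDual (fun l => min (l + s.kappa) 0) (stepActivity s.kappa) := by
  have := IsDual.of_step (s := s) (c := 0) (fun a S h => ⟨0, fun τ hτ => by simp [hT]⟩) ?_
  · simpa using this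
  · intro f hf
    by_cases hC : s.C = 0
    · obtain ⟨a, h, h1⟩ := exists_trajectory_of_unobservable hC hf.1 hf.2
      exact ⟨_, _, h, h1, by simp [hT]⟩
    · obtain ⟨a, S, h, h1⟩ := exists_trajectory_average_policy hC hf.1 hf.2
      exact ⟨_, _, h, h1, by simp [hT]⟩

theorem isDual_of_unobservable (hC : s.C = 0) (hA : s.A < 0) :
    s.IsDual (fun l => s.T * s.xe + min (l + s.kappa) 0) (stepActivity s.kappa) := by
  refine IsDual.of_step (fun a S h => ?_) fun f hf => ?_
  · have hX := xe_pos hA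
    have hW := s.W_pos
    have he := two_A_mul_xe hA
    have hμ : 0 ≤ s.T * s.xe ^ 3 / s.W := div_nonneg (mul_nonneg s.T_nonneg (by positivity)) hW.le
    refine ⟨s.T * s.xe ^ 3 / s.W * s.S0⁻¹, fun τ hτ => ?_⟩
    have h1 := h.static_bound hX hμ ?_ hτ
    · simpa [hC, he] using h1
    · have h2 := div_mul_cancel₀ (s.T * s.xe ^ 3) hW.ne'
      linear_combination h2 + s.T * s.xe ^ 3 / s.W * he
  · obtain ⟨a, h, h1⟩ := exists_trajectory_of_unobservable hC hf.1 hf.2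
    exact ⟨_, _, h, h1, h.tendsto_average_variance (tendsto_passiveFlow hA _)⟩

theorem passive_drift_pos_of_lt (hX : 0 < X) (hXY : X < Y) (hY : 0 ≤ 2 * s.A * Y + s.W) :
    0 < 2 * s.A * X + s.W := by
  rcases lt_or_ge s.A 0 with hA | hA
  · nlinarith
  · have := s.W_pos
    positivity

theorem T_pos (hT : s.T ≠ 0) : 0 < s.T := lt_of_le_of_ne s.T_nonneg hT.symm

/-- For `X < Y`, `lower` is informative at `Y` and `upper` at `X`. Together they give `Y³ / (A Y +
W) ≤ X³ / (A X + W)`, against `cubic_ratio_lt`. -/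
theorem IsOperatingPoint.le_of_isOperatingPoint (hC : s.C ≠ 0) (hT : s.T ≠ 0)
    (hX : s.IsOperatingPoint l X) (hY : s.IsOperatingPoint l Y) : Y ≤ X := by
  by_contra! hXY
  have hX0 : 0 < X := (x2_pos hC).trans_le hX.x2_le
  have hd := passive_drift_pos_of_lt hX0 hXY hY.drift_nonneg
  have hR := mul_pos (T_pos hT) (gain_pos hC)
  have hlow := hY.lower
  have hupp := hX.upper
  set R := s.C ^ 2 / s.V
  have hgY : 0 ≤ 2 * (s.kappa + l) * (s.A * Y + s.W) - s.T * R * Y ^ 3 :=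
    nonneg_of_mul_nonneg_right hlow (by linarith [hX.x2_le])
  have hgX : 2 * (s.kappa + l) * (s.A * X + s.W) - s.T * R * X ^ 3 ≤ 0 :=
    nonpos_of_mul_nonpos_right hupp hd
  have hqX := A_mul_add_W_pos hX.drift_nonneg
  have hqY := A_mul_add_W_pos hY.drift_nonneg
  have h := mul_lt_mul_of_pos_left (cubic_ratio_lt s.W_pos hX0 hXY hqX hqY) hR
  have h1 := mul_nonneg hgY hqX.le
  have h2 := mul_nonneg (neg_nonneg.2 hgX) hqY.le
  nlinarith

theorem IsOperatingPoint.unique (hC : s.C ≠ 0) (hT : s.T ≠ 0)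
    (hX : s.IsOperatingPoint l X) (hY : s.IsOperatingPoint l Y) : X = Y :=
  le_antisymm (hY.le_of_isOperatingPoint hC hT hX) (hX.le_of_isOperatingPoint hC hT hY)

/-- A bound on the operating points in terms of a bound on the tax. -/
theorem IsOperatingPoint.le_bound (hC : s.C ≠ 0) (hT : s.T ≠ 0) (hX : s.IsOperatingPoint l X)
    {B : ℝ} (hB : |s.kappa + l| ≤ B) :
    X ≤ s.x2 + 1 + 2 * B * (|s.A| + s.W) / (s.T * (s.C ^ 2 / s.V)) := by
  have hR := mul_pos (T_pos hT) (gain_pos hC)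
  have hx2 := x2_pos hC
  have hB0 : 0 ≤ B := (abs_nonneg _).trans hB
  have hW := s.W_pos
  have hlow := hX.lower
  have hd := hX.drift_nonneg
  have hq := A_mul_add_W_pos hd
  set R := s.T * (s.C ^ 2 / s.V)
  have hbd : 0 ≤ 2 * B * (|s.A| + s.W) / R := by positivity
  rcases hX.x2_le.lt_or_eq with hlt | heq
  · rcases le_total X 1 with h1 | h1
    · linarith
    · have hg := nonneg_of_mul_nonneg_right hlow (by linarith)
      have h2 : (s.kappa + l) * (s.A * X + s.W) ≤ B * ((|s.A| + s.W) * X) := by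
        refine mul_le_mul ((le_abs_self _).trans hB) ?_ hq.le hB0
        nlinarith [le_abs_self s.A]
      have h3 : X * (R * X ^ 2) ≤ X * (2 * B * (|s.A| + s.W)) := by nlinarith
      have h4 := le_of_mul_le_mul_left h3 (by linarith)
      have h5 : R * X ≤ 2 * B * (|s.A| + s.W) := by nlinarith [mul_nonneg hR.le (by linarith : 0 ≤ X)]
      have h6 : X ≤ 2 * B * (|s.A| + s.W) / R := by
        rw [le_div_iff₀ hR]
        linarith
      linarith
  · linarith

/-- The first-order expression `g` either has the sign that makes an endpoint optimal or changes
sign on the feasible interval, where a zero is an operating point. -/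
theorem exists_isOperatingPoint (hC : s.C ≠ 0) (hT : s.T ≠ 0) (l : ℝ) :
    ∃ X, s.IsOperatingPoint l X := by
  have hR := mul_pos (T_pos hT) (gain_pos hC)
  have hx2 := x2_pos hC
  have hd2 := passive_drift_x2_pos hC
  have hW := s.W_pos
  set g : ℝ → ℝ := fun X => 2 * (s.kappa + l) * (s.A * X + s.W) - s.T * (s.C ^ 2 / s.V) * X ^ 3
    with hg
  have hgc : Continuous g := by
    rw [hg]
    fun_prop
  have hroot : ∀ b, s.x2 ≤ b → 0 ≤ 2 * s.A * b + s.W → 0 ≤ g s.x2 → g b ≤ 0 →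
      ∃ X, s.IsOperatingPoint l X := by
    intro b hb hdb h1 h2
    obtain ⟨X, hX, hgX⟩ := intermediate_value_Icc' hb hgc.continuousOn ⟨h2, h1⟩
    simp only [hg] at hgX
    refine ⟨X, hX.1, ?_, by rw [hgX, mul_zero], by rw [hgX, mul_zero]⟩
    rcases hX.2.lt_or_eq with h | h
    · exact (passive_drift_pos_of_lt (hx2.trans_le hX.1) h hdb).le
    · rwa [h]
  rcases le_total (g s.x2) 0 with h1 | h1
  · exact ⟨s.x2, le_rfl, hd2.le, by simp, mul_nonpos_of_nonneg_of_nonpos hd2.le h1⟩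
  · rcases lt_or_ge s.A 0 with hA | hA
    · have hxe := x2_lt_xe hC hA
      have hde : 2 * s.A * s.xe + s.W = 0 := by linarith [two_A_mul_xe hA]
      rcases le_total 0 (g s.xe) with h2 | h2
      · exact ⟨s.xe, hxe.le, hde.ge, mul_nonneg (by linarith) h2, by rw [hde, zero_mul]⟩
      · exact hroot s.xe hxe.le hde.ge h1 h2
    · have hν : 0 ≤ s.kappa + l := by
        by_contra! hν
        have h2 : g s.x2 < 0 := by
          simp only [hg]
          have h3 := A_mul_add_W_pos hd2.le
          have h4 : 0 < s.T * (s.C ^ 2 / s.V) * s.x2 ^ 3 := by positivity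
          nlinarith
        linarith
      -- For `A ≥ 0` there is no upper end `xe`. This `b ≥ 1` is large enough that `2 ν (A b + W) ≤
      -- 2 ν (A + W) b² ≤ T R b³`, so `g b ≤ 0`.
      set b := s.x2 + 1 + 2 * (s.kappa + l) * (s.A + s.W) / (s.T * (s.C ^ 2 / s.V)) with hb
      have hq : 0 ≤ 2 * (s.kappa + l) * (s.A + s.W) / (s.T * (s.C ^ 2 / s.V)) := by positivity
      have hb1 : 1 ≤ b := by linarith
      refine hroot b (by linarith) (by positivity) h1 ?_
      have h3 : 2 * (s.kappa + l) * (s.A + s.W) ≤ s.T * (s.C ^ 2 / s.V) * b := by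
        have : 2 * (s.kappa + l) * (s.A + s.W) / (s.T * (s.C ^ 2 / s.V)) ≤ b := by linarith
        rw [div_le_iff₀ hR] at this
        linarith
      have h4 : s.A * b + s.W ≤ (s.A + s.W) * b ^ 2 := by
        have h41 : b ≤ b ^ 2 := by nlinarith
        have h42 := mul_le_mul_of_nonneg_left h41 hA
        have h43 := mul_le_mul_of_nonneg_left (hb1.trans h41) hW.le
        linarith
      have h5 := mul_le_mul_of_nonneg_right h3 (sq_nonneg b)
      have h6 := mul_le_mul_of_nonneg_left h4 hν
      simp only [hg]
      nlinarith

/-- The optimal activities of an observable site. -/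
def smoothActivity (s : ScalarSite) (l : ℝ) : Set ℝ :=
  {f | ∃ X, s.IsOperatingPoint l X ∧ f = s.activity X}

/-- The conditions defining an operating point are weak inequalities between continuous functions,
and `le_bound` confines the points to a compact interval when the taxes converge. A subsequence
therefore converges to an operating point of the limit tax. -/
theorem smoothActivity_closed (hC : s.C ≠ 0) (hT : s.T ≠ 0) (u w : ℕ → ℝ) (l f : ℝ)
    (hu : Tendsto u atTop (𝓝 l)) (hw : Tendsto w atTop (𝓝 f))
    (h : ∀ n, w n ∈ s.smoothActivity (u n)) : f ∈ s.smoothActivity l := by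
  choose X hX hXw using h
  have hx2 := x2_pos hC
  have hbdd : Bornology.IsBounded (range fun n => s.kappa + u n) :=
    Metric.isBounded_range_of_tendsto _ (hu.const_add s.kappa)
  obtain ⟨B, hB⟩ := isBounded_iff_forall_norm_le.1 hbdd
  obtain ⟨Z, -, φ, hφ, hZ⟩ := (isCompact_Icc (a := s.x2)).tendsto_subseq fun n =>
    ⟨(hX n).x2_le, (hX n).le_bound hC hT (hB _ ⟨n, rfl⟩)⟩
  have hu' := hu.comp hφ.tendsto_atTop
  have hd : Tendsto (fun n => 2 * s.A * X (φ n) + s.W) atTop (𝓝 (2 * s.A * Z + s.W)) :=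
    (hZ.const_mul _).add_const _
  have hg : Tendsto (fun n => 2 * (s.kappa + u (φ n)) * (s.A * X (φ n) + s.W)
      - s.T * (s.C ^ 2 / s.V) * X (φ n) ^ 3) atTop
      (𝓝 (2 * (s.kappa + l) * (s.A * Z + s.W) - s.T * (s.C ^ 2 / s.V) * Z ^ 3)) :=
    (((hu'.const_add _).const_mul 2).mul ((hZ.const_mul _).add_const _)).sub ((hZ.pow 3).const_mul _)
  have hZ2 : s.x2 ≤ Z := ge_of_tendsto' hZ fun n => (hX _).x2_le
  refine ⟨Z, ⟨hZ2, ge_of_tendsto' hd fun n => (hX _).drift_nonneg,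
    ge_of_tendsto' ((hZ.sub_const _).mul hg) fun n => (hX _).lower,
    le_of_tendsto' (hd.mul hg) fun n => (hX _).upper⟩, ?_⟩
  refine tendsto_nhds_unique (hw.comp hφ.tendsto_atTop) ?_
  have h1 : Tendsto (fun n => s.activity (X (φ n))) atTop (𝓝 (s.activity Z)) :=
    hd.div ((hZ.pow 2).const_mul _) (mul_pos (gain_pos hC) (pow_pos (hx2.trans_le hZ2) 2)).ne'
  exact h1.congr fun n => (hXw _).symm

theorem smoothActivity_eq_one (hC : s.C ≠ 0) (hT : s.T ≠ 0) (hl : l ≤ -s.kappa) {f : ℝ}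
    (hf : f ∈ s.smoothActivity l) : f = 1 := by
  obtain ⟨X, hX, rfl⟩ := hf
  rcases hX.x2_le.lt_or_eq with h | h
  · have hR := mul_pos (T_pos hT) (gain_pos hC)
    have hg := nonneg_of_mul_nonneg_right hX.lower (by linarith)
    have hq := A_mul_add_W_pos hX.drift_nonneg
    have hX0 : 0 < X := (x2_pos hC).trans h
    have h1 : 0 < s.T * (s.C ^ 2 / s.V) * X ^ 3 := by positivity
    nlinarith
  · rw [← h, activity_x2 hC]

/-- An activity above `ε` bounds the operating point by `b`, since `activity X ≤ (2 |A| + W) / (R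
X)` for `X ≥ 1`. The passive drift is then positive, so `upper` together with `A X + W ≥ W / 2`
bounds the tax. -/
theorem smoothActivity_le_eps (hC : s.C ≠ 0) {ε : ℝ} (hε : 0 < ε) :
    ∃ L, ∀ l ≥ L, ∀ f ∈ s.smoothActivity l, f ≤ ε := by
  have hR := gain_pos hC
  have hx2 := x2_pos hC
  have hW := s.W_pos
  set R := s.C ^ 2 / s.V with hRdef
  set b := 1 + (2 * |s.A| + s.W) / (R * ε) with hb
  have hb0 : 0 ≤ (2 * |s.A| + s.W) / (R * ε) := by positivity
  refine ⟨s.T * R * b ^ 3 / s.W + 1 - s.kappa, fun l hl f hf => ?_⟩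
  obtain ⟨X, hX, rfl⟩ := hf
  by_contra! hlt
  have hX0 : 0 < X := hx2.trans_le hX.x2_le
  have hd := hX.drift_nonneg
  have hupp := hX.upper
  rw [activity, ← hRdef, lt_div_iff₀ (by positivity)] at hlt
  have hdpos : 0 < 2 * s.A * X + s.W := lt_of_le_of_lt (by positivity) hlt
  have hg := nonpos_of_mul_nonpos_right hupp hdpos
  rw [← hRdef] at hg
  have hXb : X ≤ b := by
    rcases le_total X 1 with h1 | h1
    · linarith
    · have h2 : X * (ε * R * X) < X * (2 * |s.A| + s.W) := by nlinarith [le_abs_self s.A]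
      have h3 := lt_of_mul_lt_mul_left h2 hX0.le
      have h4 : X ≤ (2 * |s.A| + s.W) / (R * ε) := by
        rw [le_div_iff₀ (by positivity)]
        linarith
      linarith
  have h5 : s.T * R * X ^ 3 ≤ s.T * R * b ^ 3 :=
    mul_le_mul_of_nonneg_left (pow_le_pow_left₀ hX0.le hXb 3) (mul_nonneg s.T_nonneg hR.le)
  have h6 : s.T * R * b ^ 3 / s.W < s.kappa + l := by linarith
  have h0 : 0 ≤ s.T * R * b ^ 3 / s.W :=
    div_nonneg (mul_nonneg (mul_nonneg s.T_nonneg hR.le) (by positivity)) hW.le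
  rw [div_lt_iff₀ hW] at h6
  have h7 : s.W ≤ 2 * (s.A * X + s.W) := by linarith
  nlinarith

/-- Operating points are unique, so each activity set is a singleton; convexity is then immediate,
and `v` may be computed from any operating point. -/
theorem exists_isDual_of_observable (hC : s.C ≠ 0) (hT : s.T ≠ 0) :
    ∃ v, (∀ l X, s.IsOperatingPoint l X → v l = s.T * X + (s.kappa + l) * s.activity X) ∧
      s.IsDual v s.smoothActivity := by
  choose P hP using exists_isOperatingPoint hC hT
  refine ⟨fun l => s.T * P l + (s.kappa + l) * s.activity (P l),
    fun l X hX => by rw [hX.unique hC hT (hP l)], ?_⟩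
  refine ⟨fun a S h l => h.operating_bound hC (hP l), ?_, fun l => ⟨_, P l, hP l, rfl⟩, ?_, ?_,
    smoothActivity_closed hC hT, ⟨-s.kappa, fun l hl f hf => smoothActivity_eq_one hC hT hl hf⟩,
    fun ε hε => smoothActivity_le_eps hC hε⟩
  · rintro l f ⟨X, hX, rfl⟩
    obtain ⟨a, S, h, hS⟩ := exists_trajectory_tendsto hC hX.x2_le hX.drift_nonneg
    refine ⟨a, S, h, h.tendsto_average_policy hC ((x2_pos hC).trans_le hX.x2_le) hS, ?_⟩
    have := h.tendsto_average_variance hS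
    rwa [← hX.unique hC hT (hP l), add_sub_cancel_right]
  · intro l x hx y hy p q hp hq hpq
    obtain ⟨X, hX, rfl⟩ := hx
    obtain ⟨Y, hY, rfl⟩ := hy
    rw [hX.unique hC hT hY, ← add_smul, hpq, one_smul]
    exact ⟨Y, hY, rfl⟩
  · rintro l f ⟨X, hX, rfl⟩
    exact ⟨activity_nonneg hX.drift_nonneg, activity_le_one hC hX.x2_le⟩

end ScalarSite

/-! ### Long-run averages and the optimal cost of one site -/

theorem longRunAverage_eq_of_tendsto {g : ℝ → ℝ} {L : ℝ}
    (h : Tendsto (fun τ : ℝ => (∫ t in (0 : ℝ)..τ, g t) / τ) atTop (𝓝 L)) :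
    longRunAverage g = (L : EReal) :=
  ((continuous_coe_real_ereal.tendsto L).comp h).limsup_eq

theorem le_longRunAverage {g : ℝ → ℝ} {v K : ℝ}
    (h : ∀ τ, 0 ≤ τ → v * τ - K ≤ ∫ t in (0 : ℝ)..τ, g t) : (v : EReal) ≤ longRunAverage g := by
  have h1 : Tendsto (fun τ : ℝ => v - K / τ) atTop (𝓝 v) := by
    simpa using (tendsto_id.const_div_atTop K).const_sub v
  rw [← ((continuous_coe_real_ereal.tendsto v).comp h1).limsup_eq]
  refine limsup_le_limsup ?_
  filter_upwards [eventually_gt_atTop 0] with τ hτ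
  refine EReal.coe_le_coe_iff.2 ?_
  rw [le_div_iff₀ hτ, sub_mul, div_mul_cancel₀ _ hτ.ne']
  exact h τ hτ.le

theorem longRunAverage_eq_top {g : ℝ → ℝ} {p q : ℝ} (hp : 0 < p)
    (h : ∀ τ, 0 ≤ τ → p * τ ^ 2 - q * τ ≤ ∫ t in (0 : ℝ)..τ, g t) : longRunAverage g = ⊤ := by
  refine Tendsto.limsup_eq (EReal.tendsto_coe_nhds_top_iff.2 ?_)
  refine tendsto_atTop_mono' atTop ?_
    (tendsto_atTop_add_const_right _ (-q) (tendsto_id.const_mul_atTop hp))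
  filter_upwards [eventually_gt_atTop 0] with τ hτ
  rw [le_div_iff₀ hτ]
  have := h τ hτ.le
  simp only [id]
  linarith

namespace ScalarSite

variable {s : ScalarSite} {a S : ℝ → ℝ} {v : ℝ → ℝ} {D : ℝ → Set ℝ}

theorem IsTrajectory.intervalIntegrable_cost (h : s.IsTrajectory a S) (c : ℝ) {τ : ℝ}
    (hτ : 0 ≤ τ) : IntervalIntegrable (fun t => s.T * S t + c * a t) volume 0 τ :=
  ((h.intervalIntegrable le_rfl hτ).const_mul _).add ((h.intervalIntegrable_policy 0 τ).const_mul _)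

theorem IsTrajectory.integral_cost (h : s.IsTrajectory a S) (c : ℝ) {τ : ℝ} (hτ : 0 ≤ τ) :
    ∫ t in (0 : ℝ)..τ, (s.T * S t + c * a t)
      = (∫ t in (0 : ℝ)..τ, s.T * S t) + c * ∫ t in (0 : ℝ)..τ, a t := by
  rw [intervalIntegral.integral_add ((h.intervalIntegrable le_rfl hτ).const_mul _)
    ((h.intervalIntegrable_policy 0 τ).const_mul _), intervalIntegral.integral_const_mul c]

theorem IsTrajectory.neg_abs_mul_le_cost (h : s.IsTrajectory a S) (c : ℝ) {τ : ℝ} (hτ : 0 ≤ τ) :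
    -|c| * τ ≤ ∫ t in (0 : ℝ)..τ, (s.T * S t + c * a t) := by
  rw [h.integral_cost c hτ]
  have h0 : 0 ≤ ∫ t in (0 : ℝ)..τ, s.T * S t :=
    intervalIntegral.integral_nonneg hτ fun t ht => mul_nonneg s.T_nonneg (h.pos ht.1).le
  have h1 := h.integral_policy_nonneg hτ
  have h2 := h.integral_policy_le hτ
  nlinarith [neg_abs_le c, abs_nonneg c]

/-- The variance of an undetectable site grows at least linearly. -/
theorem IsTrajectory.quadratic_le_cost (h : s.IsTrajectory a S) (hC : s.C = 0) (hA : 0 ≤ s.A)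
    (c : ℝ) {τ : ℝ} (hτ : 0 ≤ τ) :
    s.T * s.W / 2 * τ ^ 2 - |c| * τ ≤ ∫ t in (0 : ℝ)..τ, (s.T * S t + c * a t) := by
  rw [h.integral_cost c hτ]
  have hS : ∀ t, 0 ≤ t → s.W * t ≤ S t := by
    intro t ht
    have h1 : ∫ _ in (0 : ℝ)..t, s.W ≤
        ∫ u in (0 : ℝ)..t, (2 * s.A * S u + s.W - a u * (s.C ^ 2 / s.V) * S u ^ 2) := by
      refine intervalIntegral.integral_mono_on ht intervalIntegrable_const
        (h.intervalIntegrable_rhs le_rfl ht) fun u hu => ?_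
      have := mul_nonneg hA (h.pos hu.1).le
      simp only [hC]
      norm_num
      linarith
    rw [intervalIntegral.integral_const, smul_eq_mul, sub_zero] at h1
    rw [h.riccati t ht]
    linarith [s.S0_pos]
  have h0 : ∫ t in (0 : ℝ)..τ, s.T * (s.W * t) ≤ ∫ t in (0 : ℝ)..τ, s.T * S t :=
    intervalIntegral.integral_mono_on hτ (Continuous.intervalIntegrable (by fun_prop) _ _)
      ((h.intervalIntegrable le_rfl hτ).const_mul _)
      fun t ht => mul_le_mul_of_nonneg_left (hS t ht.1) s.T_nonneg
  rw [intervalIntegral.integral_const_mul, intervalIntegral.integral_const_mul, integral_id] at h0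
  have h1 := h.integral_policy_nonneg hτ
  have h2 := h.integral_policy_le hτ
  nlinarith [neg_abs_le c, abs_nonneg c]

theorem taxedCosts_nonempty (s : ScalarSite) (l : ℝ) : (s.taxedCosts l).Nonempty :=
  ⟨_, _, _, s.exists_trajectory_passive, rfl⟩

theorem eq_top_of_mem_taxedCosts (hT : s.T ≠ 0) (hC : s.C = 0) (hA : 0 ≤ s.A) {l : ℝ} {w : EReal}
    (hw : w ∈ s.taxedCosts l) : w = ⊤ := by
  obtain ⟨a, S, h, rfl⟩ := hw
  exact longRunAverage_eq_top (half_pos (mul_pos (T_pos hT) s.W_pos))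
    fun τ hτ => h.quadratic_le_cost hC hA _ hτ

theorem value_eq_top (hT : s.T ≠ 0) (hC : s.C = 0) (hA : 0 ≤ s.A) (l : ℝ) : s.value l = ⊤ :=
  sInf_eq_top.2 fun _ hw => eq_top_of_mem_taxedCosts hT hC hA hw

theorem neg_abs_le_value (s : ScalarSite) (l : ℝ) : ((-|s.kappa + l| : ℝ) : EReal) ≤ s.value l := by
  refine le_sInf ?_
  rintro w ⟨a, S, h, rfl⟩
  refine le_longRunAverage (K := 0) fun τ hτ => ?_
  rw [sub_zero]
  exact h.neg_abs_mul_le_cost _ hτ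

theorem tendsto_average_cost (h : s.IsTrajectory a S) (c : ℝ) {f w : ℝ}
    (ha : Tendsto (fun τ : ℝ => (∫ t in (0 : ℝ)..τ, a t) / τ) atTop (𝓝 f))
    (hS : Tendsto (fun τ : ℝ => (∫ t in (0 : ℝ)..τ, s.T * S t) / τ) atTop (𝓝 w)) :
    Tendsto (fun τ : ℝ => (∫ t in (0 : ℝ)..τ, (s.T * S t + c * a t)) / τ) atTop
      (𝓝 (w + c * f)) := by
  refine (hS.add (ha.const_mul c)).congr' ?_
  filter_upwards [eventually_ge_atTop 0] with τ hτ
  rw [h.integral_cost c hτ]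
  ring

theorem IsDual.isLeast (hD : s.IsDual v D) (l : ℝ) : IsLeast (s.taxedCosts l) (v l : EReal) := by
  constructor
  · obtain ⟨f, hf⟩ := hD.nonempty l
    obtain ⟨a, S, h, h1, h2⟩ := hD.attained l f hf
    refine ⟨a, S, h, ?_⟩
    have h3 := tendsto_average_cost h (s.kappa + l) h1 h2
    rw [sub_add_cancel] at h3
    exact (longRunAverage_eq_of_tendsto h3).symm
  · rintro w ⟨a, S, h, rfl⟩
    obtain ⟨K, hK⟩ := hD.lower a S h l
    exact le_longRunAverage hK

theorem IsDual.value_eq (hD : s.IsDual v D) (l : ℝ) : s.value l = (v l : EReal) :=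
  (hD.isLeast l).csInf_eq

/-- Optimal activities are supergradients of the optimal cost. -/
theorem IsDual.le_add_mul (hD : s.IsDual v D) {l f : ℝ} (hf : f ∈ D l) (l' : ℝ) :
    v l' ≤ v l + f * (l' - l) := by
  obtain ⟨a, S, h, h1, h2⟩ := hD.attained l f hf
  obtain ⟨K, hK⟩ := hD.lower a S h l'
  -- The policy that is optimal under `l` is admissible under `l'`, where its cost is `v l + (l' -
  -- l) f`.
  have h3 := le_longRunAverage hK
  rw [longRunAverage_eq_of_tendsto (tendsto_average_cost h (s.kappa + l') h1 h2),
    EReal.coe_le_coe_iff] at h3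
  linarith

theorem exists_isDual (h : s.T ≠ 0 → s.C = 0 → s.A < 0) : ∃ v D, s.IsDual v D := by
  by_cases hT : s.T = 0
  · exact ⟨_, _, isDual_of_T_eq_zero hT⟩
  · by_cases hC : s.C = 0
    · exact ⟨_, _, isDual_of_unobservable hC (h hT hC)⟩
    · obtain ⟨v, -, hv⟩ := exists_isDual_of_observable hC hT
      exact ⟨v, _, hv⟩

theorem isLeast_value (s : ScalarSite) (l : ℝ) : IsLeast (s.taxedCosts l) (s.value l) := by
  by_cases h : s.T ≠ 0 → s.C = 0 → s.A < 0
  · obtain ⟨v, D, hD⟩ := exists_isDual h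
    rw [hD.value_eq l]
    exact hD.isLeast l
  · push Not at h
    obtain ⟨hT, hC, hA⟩ := h
    obtain ⟨w, hw⟩ := s.taxedCosts_nonempty l
    have := eq_top_of_mem_taxedCosts hT hC hA hw
    rw [value_eq_top hT hC hA, ← this]
    exact ⟨hw, fun w' hw' => (eq_top_of_mem_taxedCosts hT hC hA hw') ▸ le_top⟩

end ScalarSite

/-! ### Lagrangian duality for the relaxed problem -/

/-- An intermediate value theorem for sums of set-valued functions with closed graphs. -/
theorem exists_sum_eq_of_closed_graph {ι : Type*} [Fintype ι] [Nonempty ι] {D : ι → ℝ → Set ℝ}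
    (hne : ∀ i l, (D i l).Nonempty) (hconv : ∀ i l, Convex ℝ (D i l))
    (hsub : ∀ i l, D i l ⊆ Icc 0 1)
    (hcl : ∀ i (u w : ℕ → ℝ) (l f : ℝ), Tendsto u atTop (𝓝 l) → Tendsto w atTop (𝓝 f) →
      (∀ n, w n ∈ D i (u n)) → f ∈ D i l)
    (hone : ∀ i, ∃ L, ∀ l ≤ L, ∀ f ∈ D i l, f = 1)
    (heps : ∀ i, ∀ ε > 0, ∃ L, ∀ l ≥ L, ∀ f ∈ D i l, f ≤ ε)
    {m : ℝ} (hm : 0 < m) (hmN : m ≤ Fintype.card ι) :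
    ∃ (l : ℝ) (f : ι → ℝ), (∀ i, f i ∈ D i l) ∧ ∑ i, f i = m := by
  choose F hF using hne
  -- The tax sought is `sSup A`. Selections along `A` accumulate there at values with sum at least
  -- `m`, selections from the right at values with sum at most `m`. Both limits belong to the sets
  -- `D i (sSup A)` by closedness, and convexity allows interpolation to the sum `m`.
  set A : Set ℝ := {l | m ≤ ∑ i, F i l} with hA
  have hlim : ∀ (u : ℕ → ℝ) (l : ℝ), Tendsto u atTop (𝓝 l) → ∃ (g : ι → ℝ) (φ : ℕ → ℕ),
      (∀ i, g i ∈ D i l) ∧ Tendsto (fun n => ∑ i, F i (u (φ n))) atTop (𝓝 (∑ i, g i)) := by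
    intro u l hu
    obtain ⟨g, -, φ, hφ, hg⟩ := (isCompact_univ_pi fun _ : ι => isCompact_Icc (a := (0 : ℝ))
      (b := 1)).tendsto_subseq (x := fun n i => F i (u n)) fun n i _ => hsub i _ (hF i _)
    rw [tendsto_pi_nhds] at hg
    exact ⟨g, φ, fun i => hcl i _ _ l _ (hu.comp hφ.tendsto_atTop) (hg i) fun n => hF i _,
      tendsto_finsetSum _ fun i _ => hg i⟩
  have hAne : A.Nonempty := by
    choose L hL using hone
    refine ⟨Finset.univ.inf' Finset.univ_nonempty L, ?_⟩
    have : ∀ i, F i (Finset.univ.inf' Finset.univ_nonempty L) = 1 := fun i =>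
      hL i _ (Finset.inf'_le _ (Finset.mem_univ i)) _ (hF i _)
    simpa [hA, this] using hmN
  have hAbdd : BddAbove A := by
    have hN : (0 : ℝ) < Fintype.card ι := by exact_mod_cast Fintype.card_pos
    choose L hL using fun i => heps i (m / (2 * Fintype.card ι)) (by positivity)
    refine ⟨Finset.univ.sup' Finset.univ_nonempty L, fun l hl => ?_⟩
    by_contra! hlt
    have h1 : ∀ i, F i l ≤ m / (2 * Fintype.card ι) := fun i =>
      hL i _ ((Finset.le_sup' L (Finset.mem_univ i)).trans hlt.le) _ (hF i _)
    have h2 : ∑ i, F i l ≤ Fintype.card ι * (m / (2 * Fintype.card ι)) := by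
      have := Finset.sum_le_sum fun i (_ : i ∈ Finset.univ) => h1 i
      simpa using this
    have h3 : Fintype.card ι * (m / (2 * Fintype.card ι)) = m / 2 := by field_simp
    have h4 : m ≤ ∑ i, F i l := hl
    linarith
  obtain ⟨u, -, hu, huA⟩ := exists_seq_tendsto_sSup hAne hAbdd
  obtain ⟨g, φ, hg, hgs⟩ := hlim u _ hu
  have hgm : m ≤ ∑ i, g i := ge_of_tendsto' hgs fun n => huA _
  have hw : Tendsto (fun n : ℕ => sSup A + 1 / ((n : ℝ) + 1)) atTop (𝓝 (sSup A)) := by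
    simpa using (tendsto_one_div_add_atTop_nhds_zero_nat (𝕜 := ℝ)).const_add (sSup A)
  obtain ⟨g', φ', hg', hgs'⟩ := hlim _ _ hw
  have hgm' : ∑ i, g' i ≤ m := by
    refine le_of_tendsto' hgs' fun n => ?_
    by_contra! hlt
    have h1 := le_csSup hAbdd (show _ ∈ A from hlt.le)
    have h2 : (0 : ℝ) < 1 / ((φ' n : ℝ) + 1) := by positivity
    linarith
  have hc : ContinuousOn (fun θ : ℝ => ∑ i, ((1 - θ) * g' i + θ * g i)) (Icc 0 1) := by fun_prop
  obtain ⟨θ, hθ, hθm⟩ := intermediate_value_Icc zero_le_one hc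
    (show m ∈ Icc _ _ by simpa using And.intro hgm' hgm)
  exact ⟨sSup A, _, fun i => hconv i _ (hg' i) (hg i) (by linarith [hθ.2]) hθ.1 (by ring), hθm⟩

section Scheduling

theorem EReal.coe_sum_real {ι : Type*} (t : Finset ι) (f : ι → ℝ) :
    ((∑ i ∈ t, f i : ℝ) : EReal) = ∑ i ∈ t, (f i : EReal) := by
  classical
  induction t using Finset.induction_on with
  | empty => simp
  | insert i t hi ih => rw [Finset.sum_insert hi, Finset.sum_insert hi, EReal.coe_add, ih]

variable {N M : ℕ} {sites : Fin N → ScalarSite} {a S : Fin N → ℝ → ℝ}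

theorem IsJointTrajectory.integral_cost (h : IsJointTrajectory sites a S) (c : Fin N → ℝ) {τ : ℝ}
    (hτ : 0 ≤ τ) : ∫ t in (0 : ℝ)..τ, ∑ i, ((sites i).T * S i t + c i * a i t)
      = ∑ i, ∫ t in (0 : ℝ)..τ, ((sites i).T * S i t + c i * a i t) :=
  intervalIntegral.integral_finsetSum fun i _ => (h i).intervalIntegrable_cost (c i) hτ

theorem IsJointTrajectory.integral_policy (h : IsJointTrajectory sites a S) (τ : ℝ) :
    ∫ t in (0 : ℝ)..τ, ∑ i, a i t = ∑ i, ∫ t in (0 : ℝ)..τ, a i t :=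
  intervalIntegral.integral_finsetSum fun i _ => (h i).intervalIntegrable_policy 0 τ

theorem exists_jointTrajectory (sites : Fin N → ScalarSite) :
    ∃ a S, IsJointTrajectory sites a S :=
  ⟨_, _, fun i => (sites i).exists_trajectory_passive⟩

/-- If some site is undetectable, every joint policy has infinite cost. -/
theorem IsJointTrajectory.longRunAverage_eq_top (h : IsJointTrajectory sites a S) {j : Fin N}
    (hT : (sites j).T ≠ 0) (hC : (sites j).C = 0) (hA : 0 ≤ (sites j).A) (c : Fin N → ℝ) :
    longRunAverage (fun t => ∑ i, ((sites i).T * S i t + c i * a i t)) = ⊤ := by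
  refine _root_.longRunAverage_eq_top (p := (sites j).T * (sites j).W / 2) (q := ∑ i, |c i|)
    (half_pos (mul_pos (ScalarSite.T_pos hT) (sites j).W_pos)) fun τ hτ => ?_
  rw [h.integral_cost c hτ, ← Finset.add_sum_erase _ _ (Finset.mem_univ j),
    ← Finset.add_sum_erase _ _ (Finset.mem_univ j)]
  have h1 := (h j).quadratic_le_cost hC hA (c j) hτ
  have h2 : ∑ i ∈ Finset.univ.erase j, -|c i| * τ ≤
      ∑ i ∈ Finset.univ.erase j, ∫ t in (0 : ℝ)..τ, ((sites i).T * S i t + c i * a i t) :=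
    Finset.sum_le_sum fun i _ => (h i).neg_abs_mul_le_cost (c i) hτ
  rw [← Finset.sum_mul, Finset.sum_neg_distrib] at h2
  linarith

theorem sum_value_eq_top {j : Fin N} (hT : (sites j).T ≠ 0) (hC : (sites j).C = 0)
    (hA : 0 ≤ (sites j).A) (l : ℝ) : ∑ i, (sites i).value l = ⊤ := by
  rw [← Finset.add_sum_erase _ _ (Finset.mem_univ j), ScalarSite.value_eq_top hT hC hA]
  -- In `EReal` one has `⊤ + ⊥ = ⊥`, so the remaining values must be bounded below.
  refine EReal.top_add_of_ne_bot (ne_of_gt ?_)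
  have : ((∑ i ∈ Finset.univ.erase j, -|(sites i).kappa + l| : ℝ) : EReal) ≤
      ∑ i ∈ Finset.univ.erase j, (sites i).value l := by
    rw [EReal.coe_sum_real]
    exact Finset.sum_le_sum fun i _ => (sites i).neg_abs_le_value l
  exact (EReal.bot_lt_coe _).trans_le this

theorem lagrangianValues_eq_top {j : Fin N} (hT : (sites j).T ≠ 0) (hC : (sites j).C = 0) (hA : 0 ≤ (sites j).A)
    {l : ℝ} {w : EReal} (hw : w ∈ lagrangianValues sites M l) :
    w = ⊤ := by
  obtain ⟨a, S, h, rfl⟩ := hw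
  rw [lagrangian, h.longRunAverage_eq_top hT hC hA fun i => (sites i).kappa + l]
  exact EReal.top_sub_coe _

theorem dualFunction_eq_top {j : Fin N} (hT : (sites j).T ≠ 0) (hC : (sites j).C = 0) (hA : 0 ≤ (sites j).A)
    (l : ℝ) : dualFunction sites M l = ⊤ :=
  sInf_eq_top.2 fun _ hw => lagrangianValues_eq_top hT hC hA hw

theorem isLeast_dualFunction_of_undetectable {j : Fin N} (hT : (sites j).T ≠ 0)
    (hC : (sites j).C = 0) (hA : 0 ≤ (sites j).A) (l : ℝ) :
    IsLeast (lagrangianValues sites M l) (dualFunction sites M l) := by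
  rw [dualFunction_eq_top hT hC hA]
  obtain ⟨a, S, h⟩ := exists_jointTrajectory sites
  have hw : lagrangian sites M l a S ∈ lagrangianValues sites M l := ⟨a, S, h, rfl⟩
  refine ⟨?_, fun w hw' => (lagrangianValues_eq_top hT hC hA hw').ge⟩
  rwa [← lagrangianValues_eq_top hT hC hA hw]

theorem relaxedPerformance_eq_top {j : Fin N} (hT : (sites j).T ≠ 0) (hC : (sites j).C = 0)
    (hA : 0 ≤ (sites j).A) : relaxedPerformance sites M = ⊤ := by
  refine sInf_eq_top.2 ?_
  rintro w ⟨a, S, h, -, rfl⟩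
  exact h.longRunAverage_eq_top hT hC hA fun i => (sites i).kappa

section Detectable

variable {v : Fin N → ℝ → ℝ} {D : Fin N → ℝ → Set ℝ}

theorem IsJointTrajectory.lower (h : IsJointTrajectory sites a S)
    (hD : ∀ i, (sites i).IsDual (v i) (D i)) (l : ℝ) : ∃ K, ∀ τ, 0 ≤ τ →
      (∑ i, v i l) * τ - K ≤
        ∫ t in (0 : ℝ)..τ, ∑ i, ((sites i).T * S i t + ((sites i).kappa + l) * a i t) := by
  choose K hK using fun i => (hD i).lower _ _ (h i) l
  refine ⟨∑ i, K i, fun τ hτ => ?_⟩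
  rw [h.integral_cost _ hτ, Finset.sum_mul, ← Finset.sum_sub_distrib]
  exact Finset.sum_le_sum fun i _ => hK i τ hτ

/-- The policies provided by `attained` have genuine limits and not only upper limits, so their
averages add up over the sites and can be priced at any other tax `d`. -/
theorem exists_jointTrajectory_of_mem (hD : ∀ i, (sites i).IsDual (v i) (D i)) {l : ℝ}
    {f : Fin N → ℝ} (hf : ∀ i, f i ∈ D i l) : ∃ a S, IsJointTrajectory sites a S ∧
      longRunAverage (fun t => ∑ i, a i t) = ((∑ i, f i : ℝ) : EReal) ∧
      ∀ d : ℝ, longRunAverage (fun t => ∑ i, ((sites i).T * S i t + ((sites i).kappa + d) * a i t))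
        = ((∑ i, (v i l + (d - l) * f i) : ℝ) : EReal) := by
  choose a S h h1 h2 using fun i => (hD i).attained l (f i) (hf i)
  have hj : IsJointTrajectory sites a S := h
  refine ⟨a, S, h, longRunAverage_eq_of_tendsto ?_, fun d => longRunAverage_eq_of_tendsto ?_⟩
  · simp only [hj.integral_policy, Finset.sum_div]
    exact tendsto_finsetSum _ fun i _ => h1 i
  · have h3 : Tendsto (fun τ : ℝ => ∑ i, (∫ t in (0 : ℝ)..τ,
        ((sites i).T * S i t + ((sites i).kappa + d) * a i t)) / τ) atTop
        (𝓝 (∑ i, (v i l + (d - l) * f i))) := by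
      refine tendsto_finsetSum _ fun i _ => ?_
      convert! ScalarSite.tendsto_average_cost (h i) ((sites i).kappa + d) (h1 i) (h2 i) using 2
      ring
    refine h3.congr' ?_
    filter_upwards [eventually_ge_atTop 0] with τ hτ
    rw [hj.integral_cost _ hτ, Finset.sum_div]

theorem isLeast_lagrangianValues (hD : ∀ i, (sites i).IsDual (v i) (D i)) (l : ℝ) :
    IsLeast (lagrangianValues sites M l) ((∑ i, v i l - l * M : ℝ) : EReal) := by
  constructor
  · choose f hf using fun i => (hD i).nonempty l
    obtain ⟨a, S, h, -, h2⟩ := exists_jointTrajectory_of_mem hD hf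
    refine ⟨a, S, h, ?_⟩
    rw [lagrangian, h2 l]
    simp [EReal.coe_sub]
  · rintro w ⟨a, S, h, rfl⟩
    obtain ⟨K, hK⟩ := h.lower hD l
    rw [lagrangian, EReal.coe_sub]
    exact EReal.sub_le_sub (le_longRunAverage hK) le_rfl

theorem dualFunction_eq (hD : ∀ i, (sites i).IsDual (v i) (D i)) (l : ℝ) :
    dualFunction sites M l = ((∑ i, v i l - l * M : ℝ) : EReal) :=
  (isLeast_lagrangianValues hD l).csInf_eq

theorem convex_hypograph_dualFunction (hD : ∀ i, (sites i).IsDual (v i) (D i)) :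
    Convex ℝ {q : ℝ × ℝ | (q.2 : EReal) ≤ dualFunction sites M q.1} := by
  intro x hx y hy p q hp hq hpq
  simp only [mem_ofPred_eq, dualFunction_eq hD, EReal.coe_le_coe_iff, Prod.fst_add, Prod.smul_fst,
    Prod.snd_add, Prod.smul_snd, smul_eq_mul] at hx hy ⊢
  set z := p * x.1 + q * y.1 with hz
  have key : p * ∑ i, v i x.1 + q * ∑ i, v i y.1 ≤ ∑ i, v i z := by
    rw [Finset.mul_sum, Finset.mul_sum, ← Finset.sum_add_distrib]
    refine Finset.sum_le_sum fun i _ => ?_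
    -- An optimal activity at the intermediate tax is a supergradient there; its slope cancels in
    -- the convex combination.
    obtain ⟨f, hf⟩ := (hD i).nonempty z
    have h1 := mul_le_mul_of_nonneg_left ((hD i).le_add_mul hf x.1) hp
    have h2 := mul_le_mul_of_nonneg_left ((hD i).le_add_mul hf y.1) hq
    have e : p * (v i z + f * (x.1 - z)) + q * (v i z + f * (y.1 - z)) = v i z := by
      have : q = 1 - p := by linarith
      rw [hz, this]
      ring
    linarith
  have h1 := mul_le_mul_of_nonneg_left hx hp
  have h2 := mul_le_mul_of_nonneg_left hy hq
  rw [hz]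
  nlinarith

/-- Weak duality. -/
theorem dualFunction_le_relaxedPerformance (hD : ∀ i, (sites i).IsDual (v i) (D i)) (l : ℝ) :
    dualFunction sites M l ≤ relaxedPerformance sites M := by
  refine le_sInf ?_
  rintro w ⟨a, S, h, hM, rfl⟩
  rw [dualFunction_eq hD]
  -- Upper limits are not additive, so the argument is made for large finite `τ`. If the performance
  -- is below `c` and `c` below the dual value, then eventually `l` times the average activity
  -- exceeds `l M + δ`. For `l > 0` or `l < 0` this keeps the average activity away from `M` on one
  -- side, against the constraint; for `l = 0` it is absurd.
  by_contra! hlt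
  obtain ⟨c, hc1, hc2⟩ := EReal.lt_iff_exists_real_btwn.1 hlt
  rw [EReal.coe_lt_coe_iff] at hc2
  obtain ⟨K, hK⟩ := h.lower hD l
  set δ := (∑ i, v i l - l * M - c) / 2 with hδ
  have hδ0 : 0 < δ := by linarith
  have hev1 := eventually_lt_of_limsup_lt hc1
  have hev2 : ∀ᶠ τ : ℝ in atTop, K / τ < δ :=
    (tendsto_id.const_div_atTop K).eventually (gt_mem_nhds hδ0)
  have key : ∀ᶠ τ : ℝ in atTop, l * M + δ < l * ((∫ t in (0 : ℝ)..τ, ∑ i, a i t) / τ) := by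
    filter_upwards [hev1, hev2, eventually_gt_atTop 0] with τ h1 h2 hτ
    rw [EReal.coe_lt_coe_iff] at h1
    have h3 := hK τ hτ.le
    have e : ∫ t in (0 : ℝ)..τ, ∑ i, ((sites i).T * S i t + ((sites i).kappa + l) * a i t)
        = (∫ t in (0 : ℝ)..τ, ∑ i, ((sites i).T * S i t + (sites i).kappa * a i t))
          + l * ∫ t in (0 : ℝ)..τ, ∑ i, a i t := by
      rw [h.integral_cost _ hτ.le, h.integral_cost _ hτ.le, h.integral_policy, Finset.mul_sum,
        ← Finset.sum_add_distrib]
      refine Finset.sum_congr rfl fun i _ => ?_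
      rw [(h i).integral_cost _ hτ.le, (h i).integral_cost _ hτ.le]
      ring
    rw [e] at h3
    have h4 := div_le_div_of_nonneg_right h3 hτ.le
    rw [sub_div, mul_div_cancel_right₀ _ hτ.ne', add_div, mul_div_assoc] at h4
    linarith
  rcases lt_trichotomy l 0 with hl | hl | hl
  · have h1 : longRunAverage (fun t => ∑ i, a i t) ≤ ((M + δ / l : ℝ) : EReal) := by
      refine limsup_le_of_le (by isBoundedDefault) ?_
      filter_upwards [key] with τ hτ
      rw [EReal.coe_le_coe_iff, ← sub_le_iff_le_add', le_div_iff_of_neg hl]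
      linarith
    rw [hM, EReal.coe_le_coe_iff] at h1
    have := div_neg_of_pos_of_neg hδ0 hl
    linarith
  · obtain ⟨τ, hτ⟩ := key.exists
    simp only [hl, zero_mul] at hτ
    linarith
  · have h1 : ((M + δ / l : ℝ) : EReal) ≤ longRunAverage (fun t => ∑ i, a i t) := by
      refine le_limsup_of_frequently_le (Eventually.frequently ?_) (by isBoundedDefault)
      filter_upwards [key] with τ hτ
      rw [EReal.coe_le_coe_iff, ← le_sub_iff_add_le', div_le_iff₀ hl]
      linarith
    rw [hM, EReal.coe_le_coe_iff] at h1
    have := div_pos hδ0 hl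
    linarith

/-- Strong duality. -/
theorem exists_dualFunction_eq_relaxedPerformance (hD : ∀ i, (sites i).IsDual (v i) (D i))
    (hM : 0 < M) (hMN : M < N) : ∃ l₀, dualFunction sites M l₀ = relaxedPerformance sites M := by
  have : Nonempty (Fin N) := ⟨⟨0, hM.trans hMN⟩⟩
  obtain ⟨l, f, hf, hfM⟩ := exists_sum_eq_of_closed_graph (m := M) (fun i => (hD i).nonempty)
    (fun i => (hD i).convex) (fun i => (hD i).subset) (fun i => (hD i).closed)
    (fun i => (hD i).eq_one) (fun i => (hD i).le_eps) (by exact_mod_cast hM)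
    (by simpa using hMN.le)
  refine ⟨l, le_antisymm (dualFunction_le_relaxedPerformance hD l) ?_⟩
  obtain ⟨a, S, h, h1, h2⟩ := exists_jointTrajectory_of_mem hD hf
  refine sInf_le ⟨a, S, h, by rw [h1, hfM], ?_⟩
  -- At `d = 0` the policies that are optimal under `l` are charged without the tax, which costs `∑
  -- i, (v i l - l * f i)`. As the activities sum to `M`, this is the dual value at `l`.
  have h3 := h2 0
  simp only [add_zero] at h3
  rw [performance, h3, dualFunction_eq hD, ← hfM]
  congr 1
  rw [Finset.mul_sum, ← Finset.sum_sub_distrib]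
  exact Finset.sum_congr rfl fun i _ => by ring

end Detectable

theorem relaxedPerformance_le_optimalPerformance (sites : Fin N → ScalarSite) (M : ℕ) :
    relaxedPerformance sites M ≤ optimalPerformance sites M := by
  refine sInf_le_sInf ?_
  rintro w ⟨a, S, h, hM, rfl⟩
  refine ⟨a, S, h, longRunAverage_eq_of_tendsto ?_, rfl⟩
  refine (tendsto_const_nhds (x := (M : ℝ))).congr' ?_
  filter_upwards [eventually_gt_atTop 0] with τ hτ
  have : ∫ t in (0 : ℝ)..τ, ∑ i, a i t = ∫ _ in (0 : ℝ)..τ, (M : ℝ) := by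
    refine intervalIntegral.integral_congr fun t ht => ?_
    rw [uIcc_of_le hτ.le] at ht
    exact hM t ht.1
  rw [this, intervalIntegral.integral_const, smul_eq_mul, sub_zero, mul_div_cancel_left₀ _ hτ.ne']

/-- The dual function separates, is concave, and its maximum is the value of the relaxed problem. -/
theorem duality (hM : 0 < M) (hMN : M < N) (sites : Fin N → ScalarSite) :
    (∀ l : ℝ, IsLeast (lagrangianValues sites M l) (dualFunction sites M l) ∧
      dualFunction sites M l = (∑ i, (sites i).value l) - ((l * M : ℝ) : EReal)) ∧
    Convex ℝ {q : ℝ × ℝ | (q.2 : EReal) ≤ dualFunction sites M q.1} ∧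
    (∃ l₀ : ℝ, (∀ l, dualFunction sites M l ≤ dualFunction sites M l₀) ∧
      dualFunction sites M l₀ = relaxedPerformance sites M) := by
  by_cases hgood : ∀ i, (sites i).T ≠ 0 → (sites i).C = 0 → (sites i).A < 0
  · choose v D hD using fun i => ScalarSite.exists_isDual (hgood i)
    obtain ⟨l₀, hl₀⟩ := exists_dualFunction_eq_relaxedPerformance hD hM hMN
    refine ⟨fun l => ⟨?_, ?_⟩, convex_hypograph_dualFunction hD, l₀, fun l => ?_, hl₀⟩
    · rw [dualFunction_eq hD]
      exact isLeast_lagrangianValues hD l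
    · simp only [dualFunction_eq hD, (hD _).value_eq, EReal.coe_sub, EReal.coe_sum_real]
    · rw [hl₀]
      exact dualFunction_le_relaxedPerformance hD l
  · push Not at hgood
    obtain ⟨j, hT, hC, hA⟩ := hgood
    refine ⟨fun l => ⟨isLeast_dualFunction_of_undetectable hT hC hA l, ?_⟩, ?_, 0, fun l => ?_, ?_⟩
    · rw [dualFunction_eq_top hT hC hA, sum_value_eq_top hT hC hA, EReal.top_sub_coe]
    · simp only [dualFunction_eq_top hT hC hA, le_top]
      exact convex_univ
    · simp only [dualFunction_eq_top hT hC hA, le_refl]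
    · rw [dualFunction_eq_top hT hC hA, relaxedPerformance_eq_top hT hC hA]

end Scheduling

/-! ### The Hamilton-Jacobi-Bellman equation and its uniqueness -/

/-- Continuous functions on `[0, ∞)` that agree off a finite set are equal. -/
theorem eqOn_Ici_of_eqOn_compl_finite {p q : ℝ → ℝ} (hp : ContinuousOn p (Ici 0))
    (hq : ContinuousOn q (Ici 0)) {F : Set ℝ} (hF : F.Finite)
    (h : ∀ t, 0 < t → t ∉ F → p t = q t) {x : ℝ} (hx : 0 ≤ x) : p x = q x := by
  have hle : 𝓝[>] x ≤ 𝓝[Ici 0] x :=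
    nhdsWithin_mono x fun t ht => hx.trans (le_of_lt (mem_Ioi.1 ht))
  refine tendsto_nhds_unique_of_eventuallyEq ((hp x hx).tendsto.mono_left hle)
    ((hq x hx).tendsto.mono_left hle) ?_
  have h1 : (F \ {x})ᶜ ∈ 𝓝 x := (hF.sdiff).isClosed.isOpen_compl.mem_nhds (by simp)
  filter_upwards [self_mem_nhdsWithin, mem_nhdsWithin_of_mem_nhds h1] with t ht htF
  refine h t (hx.trans_lt ht) fun hmem => htF ⟨hmem, ?_⟩
  exact (ne_of_gt ht : t ≠ x)

namespace ScalarSite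

variable {s : ScalarSite} {l γ : ℝ} {h h' : ℝ → ℝ}

/-- Splitting of the Hamilton-Jacobi-Bellman equation by the optimal action. -/
theorem eq_min_terms_iff {x p : ℝ} :
    γ = min (s.passiveTerm x p) (s.activeTerm l x p) ↔
      (s.C ^ 2 / s.V * x ^ 2 * p ≤ s.kappa + l ∧ (2 * s.A * x + s.W) * p = γ - s.T * x) ∨
      (s.kappa + l ≤ s.C ^ 2 / s.V * x ^ 2 * p ∧
        (2 * s.A * x + s.W - s.C ^ 2 / s.V * x ^ 2) * p = γ - s.T * x - (s.kappa + l)) := by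
  unfold passiveTerm activeTerm
  constructor
  · intro hm
    rcases le_total (s.C ^ 2 / s.V * x ^ 2 * p) (s.kappa + l) with h1 | h1
    · rw [min_eq_left (by linarith)] at hm
      exact Or.inl ⟨h1, by linarith⟩
    · rw [min_eq_right (by linarith)] at hm
      exact Or.inr ⟨h1, by linarith⟩
  · rintro (⟨h1, h2⟩ | ⟨h1, h2⟩)
    · rw [min_eq_left (by linarith)]
      linarith
    · rw [min_eq_right (by linarith)]
      linarith

theorem passiveTerm_le_activeTerm_iff {x p : ℝ} :
    s.passiveTerm x p ≤ s.activeTerm l x p ↔ s.C ^ 2 / s.V * x ^ 2 * p ≤ s.kappa + l := by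
  unfold passiveTerm activeTerm
  constructor <;> intro h1 <;> linarith

theorem IsRelativeValue.continuousOn_derivWithin (hh : s.IsRelativeValue l h) :
    ContinuousOn (derivWithin h (Ici 0)) (Ici 0) :=
  hh.contDiffOn.continuousOn_derivWithin (uniqueDiffOn_Ici 0) le_rfl

theorem IsRelativeValue.cases (hh : s.IsRelativeValue l h) (hγ : s.value l = (γ : EReal)) {x : ℝ}
    (hx : 0 ≤ x) :
    (s.C ^ 2 / s.V * x ^ 2 * derivWithin h (Ici 0) x ≤ s.kappa + l ∧
      (2 * s.A * x + s.W) * derivWithin h (Ici 0) x = γ - s.T * x) ∨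
    (s.kappa + l ≤ s.C ^ 2 / s.V * x ^ 2 * derivWithin h (Ici 0) x ∧
      (2 * s.A * x + s.W - s.C ^ 2 / s.V * x ^ 2) * derivWithin h (Ici 0) x
        = γ - s.T * x - (s.kappa + l)) := by
  have h1 := hh.hjb x hx
  rw [hγ, EReal.coe_eq_coe_iff] at h1
  exact eq_min_terms_iff.1 h1

theorem IsRelativeValue.hasDerivAt (hh : s.IsRelativeValue l h) {x : ℝ} (hx : 0 < x) :
    HasDerivAt h (derivWithin h (Ici 0) x) x :=
  ((hh.contDiffOn.differentiableOn one_ne_zero x hx.le).hasDerivWithinAt).hasDerivAt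
    (Ici_mem_nhds hx)

/-- Integration of a nonnegative continuous solution of the Hamilton-Jacobi-Bellman equation. -/
theorem exists_isRelativeValue {p : ℝ → ℝ} (hγ : s.value l = (γ : EReal))
    (hp : ContinuousOn p (Ici 0)) (hp0 : ∀ x, 0 ≤ x → 0 ≤ p x)
    (hjb : ∀ x, 0 ≤ x → γ = min (s.passiveTerm x (p x)) (s.activeTerm l x (p x))) :
    ∃ h, s.IsRelativeValue l h ∧ ∀ x, 0 ≤ x → derivWithin h (Ici 0) x = p x := by
  -- Extending the slope by its value at `0` makes the primitive continuously differentiable on the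
  -- whole line.
  set P : ℝ → ℝ := fun u => p (max u 0) with hP
  have hPc : Continuous P :=
    hp.comp_continuous (by fun_prop) fun u => le_max_right u 0
  set h : ℝ → ℝ := fun x => ∫ u in (0 : ℝ)..x, P u with hh
  have hder : ∀ x, HasDerivAt h (P x) x := fun x =>
    intervalIntegral.integral_hasDerivAt_right (hPc.intervalIntegrable _ _)
      (hPc.stronglyMeasurableAtFilter _ _) hPc.continuousAt
  have hdw : ∀ x, 0 ≤ x → derivWithin h (Ici 0) x = p x := by
    intro x hx
    rw [(hder x).hasDerivWithinAt.derivWithin (uniqueDiffOn_Ici 0 x hx), hP]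
    simp [max_eq_left hx]
  refine ⟨h, ⟨?_, ?_, ?_⟩, hdw⟩
  · refine ContDiff.contDiffOn (contDiff_one_iff_deriv.2 ⟨fun x => (hder x).differentiableAt, ?_⟩)
    rwa [show deriv h = P from funext fun x => (hder x).deriv]
  · refine ⟨0, ?_⟩
    rintro _ ⟨x, hx, rfl⟩
    exact intervalIntegral.integral_nonneg hx fun u _ => hp0 _ (le_max_right u 0)
  · intro x hx
    rw [hγ, hdw x hx, ← hjb x hx]

theorem IsRelativeValue.exists_eq_add_const (hh : s.IsRelativeValue l h)
    (hh' : s.IsRelativeValue l h')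
    (heq : ∀ x, 0 ≤ x → derivWithin h' (Ici 0) x = derivWithin h (Ici 0) x) :
    ∃ c : ℝ, ∀ x, 0 ≤ x → h' x = h x + c := by
  have hd := hh.contDiffOn.differentiableOn one_ne_zero
  have hd' := hh'.contDiffOn.differentiableOn one_ne_zero
  refine ⟨h' 0 - h 0, fun x hx => ?_⟩
  have hz : ∀ y ∈ Ici (0 : ℝ), fderivWithin ℝ (h' - h) (Ici 0) y = 0 := by
    intro y hy
    have h1 : HasDerivWithinAt (h' - h) 0 (Ici 0) y := by
      have := (hd' y hy).hasDerivWithinAt.sub (hd y hy).hasDerivWithinAt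
      rwa [heq y hy, sub_self] at this
    have := h1.hasFDerivWithinAt.fderivWithin (uniqueDiffOn_Ici 0 y hy)
    rw [this]
    ext
    simp
  have := (convex_Ici (0 : ℝ)).is_const_of_fderivWithin_eq_zero (hd'.sub hd) hz hx
    (show (0 : ℝ) ∈ Ici 0 from self_mem_Ici)
  simp only [Pi.sub_apply] at this
  linarith

/-- A nonnegative solution of the Hamilton-Jacobi-Bellman equation that is the only one determines
the relative value function and the passive set. -/
theorem relativeValue_of_solution {p : ℝ → ℝ} (hγ : s.value l = (γ : EReal))
    (hp : ContinuousOn p (Ici 0)) (hp0 : ∀ x, 0 ≤ x → 0 ≤ p x)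
    (hjb : ∀ x, 0 ≤ x → γ = min (s.passiveTerm x (p x)) (s.activeTerm l x (p x)))
    (huniq : ∀ h h', s.IsRelativeValue l h → s.IsRelativeValue l h' → ∀ x, 0 ≤ x →
      derivWithin h' (Ici 0) x = derivWithin h (Ici 0) x) :
    (∃ h, s.IsRelativeValue l h ∧
      ∀ h', s.IsRelativeValue l h' → ∃ c : ℝ, ∀ S, 0 ≤ S → h' S = h S + c) ∧
    ∀ x, x ∈ s.passiveSet l ↔ 0 ≤ x ∧ s.C ^ 2 / s.V * x ^ 2 * p x ≤ s.kappa + l := by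
  obtain ⟨h, hh, hhp⟩ := exists_isRelativeValue hγ hp hp0 hjb
  refine ⟨⟨h, hh, fun h' hh' => hh.exists_eq_add_const hh' (huniq h h' hh hh')⟩, fun x => ?_⟩
  constructor
  · rintro ⟨hx, h', hh', hle⟩
    rw [passiveTerm_le_activeTerm_iff, huniq h h' hh hh' x hx, hhp x hx] at hle
    exact ⟨hx, hle⟩
  · rintro ⟨hx, hle⟩
    refine ⟨hx, h, hh, ?_⟩
    rwa [passiveTerm_le_activeTerm_iff, hhp x hx]

/-- If the passive sets are the sublevel sets of an index, the site is indexable. -/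
theorem indexable_of_passiveSet {J : ℝ → ℝ}
    (hJ : ∀ l x, x ∈ s.passiveSet l ↔ 0 ≤ x ∧ J x ≤ s.kappa + l) :
    s.Indexable ∧ ∀ x, 0 ≤ x → s.whittleIndex x = -s.kappa + J x := by
  refine ⟨⟨fun l l' hl x hx => ?_, ?_, ?_⟩, fun x hx => ?_⟩
  · rw [hJ] at hx ⊢
    exact ⟨hx.1, by linarith [hx.2]⟩
  · refine eq_empty_of_forall_notMem fun x hx => ?_
    have := ((hJ _ x).1 (mem_iInter.1 hx (J x - s.kappa - 1))).2
    linarith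
  · ext x
    rw [mem_iUnion]
    constructor
    · rintro ⟨l, hl⟩
      exact ((hJ l x).1 hl).1
    · exact fun hx => ⟨J x - s.kappa, (hJ _ x).2 ⟨hx, by linarith⟩⟩
  · have : {l : ℝ | x ∈ s.passiveSet l} = Ici (-s.kappa + J x) := by
      ext l
      rw [mem_ofPred_eq, hJ, mem_Ici]
      constructor
      · intro h1
        linarith [h1.2]
      · intro h1
        exact ⟨hx, by linarith⟩
    rw [whittleIndex, this, csInf_Ici]

/-- The function whose sign decides the optimal action. -/
noncomputable def hjbDefect (s : ScalarSite) (l γ x : ℝ) : ℝ :=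
  s.C ^ 2 / s.V * x ^ 2 * (γ - s.T * x) - (s.kappa + l) * (2 * s.A * x + s.W)

end ScalarSite

namespace ScalarSite

variable {s : ScalarSite} {l γ x : ℝ} {h h' : ℝ → ℝ}

/-- The switching function: the passive action is optimal where it is nonpositive. -/
noncomputable def switching (s : ScalarSite) (l : ℝ) (h : ℝ → ℝ) (x : ℝ) : ℝ :=
  s.C ^ 2 / s.V * x ^ 2 * derivWithin h (Ici 0) x - (s.kappa + l)

theorem IsRelativeValue.continuousOn_switching (hh : s.IsRelativeValue l h) :
    ContinuousOn (s.switching l h) (Ici 0) :=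
  ((continuousOn_const.mul (continuousOn_id.pow 2)).mul hh.continuousOn_derivWithin).sub
    continuousOn_const

/-- Multiplication of either branch by `(C² / V) x²` yields the same right-hand side; only the drift
in front of the switching function depends on the action. -/
theorem IsRelativeValue.switching_cases (hh : s.IsRelativeValue l h)
    (hγ : s.value l = (γ : EReal)) (hx : 0 ≤ x) :
    (s.switching l h x ≤ 0 ∧
        (2 * s.A * x + s.W) * s.switching l h x = s.hjbDefect l γ x) ∨
      (0 ≤ s.switching l h x ∧
        (2 * s.A * x + s.W - s.C ^ 2 / s.V * x ^ 2) * s.switching l h x = s.hjbDefect l γ x) := by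
  unfold switching hjbDefect
  rcases hh.cases hγ hx with ⟨h1, h2⟩ | ⟨h1, h2⟩
  · refine Or.inl ⟨by linarith, ?_⟩
    linear_combination (s.C ^ 2 / s.V * x ^ 2) * h2
  · refine Or.inr ⟨by linarith, ?_⟩
    linear_combination (s.C ^ 2 / s.V * x ^ 2) * h2

theorem IsRelativeValue.switching_ne_zero (hh : s.IsRelativeValue l h)
    (hγ : s.value l = (γ : EReal)) (hx : 0 ≤ x) (hd : s.hjbDefect l γ x < 0) :
    s.switching l h x ≠ 0 := by
  intro h0
  rcases hh.switching_cases hγ hx with ⟨-, h2⟩ | ⟨-, h2⟩ <;> rw [h0, mul_zero] at h2 <;> linarith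

/-- A continuous function without zeros on an interval has constant sign there. -/
theorem neg_of_ne_zero {u : ℝ → ℝ} {y z : ℝ} (hyz : y ≤ z) (hu : ContinuousOn u (Icc y z))
    (h0 : ∀ t ∈ Icc y z, u t ≠ 0) : u y < 0 ↔ u z < 0 := by
  constructor
  · intro hy
    by_contra! hz
    obtain ⟨t, ht, ht0⟩ := intermediate_value_Icc hyz hu ⟨hy.le, hz⟩
    exact h0 t ht ht0
  · intro hz
    by_contra! hy
    obtain ⟨t, ht, ht0⟩ := intermediate_value_Icc' hyz hu ⟨hz.le, hy⟩
    exact h0 t ht ht0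

theorem active_drift_x2 (hC : s.C ≠ 0) :
    2 * s.A * s.x2 + s.W - s.C ^ 2 / s.V * s.x2 ^ 2 = 0 := by
  rw [gain_mul_x2_sq hC, sub_self]

theorem active_drift_pos (hC : s.C ≠ 0) (hx : 0 ≤ x) (hx2 : x < s.x2) :
    0 < 2 * s.A * x + s.W - s.C ^ 2 / s.V * x ^ 2 := by
  rw [active_drift_eq hC]
  exact mul_pos (mul_pos (gain_pos hC) (by linarith [x1_neg hC])) (by linarith)

theorem active_drift_neg (hC : s.C ≠ 0) (hx2 : s.x2 < x) :
    2 * s.A * x + s.W - s.C ^ 2 / s.V * x ^ 2 < 0 := by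
  rw [active_drift_eq hC]
  exact mul_neg_of_pos_of_neg (mul_pos (gain_pos hC) (by linarith [x1_neg hC, x2_pos hC]))
    (by linarith)

/-- The active drift vanishes at `x2`, so the active branch would force zero defect there. Thus the
passive branch holds at `x2`, and the sign persists as long as the defect stays negative. -/
theorem IsRelativeValue.switching_neg (hh : s.IsRelativeValue l h)
    (hγ : s.value l = (γ : EReal)) (hC : s.C ≠ 0) (hx : s.x2 ≤ x)
    (hd : ∀ t, s.x2 ≤ t → t ≤ x → s.hjbDefect l γ t < 0) : s.switching l h x < 0 := by
  have hx2 := x2_pos hC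
  have h2 : s.switching l h s.x2 < 0 := by
    rcases hh.switching_cases hγ hx2.le with ⟨h1, -⟩ | ⟨-, h1⟩
    · exact lt_of_le_of_ne h1 (hh.switching_ne_zero hγ hx2.le (hd _ le_rfl hx))
    · rw [active_drift_x2 hC, zero_mul] at h1
      linarith [hd _ le_rfl hx]
  exact (neg_of_ne_zero hx (hh.continuousOn_switching.mono fun t ht => hx2.le.trans ht.1)
    fun t ht => hh.switching_ne_zero hγ (hx2.le.trans ht.1) (hd t ht.1 ht.2)).1 h2

/-- A relative value function cannot make the passive action optimal for all large variances if
`A ≥ 0`, because it would be unbounded from below. -/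
theorem IsRelativeValue.exists_switching_pos (hh : s.IsRelativeValue l h)
    (hγ : s.value l = (γ : EReal)) (hA : 0 ≤ s.A) (hneg : 0 < s.T ∨ γ < 0) (x : ℝ) :
    ∃ t, x ≤ t ∧ 0 < s.switching l h t := by
  by_contra! hcon
  obtain ⟨c, y, hc, hy⟩ : ∃ c y : ℝ, 0 < c ∧ ∀ t, y ≤ t → 0 ≤ t → γ - s.T * t ≤ -c := by
    rcases hneg with hT | hγ0
    · refine ⟨1, (γ + 1) / s.T, one_pos, fun t ht _ => ?_⟩
      rw [div_le_iff₀ hT] at ht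
      linarith
    · refine ⟨-γ, 0, by linarith, fun t ht _ => ?_⟩
      have := mul_nonneg s.T_nonneg ht
      linarith
  set b := max (max x y) 0 with hb
  have hb0 : 0 ≤ b := le_max_right _ _
  set E := 2 * s.A + s.W with hE
  have hW := s.W_pos
  have hE0 : 0 < E := by positivity
  -- Passivity gives `(2 A t + W) h' ≤ -c`, and `2 A t + W ≤ E (t + 1)`. Hence `h` decreases at
  -- least logarithmically, which contradicts boundedness below.
  have hderiv : ∀ t, b < t → derivWithin h (Ici 0) t ≤ -(c / E) / (t + 1) := by
    intro t ht
    have ht0 : 0 < t := hb0.trans_lt ht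
    have hxt : x ≤ t := ((le_max_left x y).trans (le_max_left _ _)).trans ht.le
    have hyt : y ≤ t := ((le_max_right x y).trans (le_max_left _ _)).trans ht.le
    have h1 : (2 * s.A * t + s.W) * derivWithin h (Ici 0) t ≤ -c := by
      have h2 := hcon t hxt
      unfold switching at h2
      have h3 := hy t hyt ht0.le
      rcases hh.cases hγ ht0.le with ⟨-, h4⟩ | ⟨h4, h5⟩
      · linarith
      · have h6 : s.C ^ 2 / s.V * t ^ 2 * derivWithin h (Ici 0) t = s.kappa + l := by linarith
        linarith
    have h3 : 0 < 2 * s.A * t + s.W := by positivity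
    have h4 : 2 * s.A * t + s.W ≤ E * (t + 1) := by
      rw [hE]
      nlinarith
    rw [le_div_iff₀ (by linarith), neg_div', le_div_iff₀ hE0]
    have h5 : derivWithin h (Ici 0) t < 0 := by
      by_contra! h5
      have := mul_nonneg h3.le h5
      linarith
    nlinarith
  have hanti : AntitoneOn (fun t => h t + c / E * Real.log (t + 1)) (Ici b) := by
    refine antitoneOn_of_deriv_nonpos (convex_Ici b) ?_ ?_ ?_
    · refine (hh.contDiffOn.continuousOn.mono fun t ht => hb0.trans ht).add
        (continuousOn_const.mul (ContinuousOn.log (by fun_prop) fun t ht => ?_))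
      have : b ≤ t := ht
      linarith
    all_goals
      intro t ht
      rw [interior_Ici] at ht
      have ht0 : 0 < t := hb0.trans_lt ht
      have hd1 := hh.hasDerivAt ht0
      have hd2 : HasDerivAt (fun t : ℝ => c / E * Real.log (t + 1)) (c / E * (1 / (t + 1))) t :=
        (((hasDerivAt_id t).add_const 1).log (by simp only [id]; linarith)).const_mul _
    · exact (hd1.add hd2).differentiableAt.differentiableWithinAt
    · have := (hd1.add hd2).deriv
      rw [show (fun t => h t + c / E * Real.log (t + 1)) = h + fun t => c / E * Real.log (t + 1)
        from rfl, this]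
      have h1 := hderiv t ht
      have e : -(c / E) / (t + 1) = -(c / E * (1 / (t + 1))) := by ring
      linarith
  obtain ⟨m, hm⟩ := hh.bddBelow
  have hlog : Tendsto (fun t : ℝ => c / E * Real.log (t + 1)) atTop atTop :=
    (Real.tendsto_log_atTop.comp (tendsto_atTop_add_const_right _ 1 tendsto_id)).const_mul_atTop
      (by positivity)
  obtain ⟨t, ht, htb⟩ := ((hlog.eventually
    (eventually_gt_atTop (h b + c / E * Real.log (b + 1) - m))).and (eventually_ge_atTop b)).exists
  have h1 := hanti (self_mem_Ici : b ∈ Ici b) htb htb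
  have h2 : m ≤ h t := hm ⟨t, hb0.trans htb, rfl⟩
  simp only at h1
  linarith

/-- The anchor now lies to the right. For `A < 0` it is `xe`, where the passive drift vanishes and
the passive branch would force zero defect. For `A ≥ 0` it is a far point supplied by
`exists_switching_pos`. Without zeros in between, the sign carries back to `x`. -/
theorem IsRelativeValue.switching_pos (hh : s.IsRelativeValue l h)
    (hγ : s.value l = (γ : EReal)) (hneg : 0 < s.T ∨ γ < 0) (hx : 0 ≤ x)
    (hdx : 0 ≤ 2 * s.A * x + s.W)
    (hd : ∀ t, x ≤ t → 0 ≤ 2 * s.A * t + s.W → s.hjbDefect l γ t < 0) :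
    0 < s.switching l h x := by
  obtain ⟨z, hxz, hz, hdz⟩ : ∃ z, x ≤ z ∧ 0 < s.switching l h z ∧
      ∀ t, t ≤ z → 0 ≤ t → 0 ≤ 2 * s.A * t + s.W := by
    rcases lt_or_ge s.A 0 with hA | hA
    · have hxe := (passive_drift_nonneg_iff hA x).1 hdx
      have h0 : 2 * s.A * s.xe + s.W = 0 := by linarith [two_A_mul_xe hA]
      have hde := hd s.xe hxe h0.ge
      refine ⟨s.xe, hxe, ?_, fun t ht _ => (passive_drift_nonneg_iff hA t).2 ht⟩
      rcases hh.switching_cases hγ (hx.trans hxe) with ⟨-, h1⟩ | ⟨h1, -⟩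
      · rw [h0, zero_mul] at h1
        linarith
      · exact lt_of_le_of_ne h1 (hh.switching_ne_zero hγ (hx.trans hxe) hde).symm
    · obtain ⟨z, hxz, hz⟩ := hh.exists_switching_pos hγ hA hneg x
      have := s.W_pos
      exact ⟨z, hxz, hz, fun t _ ht => by positivity⟩
  have hne : ∀ t ∈ Icc x z, s.switching l h t ≠ 0 := fun t ht =>
    hh.switching_ne_zero hγ (hx.trans ht.1) (hd t ht.1 (hdz t ht.2 (hx.trans ht.1)))
  have h1 := neg_of_ne_zero hxz (hh.continuousOn_switching.mono fun t ht => hx.trans ht.1) hne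
  have h2 : ¬ s.switching l h x < 0 := fun h3 => absurd (h1.1 h3) (not_lt.2 hz.le)
  exact lt_of_le_of_ne (not_lt.1 h2) (hne x ⟨le_rfl, hxz⟩).symm

theorem derivWithin_eq_of_switching_eq (hC : s.C ≠ 0) (hx : 0 < x)
    (heq : s.switching l h x = s.switching l h' x) :
    derivWithin h (Ici 0) x = derivWithin h' (Ici 0) x := by
  unfold switching at heq
  have hR : s.C ^ 2 / s.V * x ^ 2 ≠ 0 := (mul_pos (gain_pos hC) (pow_pos hx 2)).ne'
  exact mul_left_cancel₀ hR (by linarith)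

theorem finite_passive_drift_eq_zero (s : ScalarSite) : {x | 2 * s.A * x + s.W = 0}.Finite := by
  refine Set.Subsingleton.finite fun x hx y hy => ?_
  simp only [mem_ofPred_eq] at hx hy
  have hA : s.A ≠ 0 := by
    rintro hA
    rw [hA] at hx
    linarith [s.W_pos]
  have : 2 * s.A * (x - y) = 0 := by linarith
  rcases mul_eq_zero.1 this with h1 | h1
  · exact absurd (by linarith : s.A = 0) hA
  · linarith

/-- Uniqueness of the relative value function of an observable site, up to a constant. -/
theorem IsRelativeValue.derivWithin_eq (hC : s.C ≠ 0) (hγ : s.value l = (γ : EReal)) (X : ℝ)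
    (hd : ∀ x, s.x2 < x → 0 < 2 * s.A * x + s.W → x ≠ X →
      (∀ t, s.x2 ≤ t → t ≤ x → s.hjbDefect l γ t < 0) ∨
      ((0 < s.T ∨ γ < 0) ∧
        ∀ t, x ≤ t → 0 ≤ 2 * s.A * t + s.W → s.hjbDefect l γ t < 0))
    (hh : s.IsRelativeValue l h) (hh' : s.IsRelativeValue l h') (hx : 0 ≤ x) :
    derivWithin h' (Ici 0) x = derivWithin h (Ici 0) x := by
  refine eqOn_Ici_of_eqOn_compl_finite hh'.continuousOn_derivWithin hh.continuousOn_derivWithin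
    (F := {s.x2, X} ∪ {x | 2 * s.A * x + s.W = 0})
    ((Set.toFinite _).union s.finite_passive_drift_eq_zero) (fun t ht htF => ?_) hx
  simp only [mem_union, mem_insert_iff, mem_singleton_iff, mem_ofPred_eq, not_or] at htF
  obtain ⟨⟨ht2, htX⟩, ht0⟩ := htF
  refine derivWithin_eq_of_switching_eq (l := l) hC ht ?_
  have c := hh.switching_cases hγ ht.le
  have c' := hh'.switching_cases hγ ht.le
  -- Below `x2` both drifts are positive and above `xe` both are negative, so solutions on different
  -- branches can occur only at zero defect. Between these points the drifts have opposite signs,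
  -- and `hd` selects the branch.
  rcases lt_or_gt_of_ne ht2 with hlt | hgt
  · have h1 := active_drift_pos hC ht.le hlt
    have h2 : 0 < 2 * s.A * t + s.W := by
      have := mul_nonneg s.gain_nonneg (sq_nonneg t)
      linarith
    rcases c with ⟨c1, c2⟩ | ⟨c1, c2⟩ <;> rcases c' with ⟨d1, d2⟩ | ⟨d1, d2⟩
    · exact mul_left_cancel₀ h2.ne' (d2.trans c2.symm)
    · have := mul_nonneg h1.le d1
      have := mul_nonneg h2.le (neg_nonneg.2 c1)
      have hz : s.hjbDefect l γ t = 0 := by linarith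
      rw [hz] at c2 d2
      rw [(mul_eq_zero.1 c2).resolve_left h2.ne', (mul_eq_zero.1 d2).resolve_left h1.ne']
    · have := mul_nonneg h1.le c1
      have := mul_nonneg h2.le (neg_nonneg.2 d1)
      have hz : s.hjbDefect l γ t = 0 := by linarith
      rw [hz] at c2 d2
      rw [(mul_eq_zero.1 c2).resolve_left h1.ne', (mul_eq_zero.1 d2).resolve_left h2.ne']
    · exact mul_left_cancel₀ h1.ne' (d2.trans c2.symm)
  · have h1 := active_drift_neg hC hgt
    rcases lt_or_gt_of_ne ht0 with hn | hp
    · rcases c with ⟨c1, c2⟩ | ⟨c1, c2⟩ <;> rcases c' with ⟨d1, d2⟩ | ⟨d1, d2⟩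
      · exact mul_left_cancel₀ hn.ne (d2.trans c2.symm)
      · have := mul_nonneg (neg_nonneg.2 h1.le) d1
        have := mul_nonneg (neg_nonneg.2 hn.le) (neg_nonneg.2 c1)
        have hz : s.hjbDefect l γ t = 0 := by linarith
        rw [hz] at c2 d2
        rw [(mul_eq_zero.1 c2).resolve_left hn.ne, (mul_eq_zero.1 d2).resolve_left h1.ne]
      · have := mul_nonneg (neg_nonneg.2 h1.le) c1
        have := mul_nonneg (neg_nonneg.2 hn.le) (neg_nonneg.2 d1)
        have hz : s.hjbDefect l γ t = 0 := by linarith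
        rw [hz] at c2 d2
        rw [(mul_eq_zero.1 c2).resolve_left h1.ne, (mul_eq_zero.1 d2).resolve_left hn.ne]
      · exact mul_left_cancel₀ h1.ne (d2.trans c2.symm)
    · rcases hd t hgt hp htX with hd1 | ⟨hT, hd1⟩
      · have e := hh.switching_neg hγ hC hgt.le hd1
        have e' := hh'.switching_neg hγ hC hgt.le hd1
        have c2 := (c.resolve_right fun c => absurd c.1 (not_le.2 e)).2
        have d2 := (c'.resolve_right fun c => absurd c.1 (not_le.2 e')).2
        exact mul_left_cancel₀ hp.ne' (d2.trans c2.symm)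
      · have e := hh.switching_pos hγ hT ht.le hp.le hd1
        have e' := hh'.switching_pos hγ hT ht.le hp.le hd1
        have c2 := (c.resolve_left fun c => absurd c.1 (not_le.2 e)).2
        have d2 := (c'.resolve_left fun c => absurd c.1 (not_le.2 e')).2
        exact mul_left_cancel₀ h1.ne (d2.trans c2.symm)

/-- Uniqueness of the relative value function when observations carry no information. -/
theorem IsRelativeValue.derivWithin_eq_of_unobservable (hC : s.C = 0)
    (hγ : s.value l = (γ : EReal)) (hh : s.IsRelativeValue l h) (hh' : s.IsRelativeValue l h')
    (hx : 0 ≤ x) : derivWithin h' (Ici 0) x = derivWithin h (Ici 0) x := by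
  refine eqOn_Ici_of_eqOn_compl_finite hh'.continuousOn_derivWithin hh.continuousOn_derivWithin
    s.finite_passive_drift_eq_zero (fun t ht htF => ?_) hx
  have c := hh.cases hγ ht.le
  have c' := hh'.cases hγ ht.le
  simp only [hC, ne_eq, OfNat.ofNat_ne_zero, not_false_eq_true, zero_pow, zero_div, zero_mul,
    sub_zero] at c c'
  refine mul_left_cancel₀ htF ?_
  rcases c with ⟨c1, c2⟩ | ⟨c1, c2⟩ <;> rcases c' with ⟨d1, d2⟩ | ⟨d1, d2⟩ <;> linarith

/-- Uniqueness of the relative value function of an observable site without cost of variance. -/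
theorem IsRelativeValue.derivWithin_eq_of_T_eq_zero (hC : s.C ≠ 0) (hT : s.T = 0)
    (hh : s.IsRelativeValue l h) (hh' : s.IsRelativeValue l h')
    (hx : 0 ≤ x) : derivWithin h' (Ici 0) x = derivWithin h (Ici 0) x := by
  have hγ := (isDual_of_T_eq_zero hT).value_eq l
  have hR := gain_pos hC
  have hx2 := x2_pos hC
  -- For `T = 0` the defect is `-ν` times the active drift if `ν < 0` and `-ν` times the passive
  -- drift if `ν > 0`. It is negative wherever needed, so the exceptional point is set to the dummy
  -- value `0`. For `ν = 0` both branches say that a drift times `h'` is zero.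
  rcases lt_trichotomy (l + s.kappa) 0 with hν | hν | hν
  · refine hh.derivWithin_eq hC hγ 0 (fun y hy hdy _ => Or.inr ⟨Or.inr ?_, fun t hyt _ => ?_⟩) hh' hx
    · rwa [min_eq_left hν.le]
    · have h1 := active_drift_neg hC (hy.trans_le hyt)
      simp only [hjbDefect, hT, min_eq_left hν.le]
      nlinarith
  · have key : ∀ g, s.IsRelativeValue l g → ∀ y, 0 ≤ y → derivWithin g (Ici 0) y = 0 := by
      intro g hg y hy
      refine eqOn_Ici_of_eqOn_compl_finite (q := fun _ => 0) hg.continuousOn_derivWithin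
        continuousOn_const (F := {s.x2} ∪ {x | 2 * s.A * x + s.W = 0})
        ((Set.toFinite _).union s.finite_passive_drift_eq_zero) (fun t ht htF => ?_) hy
      simp only [mem_union, mem_singleton_iff, mem_ofPred_eq, not_or] at htF
      rcases hg.cases hγ ht.le with ⟨-, h1⟩ | ⟨-, h1⟩
      · rw [hT, min_eq_left hν.le, hν] at h1
        exact (mul_eq_zero.1 (by linarith)).resolve_left htF.2
      · rw [hT, min_eq_left hν.le, hν] at h1
        have h3 : (2 * s.A * t + s.W - s.C ^ 2 / s.V * t ^ 2) * derivWithin g (Ici 0) t = 0 := by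
          linarith
        refine (mul_eq_zero.1 h3).resolve_left ?_
        rcases lt_or_gt_of_ne htF.1 with h2 | h2
        · exact (active_drift_pos hC ht.le h2).ne'
        · exact (active_drift_neg hC h2).ne
    rw [key h hh x hx, key h' hh' x hx]
  · refine hh.derivWithin_eq hC hγ 0 (fun y hy hdy _ => Or.inl fun t ht2 hty => ?_) hh' hx
    simp only [hjbDefect, hT, min_eq_right hν.le]
    rcases hty.lt_or_eq with h1 | h1
    · have h2 := passive_drift_pos_of_lt (hx2.trans_le ht2) h1 hdy.le
      nlinarith
    · rw [h1]
      nlinarith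

/-- Relative value functions and passive sets of the sites whose cost of variance cannot be
influenced. -/
theorem relativeValue_of_step (hCT : s.C = 0 ∨ s.T = 0) (hdet : s.T ≠ 0 → s.C = 0 → s.A < 0)
    (l : ℝ) :
    (∃ h, s.IsRelativeValue l h ∧
      ∀ h', s.IsRelativeValue l h' → ∃ c : ℝ, ∀ S, 0 ≤ S → h' S = h S + c) ∧
    ∀ x, x ∈ s.passiveSet l ↔ 0 ≤ x ∧ 0 ≤ s.kappa + l := by
  by_cases hT : s.T = 0
  · have hγ := (isDual_of_T_eq_zero hT).value_eq l
    have := relativeValue_of_solution (p := fun _ => 0) hγ continuousOn_const (fun _ _ => le_rfl)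
      (fun x _ => ?_) fun h h' hh hh' x hx => ?_
    · simpa using this
    · rw [min_comm, add_comm l]
      simp [passiveTerm, activeTerm, hT]
    · by_cases hC : s.C = 0
      · exact hh.derivWithin_eq_of_unobservable hC hγ hh' hx
      · exact hh.derivWithin_eq_of_T_eq_zero hC hT hh' hx
  · have hC := hCT.resolve_right hT
    have hA := hdet hT hC
    have hγ := (isDual_of_unobservable hC hA).value_eq l
    -- This slope cancels the variance in the passive term, leaving the constant `T xe`.
    have := relativeValue_of_solution (p := fun _ => -s.T / (2 * s.A)) hγ continuousOn_const
      (fun _ _ => div_nonneg_of_nonpos (by linarith [s.T_nonneg]) (by linarith))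
      (fun x _ => ?_) fun h h' hh hh' x hx => hh.derivWithin_eq_of_unobservable hC hγ hh' hx
    · simpa [hC] using this
    · have e : s.T * x + (2 * s.A * x + s.W) * (-s.T / (2 * s.A)) = s.T * s.xe := by
        have hA' := hA.ne
        rw [xe]
        field_simp
        ring
      simp only [passiveTerm, activeTerm, hC]
      norm_num
      rw [show s.T * x + s.kappa + l + (2 * s.A * x + s.W) * (-s.T / (2 * s.A))
        = s.T * x + (2 * s.A * x + s.W) * (-s.T / (2 * s.A)) + (l + s.kappa) by ring, e]
      rcases le_total (l + s.kappa) 0 with h1 | h1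
      · rw [min_eq_left h1, min_eq_right (by linarith)]
      · rw [min_eq_right h1, min_eq_left (by linarith), add_zero]

end ScalarSite

/-! ### The index and explicit solutions in the three regimes -/

namespace ScalarSite

variable {s : ScalarSite} {l X x : ℝ}

/-- The tax at which both actions are optimal at variance `x`, up to the cost `κ` of an
observation. -/
noncomputable def threshold (s : ScalarSite) (x : ℝ) : ℝ :=
  if x ≤ s.x2 then s.T * x ^ 2 / (x - s.x1)
  else if 0 < 2 * s.A * x + s.W then s.C ^ 2 / (2 * s.V) * (s.T * x ^ 3 / (s.A * x + s.W))
  else s.T * s.C ^ 2 * x ^ 2 / (2 * |s.A| * s.V)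

theorem threshold_of_le (hx : x ≤ s.x2) : s.threshold x = s.T * x ^ 2 / (x - s.x1) := if_pos hx

theorem threshold_of_lt (hx : s.x2 < x) (hd : 0 < 2 * s.A * x + s.W) :
    s.threshold x = s.C ^ 2 / (2 * s.V) * (s.T * x ^ 3 / (s.A * x + s.W)) := by
  rw [threshold, if_neg (not_le.2 hx), if_pos hd]

theorem threshold_of_xe_le (hC : s.C ≠ 0) (hA : s.A < 0) (hx : s.xe ≤ x) :
    s.threshold x = s.T * s.C ^ 2 * x ^ 2 / (2 * |s.A| * s.V) := by
  rw [threshold, if_neg (not_le.2 ((x2_lt_xe hC hA).trans_le hx)),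
    if_neg fun h => absurd ((passive_drift_pos_iff hA x).1 h) (not_lt.2 hx)]

theorem two_mul_A_mul_x2_add_W (hC : s.C ≠ 0) :
    2 * (s.A * s.x2 + s.W) = s.C ^ 2 / s.V * s.x2 * (s.x2 - s.x1) := by
  linear_combination gain_mul_x1_mul_x2 hC - gain_mul_x2_sq hC

/-- The middle formula remains valid at both junctions `x2` and `xe`. This lets monotonicity be
glued across the pieces and the threshold be compared with the first-order condition at every
feasible variance. -/
theorem threshold_eq (hC : s.C ≠ 0) (hx : s.x2 ≤ x) (hd : 0 ≤ 2 * s.A * x + s.W) :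
    s.threshold x = s.T * (s.C ^ 2 / s.V) * x ^ 3 / (2 * (s.A * x + s.W)) := by
  have hx2 := x2_pos hC
  have hx1 := x1_neg hC
  have hR := gain_pos hC
  have hV := s.V_pos
  have hq := A_mul_add_W_pos hd
  rcases hx.lt_or_eq with h | h
  · rcases hd.lt_or_eq with h1 | h1
    · rw [threshold_of_lt h h1]
      field_simp
    · have hx0 : 0 < x := hx2.trans h
      have hA : s.A < 0 := by
        by_contra! hA
        have := s.W_pos
        have : 0 < 2 * s.A * x + s.W := by positivity
        linarith
      rw [threshold_of_xe_le hC hA, abs_of_neg hA]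
      · have e : s.A * x + s.W = -s.A * x := by linarith
        have hA' : -s.A ≠ 0 := by linarith
        rw [e]
        field_simp
      · rw [← not_lt, ← passive_drift_pos_iff hA]
        exact not_lt.2 h1.ge
  · rw [← h, threshold_of_le le_rfl, two_mul_A_mul_x2_add_W hC]
    have : s.x2 - s.x1 ≠ 0 := by linarith
    field_simp

theorem sq_div_lt_sq_div {c y z : ℝ} (hc : c < 0) (hy : 0 ≤ y) (hyz : y < z) :
    y ^ 2 / (y - c) < z ^ 2 / (z - c) := by
  rw [div_lt_div_iff₀ (by linarith) (by linarith)]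
  have h1 : 0 < (z - y) * (y * z + -c * (y + z)) :=
    mul_pos (by linarith) (add_pos_of_nonneg_of_pos (mul_nonneg hy (by linarith))
      (mul_pos (by linarith) (by linarith)))
  nlinarith

theorem strictMonoOn_threshold (hC : s.C ≠ 0) (hT : s.T ≠ 0) :
    StrictMonoOn s.threshold (Ici 0) := by
  have hT' := T_pos hT
  have hR := gain_pos hC
  have hV := s.V_pos
  have hx2 := x2_pos hC
  have h1 : StrictMonoOn s.threshold (Icc 0 s.x2) := by
    intro y hy z hz hyz
    rw [threshold_of_le hy.2, threshold_of_le hz.2, mul_div_assoc, mul_div_assoc]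
    exact mul_lt_mul_of_pos_left (sq_div_lt_sq_div (x1_neg hC) hy.1 hyz) hT'
  have h2 : StrictMonoOn s.threshold {x | s.x2 ≤ x ∧ 0 ≤ 2 * s.A * x + s.W} := by
    intro y hy z hz hyz
    have hqy := A_mul_add_W_pos hy.2
    have hqz := A_mul_add_W_pos hz.2
    have h3 := cubic_ratio_lt s.W_pos (hx2.trans_le hy.1) hyz hqy hqz
    rw [threshold_eq hC hy.1 hy.2, threshold_eq hC hz.1 hz.2, div_lt_div_iff₀ (by positivity)
      (by positivity)]
    have h4 := mul_lt_mul_of_pos_left h3 (mul_pos hT' hR)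
    linarith
  rcases lt_or_ge s.A 0 with hA | hA
  · have hxe := x2_lt_xe hC hA
    have h3 : StrictMonoOn s.threshold (Ici s.xe) := by
      intro y hy z hz hyz
      rw [threshold_of_xe_le hC hA hy, threshold_of_xe_le hC hA hz]
      have hy0 : 0 < y := (xe_pos hA).trans_le hy
      have hA' : 0 < |s.A| := abs_pos.2 hA.ne
      have hC2 : 0 < s.C ^ 2 := by positivity
      gcongr
    have e2 : {x | s.x2 ≤ x ∧ 0 ≤ 2 * s.A * x + s.W} = Icc s.x2 s.xe := by
      ext y
      rw [mem_ofPred_eq, passive_drift_nonneg_iff hA, mem_Icc]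
    rw [e2] at h2
    have h4 := h1.union h2 (isGreatest_Icc hx2.le) (isLeast_Icc hxe.le)
    rw [Icc_union_Icc_eq_Icc hx2.le hxe.le] at h4
    have h5 := h4.union h3 (isGreatest_Icc (hx2.trans hxe).le) isLeast_Ici
    rwa [Icc_union_Ici_eq_Ici (hx2.trans hxe).le] at h5
  · have e2 : {x | s.x2 ≤ x ∧ 0 ≤ 2 * s.A * x + s.W} = Ici s.x2 := by
      ext y
      rw [mem_ofPred_eq, mem_Ici, and_iff_left_iff_imp]
      intro hy
      have := hx2.le.trans hy
      have := s.W_pos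
      positivity
    rw [e2] at h2
    have h4 := h1.union h2 (isGreatest_Icc hx2.le) isLeast_Ici
    rwa [Icc_union_Ici_eq_Ici hx2.le] at h4

theorem le_threshold_iff (hC : s.C ≠ 0) (hx : s.x2 ≤ x) (hd : 0 ≤ 2 * s.A * x + s.W) {ν : ℝ} :
    ν ≤ s.threshold x ↔ 2 * ν * (s.A * x + s.W) - s.T * (s.C ^ 2 / s.V) * x ^ 3 ≤ 0 := by
  have hq := A_mul_add_W_pos hd
  rw [threshold_eq hC hx hd, le_div_iff₀ (by positivity)]
  constructor <;> intro h <;> linarith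

theorem threshold_le_iff (hC : s.C ≠ 0) (hx : s.x2 ≤ x) (hd : 0 ≤ 2 * s.A * x + s.W) {ν : ℝ} :
    s.threshold x ≤ ν ↔ 0 ≤ 2 * ν * (s.A * x + s.W) - s.T * (s.C ^ 2 / s.V) * x ^ 3 := by
  have hq := A_mul_add_W_pos hd
  rw [threshold_eq hC hx hd, div_le_iff₀ (by positivity)]
  constructor <;> intro h <;> linarith

/-- The three kinds of operating points. -/
theorem IsOperatingPoint.trichotomy (hC : s.C ≠ 0) (hX : s.IsOperatingPoint l X) :
    (X = s.x2 ∧ s.kappa + l ≤ s.threshold X) ∨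
    (s.x2 < X ∧ 0 < 2 * s.A * X + s.W ∧ s.kappa + l = s.threshold X) ∨
    (2 * s.A * X + s.W = 0 ∧ s.threshold X ≤ s.kappa + l) := by
  have hle := le_threshold_iff hC hX.x2_le hX.drift_nonneg (ν := s.kappa + l)
  have hge := threshold_le_iff hC hX.x2_le hX.drift_nonneg (ν := s.kappa + l)
  rcases hX.x2_le.lt_or_eq with h | h
  · have h1 := nonneg_of_mul_nonneg_right hX.lower (by linarith)
    rcases hX.drift_nonneg.lt_or_eq with h2 | h2
    · exact Or.inr (Or.inl ⟨h, h2, le_antisymm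
        (hle.2 (nonpos_of_mul_nonpos_right hX.upper h2)) (hge.2 h1)⟩)
    · exact Or.inr (Or.inr ⟨h2.symm, hge.2 h1⟩)
  · refine Or.inl ⟨h.symm, hle.2 (nonpos_of_mul_nonpos_right hX.upper ?_)⟩
    rw [← h]
    exact passive_drift_x2_pos hC

/-- The link to the static problem: the defect is negative exactly where the static cost exceeds
`γ`. -/
theorem hjbDefect_eq_mul (hC : s.C ≠ 0) (hx : 0 < x) (γ : ℝ) :
    s.hjbDefect l γ x
      = s.C ^ 2 / s.V * x ^ 2 * (γ - (s.T * x + (s.kappa + l) * s.activity x)) := by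
  have hR := gain_pos hC
  unfold hjbDefect activity
  set R := s.C ^ 2 / s.V
  field_simp
  ring

/-- This is the factorization of `static_cost_le` with denominators in `x` cleared, so it holds for
every real `x` and not only at feasible variances. -/
theorem hjbDefect_of_critical (hC : s.C ≠ 0) (hX : 0 < X)
    (hcrit : 2 * (s.kappa + l) * (s.A * X + s.W) = s.T * (s.C ^ 2 / s.V) * X ^ 3) (x : ℝ) :
    s.hjbDefect l (s.T * X + (s.kappa + l) * s.activity X) x
      = -((x - X) ^ 2 * (s.T * (s.C ^ 2 / s.V) * X ^ 2 * x + (s.kappa + l) * s.W) / X ^ 2) := by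
  have hR := gain_pos hC
  unfold hjbDefect activity
  set R := s.C ^ 2 / s.V
  field_simp
  linear_combination (x ^ 2 - x * X) * hcrit

/-- The operating point is the only minimizer of the static cost among the feasible variances. -/
theorem IsOperatingPoint.hjbDefect_neg (hC : s.C ≠ 0) (hT : s.T ≠ 0)
    (hX : s.IsOperatingPoint l X) (hx : s.x2 ≤ x) (hd : 0 ≤ 2 * s.A * x + s.W) (hne : x ≠ X) :
    s.hjbDefect l (s.T * X + (s.kappa + l) * s.activity X) x < 0 := by
  have hX0 : 0 < X := (x2_pos hC).trans_le hX.x2_le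
  have hx0 : 0 < x := (x2_pos hC).trans_le hx
  have hT' := T_pos hT
  have hR := gain_pos hC
  have hW := s.W_pos
  have hq := A_mul_add_W_pos hX.drift_nonneg
  -- Under the tax `l'` the point `X` is critical without constraints. Passing to `l` changes the
  -- excess static cost by `(l - l') (activity x - activity X)`, which is nonnegative by
  -- complementary slackness.
  set l' := s.threshold X - s.kappa with hl'
  have hν' : s.kappa + l' = s.threshold X := by rw [hl']; ring
  have hcrit : 2 * (s.kappa + l') * (s.A * X + s.W) = s.T * (s.C ^ 2 / s.V) * X ^ 3 := by
    have := div_mul_cancel₀ (s.T * (s.C ^ 2 / s.V) * X ^ 3)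
      (by positivity : 2 * (s.A * X + s.W) ≠ 0)
    rw [← threshold_eq hC hX.x2_le hX.drift_nonneg, ← hν'] at this
    linarith
  have hpos : 0 < s.kappa + l' := by
    rw [hν', threshold_eq hC hX.x2_le hX.drift_nonneg]
    positivity
  have h1 : s.hjbDefect l' (s.T * X + (s.kappa + l') * s.activity X) x < 0 := by
    rw [hjbDefect_of_critical hC hX0 hcrit, neg_lt_zero]
    have : 0 < (x - X) ^ 2 := by
      have : x - X ≠ 0 := sub_ne_zero.2 hne
      positivity
    positivity
  rw [hjbDefect_eq_mul hC hx0] at h1 ⊢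
  have hRx : 0 < s.C ^ 2 / s.V * x ^ 2 := by positivity
  have h2 := neg_of_mul_neg_right h1 hRx.le
  refine mul_neg_of_pos_of_neg hRx ?_
  have key : 0 ≤ (s.kappa + l - (s.kappa + l')) * (s.activity x - s.activity X) := by
    rw [hν']
    rcases hX.trichotomy hC with ⟨h3, h4⟩ | ⟨-, -, h4⟩ | ⟨h3, h4⟩
    · have h5 : s.activity X = 1 := by rw [h3, activity_x2 hC]
      rw [h5]
      exact mul_nonneg_of_nonpos_of_nonpos (by linarith) (by linarith [activity_le_one hC hx])
    · rw [h4, sub_self, zero_mul]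
    · have h5 : s.activity X = 0 := by rw [activity, h3, zero_div]
      rw [h5]
      exact mul_nonneg (by linarith) (by linarith [activity_nonneg hd])
  linarith

/-- Uniqueness of the relative value function of an observable site. -/
theorem IsOperatingPoint.derivWithin_eq (hC : s.C ≠ 0) (hT : s.T ≠ 0)
    (hX : s.IsOperatingPoint l X)
    (hγ : s.value l = ((s.T * X + (s.kappa + l) * s.activity X : ℝ) : EReal)) {h h' : ℝ → ℝ}
    (hh : s.IsRelativeValue l h) (hh' : s.IsRelativeValue l h') (hx : 0 ≤ x) :
    derivWithin h' (Ici 0) x = derivWithin h (Ici 0) x := by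
  refine hh.derivWithin_eq hC hγ X (fun y hy hdy hne => ?_) hh' hx
  -- To the left of the operating point the defect is negative all the way down to `x2`; to the
  -- right it is negative on the rest of the feasible range.
  rcases lt_or_gt_of_ne hne with hlt | hgt
  · refine Or.inl fun t ht2 hty => hX.hjbDefect_neg hC hT ht2 ?_ (hty.trans_lt hlt).ne
    rcases hty.lt_or_eq with h1 | h1
    · exact (passive_drift_pos_of_lt ((x2_pos hC).trans_le ht2) h1 hdy.le).le
    · rw [h1]
      exact hdy.le
  · exact Or.inr ⟨Or.inl (T_pos hT), fun t hyt hdt =>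
      hX.hjbDefect_neg hC hT (hy.le.trans hyt) hdt (hgt.trans_le hyt).ne'⟩

/-- A function that is defined piecewise on `[0, c]` and `[c, ∞)`. -/
theorem continuousOn_Ici_ite {c : ℝ} {p q : ℝ → ℝ} (hc : 0 ≤ c) (hp : ContinuousOn p (Icc 0 c))
    (hq : ContinuousOn q (Ici c)) (hpq : p c = q c) :
    ContinuousOn (fun x => if x ≤ c then p x else q x) (Ici 0) := by
  have h1 : ContinuousOn (fun x => if x ≤ c then p x else q x) (Icc 0 c) :=
    hp.congr fun x hx => if_pos hx.2
  have h2 : ContinuousOn (fun x => if x ≤ c then p x else q x) (Ici c) := by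
    refine hq.congr fun x hx => ?_
    rcases (mem_Ici.1 hx).lt_or_eq with h | h
    · exact if_neg (not_le.2 h)
    · simp [← h, hpq]
  have := h1.union_of_isClosed h2 isClosed_Icc isClosed_Ici
  rwa [Icc_union_Ici_eq_Ici hc] at this

/-- A nonnegative solution `p` of the Hamilton-Jacobi-Bellman equation at optimal cost `γ` whose
passive set is given by the threshold. -/
structure IsThresholdSolution (s : ScalarSite) (l γ : ℝ) (p : ℝ → ℝ) : Prop where
  continuousOn : ContinuousOn p (Ici 0)
  nonneg : ∀ x, 0 ≤ x → 0 ≤ p x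
  hjb : ∀ x, 0 ≤ x → γ = min (s.passiveTerm x (p x)) (s.activeTerm l x (p x))
  passive_iff : ∀ x, 0 ≤ x →
    (s.C ^ 2 / s.V * x ^ 2 * p x ≤ s.kappa + l ↔ s.threshold x ≤ s.kappa + l)

theorem passive_drift_pos_of_le_x2 (hC : s.C ≠ 0) (hx : 0 ≤ x) (hx2 : x ≤ s.x2) :
    0 < 2 * s.A * x + s.W := by
  rcases hx.lt_or_eq with h | h
  · rcases hx2.lt_or_eq with h2 | h2
    · exact passive_drift_pos_of_lt h h2 (passive_drift_x2_pos hC).le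
    · rw [h2]
      exact passive_drift_x2_pos hC
  · rw [← h]
    simpa using s.W_pos

theorem continuousOn_passive_slope (γ : ℝ) {I : Set ℝ} (hI : ∀ x ∈ I, 2 * s.A * x + s.W ≠ 0) :
    ContinuousOn (fun x => (γ - s.T * x) / (2 * s.A * x + s.W)) I :=
  ContinuousOn.div (by fun_prop) (by fun_prop) hI

theorem continuousOn_active_slope (γ : ℝ) {I : Set ℝ}
    (hI : ∀ x ∈ I, 2 * s.A * x + s.W - s.C ^ 2 / s.V * x ^ 2 ≠ 0) :
    ContinuousOn (fun x => (γ - s.T * x - (s.kappa + l)) /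
      (2 * s.A * x + s.W - s.C ^ 2 / s.V * x ^ 2)) I :=
  ContinuousOn.div (by fun_prop) (by fun_prop) hI

/-- Solution when observing all the time is optimal on average. -/
theorem exists_isThresholdSolution_of_le (hC : s.C ≠ 0) (hT : s.T ≠ 0)
    (hν : s.kappa + l ≤ s.threshold s.x2) :
    ∃ p, s.IsThresholdSolution l (s.T * s.x2 + (s.kappa + l)) p := by
  have hx2 := x2_pos hC
  have hx1 := x1_neg hC
  have hR := gain_pos hC
  have hT' := T_pos hT
  have hmono := strictMonoOn_threshold hC hT
  set γ := s.T * s.x2 + (s.kappa + l) with hγ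
  -- The slope of the active branch after cancelling the factor `x2 - x`, common to the active drift
  -- and to `γ - T x - ν`; it stays regular at `x2`.
  set pa : ℝ → ℝ := fun x => s.T / (s.C ^ 2 / s.V * (x - s.x1)) with hpa
  set pp : ℝ → ℝ := fun x => (γ - s.T * x) / (2 * s.A * x + s.W) with hpp
  have hpa0 : ∀ x, 0 ≤ x → 0 < pa x := fun x hx =>
    div_pos hT' (mul_pos hR (by linarith))
  have hpaJ : ∀ x, 0 ≤ x → s.C ^ 2 / s.V * x ^ 2 * pa x = s.T * x ^ 2 / (x - s.x1) := by
    intro x hx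
    have : x - s.x1 ≠ 0 := by linarith
    have hV := s.V_pos.ne'
    simp only [hpa]
    field_simp
  have hactive : ∀ x, 0 ≤ x → (2 * s.A * x + s.W - s.C ^ 2 / s.V * x ^ 2) * pa x
      = γ - s.T * x - (s.kappa + l) := by
    intro x hx
    have : x - s.x1 ≠ 0 := by linarith
    have hV := s.V_pos.ne'
    rw [active_drift_eq hC, hγ]
    simp only [hpa]
    field_simp
    ring
  have hpassive : ∀ x, 0 ≤ x → x ≤ s.x2 → (2 * s.A * x + s.W) * pp x = γ - s.T * x :=
    fun x hx hle => mul_div_cancel₀ _ (passive_drift_pos_of_le_x2 hC hx hle).ne'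
  have hpac : ContinuousOn pa (Ici 0) := by
    refine ContinuousOn.div (by fun_prop) (by fun_prop) fun x hx => ?_
    have : 0 ≤ x := hx
    exact (mul_pos hR (by linarith)).ne'
  have hadrift : ∀ x, 0 ≤ x → x ≤ s.x2 → 0 ≤ 2 * s.A * x + s.W - s.C ^ 2 / s.V * x ^ 2 := by
    intro x hx hle
    rcases hle.lt_or_eq with h | h
    · exact (active_drift_pos hC hx h).le
    · rw [h, active_drift_x2 hC]
  have hthr : s.threshold s.x2 = s.T * s.x2 ^ 2 / (s.x2 - s.x1) := threshold_of_le le_rfl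
  have hjoin : max (pa s.x2) (pp s.x2) = pa s.x2 := by
    refine max_eq_left ?_
    have h1 := hpassive s.x2 hx2.le le_rfl
    have h2 := hpaJ s.x2 hx2.le
    rw [← hthr, gain_mul_x2_sq hC] at h2
    refine le_of_mul_le_mul_left ?_ (passive_drift_x2_pos hC)
    rw [h1, h2, hγ]
    linarith
  -- Up to `x2` neither drift is negative, so both terms are nondecreasing in the slope, and the
  -- equation is solved by the larger of the two branch slopes. Beyond `x2` the active branch is
  -- used alone.
  have hcases : ∀ x, 0 ≤ x →
      (s.C ^ 2 / s.V * x ^ 2 * (if x ≤ s.x2 then max (pa x) (pp x) else pa x) ≤ s.kappa + l ∧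
        (2 * s.A * x + s.W) * (if x ≤ s.x2 then max (pa x) (pp x) else pa x) = γ - s.T * x) ∨
      (s.kappa + l ≤ s.C ^ 2 / s.V * x ^ 2 * (if x ≤ s.x2 then max (pa x) (pp x) else pa x) ∧
        (2 * s.A * x + s.W - s.C ^ 2 / s.V * x ^ 2) *
          (if x ≤ s.x2 then max (pa x) (pp x) else pa x) = γ - s.T * x - (s.kappa + l)) := by
    intro x hx
    have ha := hactive x hx
    by_cases hle : x ≤ s.x2
    · simp only [hle, if_true]
      have hb := hpassive x hx hle
      have hd := passive_drift_pos_of_le_x2 hC hx hle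
      rcases le_total (pa x) (pp x) with h | h
      · rw [max_eq_right h]
        have := mul_le_mul_of_nonneg_left h (hadrift x hx hle)
        exact Or.inl ⟨by linarith, hb⟩
      · rw [max_eq_left h]
        have := mul_le_mul_of_nonneg_left h hd.le
        exact Or.inr ⟨by linarith, ha⟩
    · simp only [hle, if_false]
      refine Or.inr ⟨?_, ha⟩
      have h1 := sq_div_lt_sq_div hx1 hx2.le (not_le.1 hle)
      have h2 := mul_lt_mul_of_pos_left h1 hT'
      rw [hpaJ x hx, mul_div_assoc]
      rw [hthr, mul_div_assoc] at hν
      linarith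
  refine ⟨fun x => if x ≤ s.x2 then max (pa x) (pp x) else pa x, ⟨?_, fun x hx => ?_,
    fun x hx => eq_min_terms_iff.2 (hcases x hx), fun x hx => ?_⟩⟩
  · refine continuousOn_Ici_ite hx2.le ((hpac.mono fun x hx => hx.1).sup ?_)
      (hpac.mono fun x hx => hx2.le.trans hx) hjoin
    exact continuousOn_passive_slope γ fun x hx => (passive_drift_pos_of_le_x2 hC hx.1 hx.2).ne'
  · have := hpa0 x hx
    split_ifs
    · exact this.le.trans (le_max_left _ _)
    · exact this.le
  · have hRx : 0 ≤ s.C ^ 2 / s.V * x ^ 2 := by positivity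
    by_cases hle : x ≤ s.x2
    · have hc := hcases x hx
      simp only [hle, if_true] at hc ⊢
      rw [threshold_of_le hle, ← hpaJ x hx]
      refine ⟨fun h => (mul_le_mul_of_nonneg_left (le_max_left _ _) hRx).trans h, fun h => ?_⟩
      rcases le_total (pa x) (pp x) with h1 | h1
      · rcases hc with ⟨h2, -⟩ | ⟨h2, h3⟩
        · exact h2
        · rw [max_eq_right h1] at h2 h3 ⊢
          have h4 := hpassive x hx hle
          linarith
      · rwa [max_eq_left h1]
    · simp only [hle, if_false]
      rw [hpaJ x hx]
      have h1 := sq_div_lt_sq_div hx1 hx2.le (not_le.1 hle)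
      have h2 := mul_lt_mul_of_pos_left h1 hT'
      have h3 := hmono (mem_Ici.2 hx2.le) (mem_Ici.2 hx) (not_le.1 hle)
      have h4 := hν
      rw [hthr, mul_div_assoc] at h4
      rw [mul_div_assoc]
      constructor <;> intro h <;> linarith

/-- Solution when both actions are used infinitely often. -/
theorem exists_isThresholdSolution_of_eq (hC : s.C ≠ 0) (hT : s.T ≠ 0) (hX : s.x2 < X)
    (hd : 0 < 2 * s.A * X + s.W) (hν : s.kappa + l = s.threshold X) :
    ∃ p, s.IsThresholdSolution l (s.T * X + (s.kappa + l) * s.activity X) p := by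
  have hx2 := x2_pos hC
  have hX0 : 0 < X := hx2.trans hX
  have hR := gain_pos hC
  have hT' := T_pos hT
  have hW := s.W_pos
  have hq := A_mul_add_W_pos hd.le
  have hmono := strictMonoOn_threshold hC hT
  have hcrit : 2 * (s.kappa + l) * (s.A * X + s.W) = s.T * (s.C ^ 2 / s.V) * X ^ 3 := by
    have := div_mul_cancel₀ (s.T * (s.C ^ 2 / s.V) * X ^ 3)
      (by positivity : 2 * (s.A * X + s.W) ≠ 0)
    rw [← threshold_eq hC hX.le hd.le, ← hν] at this
    linarith
  have hν0 : 0 < s.kappa + l := by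
    rw [hν, threshold_eq hC hX.le hd.le]
    positivity
  set γ := s.T * X + (s.kappa + l) * s.activity X with hγ
  have hdef : ∀ x, 0 ≤ x → s.hjbDefect l γ x ≤ 0 := by
    intro x hx
    rw [hγ, hjbDefect_of_critical hC hX0 hcrit, neg_nonpos]
    positivity
  have hdef' : ∀ x, 0 ≤ x → x ≠ X → s.hjbDefect l γ x < 0 := by
    intro x hx hne
    rw [hγ, hjbDefect_of_critical hC hX0 hcrit, neg_lt_zero]
    have : 0 < (x - X) ^ 2 := by
      have : x - X ≠ 0 := sub_ne_zero.2 hne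
      positivity
    positivity
  have hdrift : ∀ x, 0 ≤ x → x ≤ X → 0 < 2 * s.A * x + s.W := by
    intro x hx hle
    rcases le_total x s.x2 with h | h
    · exact passive_drift_pos_of_le_x2 hC hx h
    · rcases hle.lt_or_eq with h1 | h1
      · exact passive_drift_pos_of_lt (hx2.trans_le h) h1 hd.le
      · rwa [h1]
  have hact : s.C ^ 2 / s.V * X ^ 2 * s.activity X = 2 * s.A * X + s.W :=
    mul_div_cancel₀ _ (by positivity)
  set pp : ℝ → ℝ := fun x => (γ - s.T * x) / (2 * s.A * x + s.W) with hpp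
  set pa : ℝ → ℝ := fun x => (γ - s.T * x - (s.kappa + l)) /
      (2 * s.A * x + s.W - s.C ^ 2 / s.V * x ^ 2) with hpa
  have hpassive : ∀ x, 0 ≤ x → x ≤ X → (2 * s.A * x + s.W) * pp x = γ - s.T * x :=
    fun x hx hle => mul_div_cancel₀ _ (hdrift x hx hle).ne'
  have hactive : ∀ x, X ≤ x → (2 * s.A * x + s.W - s.C ^ 2 / s.V * x ^ 2) * pa x
      = γ - s.T * x - (s.kappa + l) :=
    fun x hx => mul_div_cancel₀ _ (active_drift_neg hC (hX.trans_le hx)).ne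
  -- At the operating point the optimal cost makes the two actions indifferent, so the branch slopes
  -- meet there.
  have hppX : s.C ^ 2 / s.V * X ^ 2 * pp X = s.kappa + l := by
    refine mul_left_cancel₀ hd.ne' ?_
    linear_combination (s.C ^ 2 / s.V * X ^ 2) * hpassive X hX0.le le_rfl + (s.kappa + l) * hact
  have hjoin : pp X = pa X := by
    refine mul_left_cancel₀ (active_drift_neg hC hX).ne ?_
    linear_combination hpassive X hX0.le le_rfl - hppX - hactive X le_rfl
  -- On either side of `X` the relevant drift times the switching expression equals the defect,
  -- which is nonpositive. The passive drift is positive up to `X` and the active drift negative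
  -- beyond it, so the action changes at `X`.
  have hpple : ∀ x, 0 ≤ x → x ≤ X → s.C ^ 2 / s.V * x ^ 2 * pp x ≤ s.kappa + l := by
    intro x hx hle
    refine le_of_mul_le_mul_left ?_ (hdrift x hx hle)
    have h1 := hdef x hx
    unfold hjbDefect at h1
    rw [← hpassive x hx hle] at h1
    linarith
  have hpage : ∀ x, X < x → s.kappa + l < s.C ^ 2 / s.V * x ^ 2 * pa x := by
    intro x hx
    have h1 := hdef' x (hX0.trans hx).le hx.ne'
    have h2 := active_drift_neg hC (hX.trans hx)
    have h3 := hactive x hx.le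
    unfold hjbDefect at h1
    by_contra! hcon
    have h4 := mul_le_mul_of_nonpos_left hcon h2.le
    have h5 : γ - s.T * x = (2 * s.A * x + s.W - s.C ^ 2 / s.V * x ^ 2) * pa x + (s.kappa + l) := by
      linarith
    rw [h5] at h1
    linarith
  refine ⟨fun x => if x ≤ X then pp x else pa x, ⟨?_, fun x hx => ?_, fun x hx => ?_,
    fun x hx => ?_⟩⟩
  · exact continuousOn_Ici_ite hX0.le
      (continuousOn_passive_slope γ fun x hx => (hdrift x hx.1 hx.2).ne')
      (continuousOn_active_slope γ fun x hx => (active_drift_neg hC (hX.trans_le hx)).ne) hjoin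
  · split_ifs with hle
    · refine div_nonneg ?_ (hdrift x hx hle).le
      have h1 := mul_nonneg hν0.le (activity_nonneg hd.le)
      have h2 := mul_le_mul_of_nonneg_left hle hT'.le
      linarith
    · have hx0 : 0 < x := hX0.trans (not_le.1 hle)
      have h1 := hν0.trans (hpage x (not_le.1 hle))
      exact (pos_of_mul_pos_right h1 (by positivity)).le
  · refine eq_min_terms_iff.2 ?_
    by_cases hle : x ≤ X
    · simp only [hle, if_true]
      exact Or.inl ⟨hpple x hx hle, hpassive x hx hle⟩
    · simp only [hle, if_false]
      exact Or.inr ⟨(hpage x (not_le.1 hle)).le, hactive x (not_le.1 hle).le⟩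
  · rw [hν, hmono.le_iff_le (mem_Ici.2 hx) (mem_Ici.2 hX0.le), ← hν]
    by_cases hle : x ≤ X
    · simp only [hle, if_true, iff_true]
      exact hpple x hx hle
    · simp only [hle, if_false, iff_false, not_le]
      exact hpage x (not_le.1 hle)

/-- Solution when never observing is optimal on average. -/
theorem exists_isThresholdSolution_of_ge (hC : s.C ≠ 0) (hT : s.T ≠ 0) (hA : s.A < 0)
    (hν : s.threshold s.xe ≤ s.kappa + l) :
    ∃ p, s.IsThresholdSolution l (s.T * s.xe) p := by
  have hx2e := x2_lt_xe hC hA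
  have hxe := xe_pos hA
  have hR := gain_pos hC
  have hT' := T_pos hT
  have hV := s.V_pos
  have hmono := strictMonoOn_threshold hC hT
  -- With optimal cost `T xe` the passive slope is this constant, because the factor `x - xe`
  -- cancels.
  set c := s.T / (2 * |s.A|) with hc
  have hA' : 0 < |s.A| := abs_pos.2 hA.ne
  have hc0 : 0 < c := by positivity
  have hpassive : ∀ x, (2 * s.A * x + s.W) * c = s.T * s.xe - s.T * x := by
    intro x
    rw [passive_drift_eq hA, hc, abs_of_neg hA]
    have : s.A ≠ 0 := hA.ne
    field_simp
    ring
  have hJ : ∀ x, s.xe ≤ x → s.threshold x = s.C ^ 2 / s.V * x ^ 2 * c := by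
    intro x hx
    rw [threshold_of_xe_le hC hA hx, hc]
    field_simp
  have hν0 : 0 < s.kappa + l := by
    refine lt_of_lt_of_le ?_ hν
    rw [hJ _ le_rfl]
    positivity
  set pa : ℝ → ℝ := fun x => (s.T * s.xe - s.T * x - (s.kappa + l)) /
      (2 * s.A * x + s.W - s.C ^ 2 / s.V * x ^ 2) with hpa
  have hactive : ∀ x, s.xe ≤ x → (2 * s.A * x + s.W - s.C ^ 2 / s.V * x ^ 2) * pa x
      = s.T * s.xe - s.T * x - (s.kappa + l) :=
    fun x hx => mul_div_cancel₀ _ (active_drift_neg hC (hx2e.trans_le hx)).ne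
  have hpa0 : ∀ x, s.xe ≤ x → 0 ≤ pa x := by
    intro x hx
    refine div_nonneg_of_nonpos ?_ (active_drift_neg hC (hx2e.trans_le hx)).le
    have := mul_le_mul_of_nonneg_left hx hT'.le
    linarith
  have hjoin : c = min c (pa s.xe) := by
    refine (min_eq_left ?_).symm
    have h1 := active_drift_neg hC hx2e
    refine (mul_le_mul_left_of_neg h1).1 ?_
    rw [hactive _ le_rfl]
    rw [hJ _ le_rfl] at hν
    have := hpassive s.xe
    linarith
  -- Beyond `xe` both drifts are negative, so both terms decrease in the slope and the smaller
  -- branch slope solves the equation.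
  have hcases : ∀ x, s.xe < x →
      (s.C ^ 2 / s.V * x ^ 2 * min c (pa x) ≤ s.kappa + l ∧
        (2 * s.A * x + s.W) * min c (pa x) = s.T * s.xe - s.T * x) ∨
      (s.kappa + l ≤ s.C ^ 2 / s.V * x ^ 2 * min c (pa x) ∧
        (2 * s.A * x + s.W - s.C ^ 2 / s.V * x ^ 2) * min c (pa x)
          = s.T * s.xe - s.T * x - (s.kappa + l)) := by
    intro x hx
    have ha := hactive x hx.le
    have hb := hpassive x
    have h1 := active_drift_neg hC (hx2e.trans hx)
    have h2 : 2 * s.A * x + s.W < 0 := by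
      rw [passive_drift_eq hA]
      exact mul_neg_of_neg_of_pos (by linarith) (by linarith)
    rcases le_total c (pa x) with h | h
    · rw [min_eq_left h]
      have := mul_le_mul_of_nonpos_left h h1.le
      exact Or.inl ⟨by linarith, hb⟩
    · rw [min_eq_right h]
      have := mul_le_mul_of_nonpos_left h h2.le
      exact Or.inr ⟨by linarith, ha⟩
  have hlow : ∀ x, 0 ≤ x → x ≤ s.xe → s.C ^ 2 / s.V * x ^ 2 * c ≤ s.kappa + l := by
    intro x hx hle
    refine le_trans ?_ hν
    rw [hJ _ le_rfl]
    gcongr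
  refine ⟨fun x => if x ≤ s.xe then c else min c (pa x), ⟨?_, fun x hx => ?_, fun x hx => ?_,
    fun x hx => ?_⟩⟩
  · exact continuousOn_Ici_ite hxe.le continuousOn_const (continuousOn_const.inf
      (continuousOn_active_slope _ fun x hx => (active_drift_neg hC (hx2e.trans_le hx)).ne)) hjoin
  · split_ifs with hle
    · exact hc0.le
    · exact le_min hc0.le (hpa0 x (not_le.1 hle).le)
  · refine eq_min_terms_iff.2 ?_
    by_cases hle : x ≤ s.xe
    · simp only [hle, if_true]
      exact Or.inl ⟨hlow x hx hle, hpassive x⟩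
    · simp only [hle, if_false]
      exact hcases x (not_le.1 hle)
  · by_cases hle : x ≤ s.xe
    · simp only [hle, if_true]
      have h1 : s.threshold x ≤ s.kappa + l :=
        ((hmono.le_iff_le (mem_Ici.2 hx) (mem_Ici.2 hxe.le)).2 hle).trans hν
      exact ⟨fun _ => h1, fun _ => hlow x hx hle⟩
    · have hlt := not_le.1 hle
      simp only [hle, if_false]
      rw [hJ x hlt.le]
      have hRx : 0 ≤ s.C ^ 2 / s.V * x ^ 2 := by positivity
      refine ⟨fun h => ?_, fun h => (mul_le_mul_of_nonneg_left (min_le_left _ _) hRx).trans h⟩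
      rcases le_total c (pa x) with h1 | h1
      · rwa [min_eq_left h1] at h
      · rw [min_eq_right h1] at h
        have ha := hactive x hlt.le
        have hb := hpassive x
        have h2 := active_drift_neg hC (hx2e.trans hlt)
        have h3 : 2 * s.A * x + s.W < 0 := by
          rw [passive_drift_eq hA]
          exact mul_neg_of_neg_of_pos (by linarith) (by linarith)
        have h4 : (2 * s.A * x + s.W) * pa x ≤ (2 * s.A * x + s.W) * c := by linarith
        have h5 : c ≤ pa x := (mul_le_mul_left_of_neg h3).1 h4
        rwa [le_antisymm h1 h5] at h

end ScalarSite

/-! ### Closed forms and the theorem -/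

namespace ScalarSite

variable {s : ScalarSite} {l X x : ℝ}

theorem IsOperatingPoint.value_eq (hC : s.C ≠ 0) (hT : s.T ≠ 0) (hX : s.IsOperatingPoint l X) :
    s.value l = ((s.T * X + (s.kappa + l) * s.activity X : ℝ) : EReal) := by
  obtain ⟨v, hv, hD⟩ := exists_isDual_of_observable hC hT
  rw [hD.value_eq l, hv l X hX]

theorem IsOperatingPoint.exists_isThresholdSolution (hC : s.C ≠ 0) (hT : s.T ≠ 0)
    (hX : s.IsOperatingPoint l X) :
    ∃ p, s.IsThresholdSolution l (s.T * X + (s.kappa + l) * s.activity X) p := by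
  rcases hX.trichotomy hC with ⟨h1, h2⟩ | ⟨h1, h2, h3⟩ | ⟨h1, h2⟩
  · subst h1
    rw [activity_x2 hC, mul_one]
    exact exists_isThresholdSolution_of_le hC hT h2
  · exact exists_isThresholdSolution_of_eq hC hT h1 h2 h3
  · have hX0 : 0 < X := (x2_pos hC).trans_le hX.x2_le
    have hA : s.A < 0 := by
      by_contra! hA
      have := s.W_pos
      have : 0 < 2 * s.A * X + s.W := by positivity
      linarith
    have hXe : X = s.xe := by
      have h3 : 2 * s.A * (X - s.xe) = 0 := by rw [← passive_drift_eq hA, h1]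
      have := (mul_eq_zero.1 h3).resolve_left (by linarith)
      linarith
    have h4 : s.activity X = 0 := by rw [activity, h1, zero_div]
    rw [h4, mul_zero, add_zero, hXe]
    exact exists_isThresholdSolution_of_ge hC hT hA (hXe ▸ h2)

theorem relativeValue_of_observable (hC : s.C ≠ 0) (hT : s.T ≠ 0) (l : ℝ) :
    (∃ h, s.IsRelativeValue l h ∧
      ∀ h', s.IsRelativeValue l h' → ∃ c : ℝ, ∀ S, 0 ≤ S → h' S = h S + c) ∧
    ∀ x, x ∈ s.passiveSet l ↔ 0 ≤ x ∧ s.threshold x ≤ s.kappa + l := by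
  obtain ⟨X, hX⟩ := exists_isOperatingPoint hC hT l
  have hγ := hX.value_eq hC hT
  obtain ⟨p, hp⟩ := hX.exists_isThresholdSolution hC hT
  obtain ⟨h1, h2⟩ := relativeValue_of_solution hγ hp.continuousOn hp.nonneg hp.hjb
    fun h h' hh hh' x hx => hX.derivWithin_eq hC hT hγ hh hh' hx
  refine ⟨h1, fun x => (h2 x).trans ?_⟩
  constructor
  · exact fun h => ⟨h.1, (hp.passive_iff x h.1).1 h.2⟩
  · exact fun h => ⟨h.1, (hp.passive_iff x h.1).2 h.2⟩

theorem whittleIndex_eq (hC : s.C ≠ 0) (hT : s.T ≠ 0) (hx : 0 ≤ x) :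
    s.whittleIndex x = -s.kappa + s.threshold x :=
  (indexable_of_passiveSet fun l => (relativeValue_of_observable hC hT l).2).2 x hx

/-- Relative value functions, indexability and Whittle index of a detectable site. -/
theorem indexability (s : ScalarSite) (hdet : s.T ≠ 0 → s.C = 0 → s.A < 0) :
    (∀ l : ℝ, ∃ h, s.IsRelativeValue l h ∧
      ∀ h', s.IsRelativeValue l h' → ∃ c : ℝ, ∀ S, 0 ≤ S → h' S = h S + c) ∧
    s.Indexable ∧
    (s.C = 0 ∨ s.T = 0 → ∀ S, 0 ≤ S → s.whittleIndex S = -s.kappa) ∧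
    (s.C ≠ 0 → s.T ≠ 0 →
      (∀ S, 0 ≤ S → S ≤ s.x2 →
        s.whittleIndex S = -s.kappa + s.T * S ^ 2 / (S - s.x1)) ∧
      (∀ S, s.x2 < S → (s.A < 0 → S < s.xe) →
        s.whittleIndex S =
          -s.kappa + s.C ^ 2 / (2 * s.V) * (s.T * S ^ 3 / (s.A * S + s.W))) ∧
      (∀ S, s.A < 0 → s.xe ≤ S →
        s.whittleIndex S = -s.kappa + s.T * s.C ^ 2 * S ^ 2 / (2 * |s.A| * s.V))) := by
  by_cases hCT : s.C = 0 ∨ s.T = 0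
  · have h1 := relativeValue_of_step hCT hdet
    obtain ⟨h2, h3⟩ := indexable_of_passiveSet (J := fun _ => 0) fun l => (h1 l).2
    refine ⟨fun l => (h1 l).1, h2, fun _ S hS => by simpa using h3 S hS, fun hC hT => ?_⟩
    exact absurd hCT (not_or.2 ⟨hC, hT⟩)
  · obtain ⟨hC, hT⟩ := not_or.1 hCT
    have h1 := relativeValue_of_observable hC hT
    refine ⟨fun l => (h1 l).1, (indexable_of_passiveSet fun l => (h1 l).2).1,
      fun h => absurd h hCT, fun _ _ => ⟨fun S hS hle => ?_, fun S hlt hSe => ?_, fun S hA hle => ?_⟩⟩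
    · rw [whittleIndex_eq hC hT hS, threshold_of_le hle]
    · have hS : 0 < S := (x2_pos hC).trans hlt
      rw [whittleIndex_eq hC hT hS.le, threshold_of_lt hlt]
      rcases lt_or_ge s.A 0 with hA | hA
      · exact (passive_drift_pos_iff hA S).2 (hSe hA)
      · have := s.W_pos
        positivity
    · rw [whittleIndex_eq hC hT ((xe_pos hA).le.trans hle), threshold_of_xe_le hC hA hle]

theorem cubic_eq_zero_iff (hC : s.C ≠ 0) (hT : s.T ≠ 0) :
    s.cubic l X = 0 ↔
      2 * (s.kappa + l) * (s.A * X + s.W) - s.T * (s.C ^ 2 / s.V) * X ^ 3 = 0 := by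
  have hV := s.V_pos.ne'
  have e : 2 * (s.kappa + l) * (s.A * X + s.W) - s.T * (s.C ^ 2 / s.V) * X ^ 3
      = -(s.T * (s.C ^ 2 / s.V)) * s.cubic l X := by
    unfold cubic
    field_simp
    ring
  rw [e, mul_eq_zero, or_iff_right]
  exact (neg_neg_of_pos (mul_pos (T_pos hT) (gain_pos hC))).ne

/-- A positive root satisfies `A X + W > 0` since `κ + l > 0`, and then `X³ / (A X + W)` has a
prescribed value, which `cubic_ratio_lt` allows only once. -/
theorem eq_of_cubic_eq_zero (hC : s.C ≠ 0) (hT : s.T ≠ 0) (hν : 0 < s.kappa + l) {Y : ℝ}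
    (hX : 0 < X) (hY : 0 < Y) (hX0 : s.cubic l X = 0) (hY0 : s.cubic l Y = 0) : X = Y := by
  have hR := mul_pos (T_pos hT) (gain_pos hC)
  have hpos : ∀ {Z}, 0 < Z →
      2 * (s.kappa + l) * (s.A * Z + s.W) - s.T * (s.C ^ 2 / s.V) * Z ^ 3 = 0 →
      0 < s.A * Z + s.W := by
    intro Z hZ h
    have h1 : 0 < s.T * (s.C ^ 2 / s.V) * Z ^ 3 := by positivity
    have h2 : 0 < 2 * (s.kappa + l) * (s.A * Z + s.W) := by linarith
    exact pos_of_mul_pos_right h2 (by linarith)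
  have hlt : ∀ {Z Z'}, 0 < Z → Z < Z' →
      2 * (s.kappa + l) * (s.A * Z + s.W) - s.T * (s.C ^ 2 / s.V) * Z ^ 3 = 0 →
      2 * (s.kappa + l) * (s.A * Z' + s.W) - s.T * (s.C ^ 2 / s.V) * Z' ^ 3 = 0 → False := by
    intro Z Z' hZ hZZ h h'
    have h1 := mul_lt_mul_of_pos_left
      (cubic_ratio_lt s.W_pos hZ hZZ (hpos hZ h) (hpos (hZ.trans hZZ) h')) hR
    have h2 : s.T * (s.C ^ 2 / s.V) * (Z ^ 3 * (s.A * Z' + s.W))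
        = s.T * (s.C ^ 2 / s.V) * (Z' ^ 3 * (s.A * Z + s.W)) := by
      linear_combination (s.A * Z + s.W) * h' - (s.A * Z' + s.W) * h
    exact h1.ne h2
  rw [cubic_eq_zero_iff hC hT] at hX0 hY0
  rcases lt_trichotomy X Y with h | h | h
  · exact (hlt hX h hX0 hY0).elim
  · exact h
  · exact (hlt hY h hY0 hX0).elim

/-- Closed form of the optimal cost of an observable site. -/
theorem value_of_observable (hC : s.C ≠ 0) (hT : s.T ≠ 0) (l : ℝ) :
    (l ≤ s.whittleIndex s.x2 → s.value l = ((s.T * s.x2 + s.kappa + l : ℝ) : EReal)) ∧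
    (s.whittleIndex s.x2 < l → (s.A < 0 → l < s.whittleIndex s.xe) →
      (∃! X : ℝ, 0 < X ∧ s.cubic l X = 0) ∧
      ∀ X : ℝ, 0 < X → s.cubic l X = 0 →
        s.value l = ((s.T * X + s.V * (s.kappa + l) * (2 * s.A * X + s.W)
          / (s.C ^ 2 * X ^ 2) : ℝ) : EReal)) ∧
    (s.A < 0 → s.whittleIndex s.xe ≤ l → s.value l = ((s.T * s.xe : ℝ) : EReal)) := by
  have hx2 := x2_pos hC
  rw [whittleIndex_eq hC hT hx2.le]
  refine ⟨fun hl => ?_, fun hl hle => ?_, fun hA hl => ?_⟩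
  · have hd := passive_drift_x2_pos hC
    have h1 := (le_threshold_iff hC le_rfl hd.le).1 (by linarith : s.kappa + l ≤ s.threshold s.x2)
    have hX : s.IsOperatingPoint l s.x2 :=
      ⟨le_rfl, hd.le, by simp, mul_nonpos_of_nonneg_of_nonpos hd.le h1⟩
    rw [hX.value_eq hC hT, activity_x2 hC, mul_one, ← add_assoc]
  · have hJ2 : 0 < s.threshold s.x2 := by
      have := T_pos hT
      have := x1_neg hC
      rw [threshold_of_le le_rfl]
      exact div_pos (by positivity) (by linarith)
    have hν : 0 < s.kappa + l := by linarith
    obtain ⟨X, hX⟩ := exists_isOperatingPoint hC hT l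
    have hX0 : 0 < X := hx2.trans_le hX.x2_le
    have hroot : s.cubic l X = 0 := by
      rw [cubic_eq_zero_iff hC hT]
      -- The strict bounds on `l` exclude the two saturated operating points; the remaining kind is
      -- a critical point, hence a root of the cubic.
      rcases hX.trichotomy hC with ⟨h1, h2⟩ | ⟨h1, h2, h3⟩ | ⟨h1, h2⟩
      · rw [h1] at h2
        linarith
      · exact le_antisymm ((le_threshold_iff hC h1.le h2.le).1 h3.le)
          ((threshold_le_iff hC h1.le h2.le).1 h3.ge)
      · have hA : s.A < 0 := by
          by_contra! hA
          have := s.W_pos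
          have : 0 < 2 * s.A * X + s.W := by positivity
          linarith
        have h3 := hle hA
        rw [whittleIndex_eq hC hT (xe_pos hA).le] at h3
        have h4 : s.xe ≤ X := not_lt.1 fun h => ((passive_drift_pos_iff hA X).2 h).ne' h1
        have h5 := (strictMonoOn_threshold hC hT).monotoneOn (mem_Ici.2 (xe_pos hA).le)
          (mem_Ici.2 hX0.le) h4
        linarith
    refine ⟨⟨X, ⟨hX0, hroot⟩, fun Y hY => eq_of_cubic_eq_zero hC hT hν hY.1 hX0 hY.2 hroot⟩,
      fun Y hY hY0 => ?_⟩
    rw [eq_of_cubic_eq_zero hC hT hν hY hX0 hY0 hroot, hX.value_eq hC hT]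
    congr 2
    have hV := s.V_pos.ne'
    unfold activity
    field_simp
  · rw [whittleIndex_eq hC hT (xe_pos hA).le] at hl
    have hxe := x2_lt_xe hC hA
    have hd : 2 * s.A * s.xe + s.W = 0 := by linarith [two_A_mul_xe hA]
    have h1 := (threshold_le_iff hC hxe.le hd.ge).1 (by linarith : s.threshold s.xe ≤ s.kappa + l)
    have hX : s.IsOperatingPoint l s.xe :=
      ⟨hxe.le, hd.ge, mul_nonneg (by linarith) h1, by rw [hd, zero_mul]⟩
    have h2 : s.activity s.xe = 0 := by rw [activity, hd, zero_div]
    rw [hX.value_eq hC hT, h2, mul_zero, add_zero]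

theorem value_of_unobservable (hC : s.C = 0) (hA : s.A < 0) (l : ℝ) :
    s.value l = ((s.T * s.W / (2 * |s.A|) + min (l + s.kappa) 0 : ℝ) : EReal) := by
  have e : s.T * s.W / (2 * |s.A|) = s.T * s.xe := by
    rw [xe, abs_of_neg hA]
    have := hA.ne
    field_simp
  rw [(isDual_of_unobservable hC hA).value_eq l, e]

end ScalarSite

theorem mainTheorem3 {N M : ℕ} (hM : 0 < M) (hMN : M < N) (sites : Fin N → ScalarSite) :
    -- indexability and Whittle index of every detectable site
    (∀ s ∈ Set.range sites, (s.T ≠ 0 → s.C = 0 → s.A < 0) →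
      -- the relative value function exists and is unique up to an additive constant
      (∀ l : ℝ, ∃ h, s.IsRelativeValue l h ∧
        ∀ h', s.IsRelativeValue l h' → ∃ c : ℝ, ∀ S, 0 ≤ S → h' S = h S + c) ∧
      s.Indexable ∧
      (s.C = 0 ∨ s.T = 0 → ∀ S, 0 ≤ S → s.whittleIndex S = -s.kappa) ∧
      (s.C ≠ 0 → s.T ≠ 0 →
        (∀ S, 0 ≤ S → S ≤ s.x2 →
          s.whittleIndex S = -s.kappa + s.T * S ^ 2 / (S - s.x1)) ∧
        (∀ S, s.x2 < S → (s.A < 0 → S < s.xe) →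
          s.whittleIndex S =
            -s.kappa + s.C ^ 2 / (2 * s.V) * (s.T * S ^ 3 / (s.A * S + s.W))) ∧
        (∀ S, s.A < 0 → s.xe ≤ S →
          s.whittleIndex S = -s.kappa + s.T * s.C ^ 2 * S ^ 2 / (2 * |s.A| * s.V)))) ∧
    -- closed form of the optimal average cost of every site
    (∀ s ∈ Set.range sites, ∀ l : ℝ,
      IsLeast (s.taxedCosts l) (s.value l) ∧
      (s.T = 0 → s.value l = ((min (l + s.kappa) 0 : ℝ) : EReal)) ∧
      (s.T ≠ 0 → s.C = 0 → s.A < 0 →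
        s.value l = ((s.T * s.W / (2 * |s.A|) + min (l + s.kappa) 0 : ℝ) : EReal)) ∧
      (s.T ≠ 0 → s.C = 0 → 0 ≤ s.A → s.value l = ⊤) ∧
      (s.T ≠ 0 → s.C ≠ 0 →
        (l ≤ s.whittleIndex s.x2 →
          s.value l = ((s.T * s.x2 + s.kappa + l : ℝ) : EReal)) ∧
        (s.whittleIndex s.x2 < l → (s.A < 0 → l < s.whittleIndex s.xe) →
          (∃! X : ℝ, 0 < X ∧ s.cubic l X = 0) ∧
          ∀ X : ℝ, 0 < X → s.cubic l X = 0 →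
            s.value l = ((s.T * X + s.V * (s.kappa + l) * (2 * s.A * X + s.W)
              / (s.C ^ 2 * X ^ 2) : ℝ) : EReal)) ∧
        (s.A < 0 → s.whittleIndex s.xe ≤ l →
          s.value l = ((s.T * s.xe : ℝ) : EReal)))) ∧
    -- the dual function separates by site
    (∀ l : ℝ, IsLeast (lagrangianValues sites M l) (dualFunction sites M l) ∧
      dualFunction sites M l = (∑ i, (sites i).value l) - ((l * M : ℝ) : EReal)) ∧
    -- the dual function is concave (its hypograph is convex)
    Convex ℝ {q : ℝ × ℝ | (q.2 : EReal) ≤ dualFunction sites M q.1} ∧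
    -- its maximum is the lower bound on the achievable performance
    (∃ l₀ : ℝ, (∀ l, dualFunction sites M l ≤ dualFunction sites M l₀) ∧
      dualFunction sites M l₀ = relaxedPerformance sites M) ∧
    relaxedPerformance sites M ≤ optimalPerformance sites M := by
  refine ⟨?_, ?_, ?_⟩
  · rintro s -
    exact s.indexability
  · rintro s - l
    exact ⟨s.isLeast_value l, fun hT => (ScalarSite.isDual_of_T_eq_zero hT).value_eq l,
      fun _ hC hA => ScalarSite.value_of_unobservable hC hA l,
      fun hT hC hA => ScalarSite.value_eq_top hT hC hA l,
      fun hT hC => ScalarSite.value_of_observable hC hT l⟩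
  · obtain ⟨h1, h2, h3⟩ := duality hM hMN sites
    exact ⟨h1, h2, h3, relaxedPerformance_le_optimalPerformance sites M⟩
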